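/- **Setup.** Let $m,n\ge 0$ be integers with $n$ even and $N=m+n>2$; put $s=\lfloor N/2\rfloor$ and $i'=N+1-i$ for $1\le i\le N$. Let $V$ be an $N$-dimensional superspace with homogeneous basis $v_1,\dots,v_N$, exactly $n$ of them odd, whose parities $\bar i=|v_i|\in\mathbb Z/2$ satisfy $\bar i=\overline{i'}$ (and are otherwise arbitrary). Let $\vartheta_i=\pm1$ with $\vartheta_i=1$ if $\bar i=\bar 0$ and $\vartheta_i=-\vartheta_{i'}$ if $\bar i=\bar 1$. Let $\varepsilon_1,\dots,\varepsilon_s$ be a basis of the weight lattice with $(\varepsilon_i,\varepsilon_j)=\delta_{ij}(-1)^{\bar i}$, and set $\varepsilon_{i'}=-\varepsilon_i$ (so $\varepsilon_{s+1}=0$ if $N$ is odd). Put $X_{ij}=E_{ij}-(-1)^{\bar i(\bar i+\bar j)}\vartheta_i\vartheta_jE_{j'i'}$. For $1\le i\le s$ let $\alpha_i=\varepsilon_i-\varepsilon_{i+1}$, $\mathsf e_i=X_{i,i+1}$, $\mathsf f_i=(-1)^{\bar i}X_{i+1,i}$, $\mathsf h_i=(-1)^{\bar i}X_{ii}-(-1)^{\overline{i+1}}X_{i+1,i+1}$,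 with these exceptions for $i=s$ and $m$ even: if $\bar s=\bar 0$, then $\alpha_s=\varepsilon_{s-1}-\varepsilon_{s+1}$, $\mathsf e_s=X_{s-1,s+1}$, $\mathsf f_s=(-1)^{\overline{s-1}}X_{s+1,s-1}$, $\mathsf h_s=(-1)^{\overline{s-1}}X_{s-1,s-1}-(-1)^{\overline{s+1}}X_{s+1,s+1}$; if $\bar s=\bar 1$, then $\alpha_s=2\varepsilon_s$, $\mathsf e_s=E_{s,s+1}$, $\mathsf f_s=-2E_{s+1,s}$, $\mathsf h_s=-2X_{ss}$. Let $a_{ij}=(\alpha_i,\alpha_j)$; the parity of the root $\varepsilon_a-\varepsilon_b$ is $\bar a+\bar b$ (and that of $2\varepsilon_s$ is $\bar 0$). $U_q(\mathfrak{osp}(V))$ is the superalgebra over $\mathbb C(q^{1/2})$ generated by $e_i,f_i,q^{\pm h_i/2}$ ($1\le i\le s$), with $|e_i|=|f_i|=|\alpha_i|$ and $q^{\pm h_i/2}$ even, subject to $$q^{h_i/2}q^{h_j/2}=q^{h_j/2}q^{h_i/2},\quad q^{\pm h_i/2}q^{\mp h_i/2}=1,\quad q^{h_i/2}e_jq^{-h_i/2}=q^{a_{ij}/2}e_j,\quad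 q^{h_i/2}f_jq^{-h_i/2}=q^{-a_{ij}/2}f_j,$$ $$e_if_j-(-1)^{|e_i||f_j|}f_je_i=\delta_{ij}\frac{q^{h_i}-q^{-h_i}}{q-q^{-1}},$$ and the standard and higher order $q$-Serre relations for the $e_i$ and for the $f_i$; these relations generate the radical of the standard bilinear form on the free superalgebra on the $e_i$ (respectively the $f_i$), i.e. the form with $(1,1)=1$, $(1,x_jy)=0$, $(x_iu,y)=(u,\partial_iy)$, where $\partial_i1=0$ and $\partial_i(x_jy)=\delta_{ij}y+(-1)^{|\alpha_i||\alpha_j|}q^{a_{ij}}x_j\partial_i y$. It acts on $V$ (over $\mathbb C(q^{1/2})$) by $e_i\mapsto\mathsf e_i$, $f_i\mapsto\kappa_i\mathsf f_i$, $q^{\pm h_i/2}\mapsto q^{\pm\mathsf h_i/2}$, where $\kappa_s=\frac{q+q^{-1}}2$ if $m$ is even and $\bar s=\bar 1$, and $\kappa_i=1$ otherwise. It acts on $V\otimes V$ through $\Delta(e_i)=q^{h_i/2}\otimes e_i+e_i\otimes q^{-h_i/2}$, $\Delta(f_i)=q^{h_i/2}\otimes f_i+f_i\otimes q^{-h_i/2}$,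 $\Delta(q^{\pm h_i/2})=q^{\pm h_i/2}\otimes q^{\pm h_i/2}$ and the sign rule $(x\otimes y)(v\otimes w)=(-1)^{|y||v|}xv\otimes yw$. A nonzero vector $w$ is a *highest weight vector of weight $\mu$* if $e_iw=0$ and $q^{h_i/2}w=q^{\mu(\mathsf h_i)/2}w$ for all $i$. **Proposition.** Put $$w_1=v_1\otimes v_1,\qquad w_2=v_1\otimes v_2-(-1)^{\bar1(\bar1+\bar2)}q^{(-1)^{\bar1}}\,v_2\otimes v_1,\qquad w_3=\sum_{i=1}^Nc_i\,v_i\otimes v_{i'},$$ where the $c_i$ are uniquely determined by $c_1=1$; for $1\le a<s$, $$c_{a+1}=q^{\frac{(-1)^{\bar a}+(-1)^{\overline{a+1}}}2}\vartheta_a\vartheta_{a+1}c_a,\qquad c_{a'}=(-1)^{\bar a+\overline{a+1}}q^{\frac{(-1)^{\bar a}+(-1)^{\overline{a+1}}}2}\vartheta_a\vartheta_{a+1}c_{(a+1)'};$$ and - for odd $m$: $c_{s+1}=q^{(-1)^{\bar s}/2}\vartheta_s\vartheta_{s+1}c_s$ and $c_{s+2}=(-1)^{\bar s+\overline{s+1}}q^{(-1)^{\bar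 s}/2}\vartheta_s\vartheta_{s+1}c_{s+1}$; - for even $m$ and $\bar s=\bar 0$: $c_{s+1}=q^{\frac{(-1)^{\bar s}+(-1)^{\overline{s-1}}}2}\vartheta_{s-1}\vartheta_{s+1}c_{s-1}$; - for even $m$ and $\bar s=\bar 1$: $c_{s+1}=-q^{-2}c_s$. (a) $w_1,w_2,w_3$ are highest weight vectors of $V\otimes V$, of weights $2\varepsilon_1$, $\varepsilon_1+\varepsilon_2$ and $0$. (b) If $n\ne m$ and $(m,n)\neq(4,0)$, then $V\otimes V$ is generated as a $U_q(\mathfrak{osp}(V))$-module by $w_1,w_2,w_3$. (c) For all $m,n$, $V\otimes V$ is generated by $w_1,w_2,v_1\otimes v_{1'}$, and also by $w_1,w_2,v_{1'}\otimes v_1$. -/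

import Mathlib

/-! ### The radical of the bilinear form of a free superalgebra -/

namespace QSerre

section
variable {K ι : Type*} [Field K]

/-- The skew derivation `∂_i` of the free algebra on letters `x_j` with twist `τ`, on words:
`∂_i 1 = 0`, `∂_i (x_j y) = δ_{ij} y + τ i j · x_j ∂_i y`.
Elements of the free algebra are finitely supported functions on words. -/
noncomputable def skewDeriv [DecidableEq ι] (τ : ι → ι → K) (i : ι) : List ι → (List ι →₀ K)
  | [] => 0
  | j :: w => (if i = j then Finsupp.single w 1 else 0)
      + τ i j • Finsupp.lmapDomain K K (List.cons j) (skewDeriv τ i w)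

/-- The bilinear form on the free algebra, on pairs of words: `(1, 1) = 1`, `(1, x_j y) = 0` and
`(x_i u, y) = (u, ∂_i y)`. -/
noncomputable def pairing [DecidableEq ι] (τ : ι → ι → K) : List ι → List ι → K
  | [] => fun w => if w = [] then 1 else 0
  | i :: u => fun w => Finsupp.linearCombination K (pairing τ u) (skewDeriv τ i w)

/-- The radical of the bilinear form. -/
noncomputable def radical [DecidableEq ι] (τ : ι → ι → K) : Submodule K (List ι →₀ K) :=
  ⨅ u : List ι, LinearMap.ker (Finsupp.linearCombination K (pairing τ u))

/-- Evaluation of an element of the free algebra at elements `x_j` of an algebra `A`. -/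
noncomputable def evalWord (K : Type*) {ι A : Type*} [Field K] [Semiring A] [Algebra K A] (x : ι → A) :
    (List ι →₀ K) →ₗ[K] A :=
  Finsupp.linearCombination K (fun w => (w.map x).prod)

/-! The lemmas below serve only to show that the radical acts by zero on the modules constructed
later on. -/

noncomputable def dMap [DecidableEq ι] (τ : ι → ι → K) (i : ι) :
    (List ι →₀ K) →ₗ[K] (List ι →₀ K) :=
  Finsupp.linearCombination K (skewDeriv τ i)

noncomputable def consMap (i : ι) : (List ι →₀ K) →ₗ[K] (List ι →₀ K) :=
  Finsupp.lmapDomain K K (List.cons i)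

noncomputable def pMap [DecidableEq ι] (τ : ι → ι → K) (u : List ι) : (List ι →₀ K) →ₗ[K] K :=
  Finsupp.linearCombination K (pairing τ u)

noncomputable def scaleMap (χ : ι → K) : (List ι →₀ K) →ₗ[K] (List ι →₀ K) :=
  Finsupp.linearCombination K (fun w => Finsupp.single w ((w.map χ).prod))

theorem lin_ext {M : Type*} [AddCommMonoid M] [Module K M] {f g : (List ι →₀ K) →ₗ[K] M}
    (h0 : f (Finsupp.single [] 1) = g (Finsupp.single [] 1))
    (h : ∀ j z, f z = g z → f (consMap j z) = g (consMap j z)) : f = g := by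
  refine Finsupp.lhom_ext' fun w => LinearMap.ext_ring ?_
  show f (Finsupp.single w 1) = g (Finsupp.single w 1)
  induction w with
  | nil => exact h0
  | cons j w ih => simpa [consMap] using h j _ ih

theorem consMap_single (j : ι) (w : List ι) :
    consMap j (Finsupp.single w (1 : K)) = Finsupp.single (j :: w) 1 := by
  simp [consMap]

theorem lin_ext' {M : Type*} [AddCommMonoid M] [Module K M] {f g : (List ι →₀ K) →ₗ[K] M}
    (h : ∀ w, f (Finsupp.single w 1) = g (Finsupp.single w 1)) : f = g :=
  Finsupp.lhom_ext' fun w => LinearMap.ext_ring (h w)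

theorem dMap_nil [DecidableEq ι] (τ : ι → ι → K) (i : ι) :
    dMap τ i (Finsupp.single [] 1) = 0 := by
  simp [dMap, skewDeriv]

theorem dMap_cons [DecidableEq ι] (τ : ι → ι → K) (i j : ι) (z : List ι →₀ K) :
    dMap τ i (consMap j z) = (if i = j then z else 0) + τ i j • consMap j (dMap τ i z) := by
  have : dMap τ i ∘ₗ consMap j
      = (if i = j then LinearMap.id else 0) + τ i j • (consMap j ∘ₗ dMap τ i) := by
    refine lin_ext' fun w => ?_
    simp only [LinearMap.comp_apply, consMap_single, LinearMap.add_apply, LinearMap.smul_apply]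
    simp only [dMap, Finsupp.linearCombination_single, one_smul, skewDeriv, consMap]
    split_ifs <;> simp
  have h := LinearMap.congr_fun this z
  simp only [LinearMap.comp_apply, LinearMap.add_apply, LinearMap.smul_apply] at h
  rw [h]
  split_ifs <;> simp

theorem pMap_nil_nil [DecidableEq ι] (τ : ι → ι → K) : pMap τ [] (Finsupp.single [] 1) = 1 := by
  simp [pMap, pairing]

theorem pMap_nil_cons [DecidableEq ι] (τ : ι → ι → K) (j : ι) (z : List ι →₀ K) :
    pMap τ [] (consMap j z) = 0 := by
  have : pMap τ [] ∘ₗ consMap j = 0 := by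
    refine lin_ext' fun w => ?_
    simp only [LinearMap.comp_apply, consMap_single]
    simp [pMap, pairing]
  exact LinearMap.congr_fun this z

theorem pMap_cons [DecidableEq ι] (τ : ι → ι → K) (i : ι) (u : List ι) (z : List ι →₀ K) :
    pMap τ (i :: u) z = pMap τ u (dMap τ i z) := by
  have : pMap τ (i :: u) = pMap τ u ∘ₗ dMap τ i := by
    refine lin_ext' fun w => ?_
    simp [pMap, pairing, dMap]
  exact LinearMap.congr_fun this z

theorem scaleMap_nil (χ : ι → K) :
    scaleMap χ (Finsupp.single [] 1) = Finsupp.single [] 1 := by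
  simp [scaleMap]

theorem scaleMap_cons (χ : ι → K) (j : ι) (z : List ι →₀ K) :
    scaleMap χ (consMap j z) = χ j • consMap j (scaleMap χ z) := by
  have : scaleMap χ ∘ₗ consMap j = χ j • (consMap j ∘ₗ scaleMap χ) := by
    refine lin_ext' fun w => ?_
    simp [consMap, scaleMap]
  exact LinearMap.congr_fun this z

theorem evalWord_nil {A : Type*} [Semiring A] [Algebra K A] (x : ι → A) :
    evalWord K x (Finsupp.single [] 1) = 1 := by
  simp [evalWord]

theorem evalWord_cons {A : Type*} [Semiring A] [Algebra K A] (x : ι → A) (j : ι) (z : List ι →₀ K) :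
    evalWord K x (consMap j z) = x j * evalWord K x z := by
  have : evalWord K x ∘ₗ consMap j = LinearMap.mulLeft K (x j) ∘ₗ evalWord K x := by
    refine lin_ext' fun w => ?_
    simp [consMap, evalWord]
  exact LinearMap.congr_fun this z

theorem mem_radical [DecidableEq ι] (τ : ι → ι → K) (z : List ι →₀ K) :
    z ∈ radical τ ↔ ∀ u, pMap τ u z = 0 := by
  simp [radical, pMap]

theorem dMap_mem [DecidableEq ι] (τ : ι → ι → K) (i : ι) {z : List ι →₀ K} (hz : z ∈ radical τ) :
    dMap τ i z ∈ radical τ := by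
  rw [mem_radical] at *
  intro u
  rw [← pMap_cons]
  exact hz _

theorem dMap_scaleMap [DecidableEq ι] (τ : ι → ι → K) (χ : ι → K) (i : ι) (z : List ι →₀ K) :
    dMap τ i (scaleMap χ z) = χ i • scaleMap χ (dMap τ i z) := by
  have : dMap τ i ∘ₗ scaleMap χ = χ i • (scaleMap χ ∘ₗ dMap τ i) := by
    refine lin_ext ?_ fun j z ih => ?_
    · simp [scaleMap_nil, dMap_nil]
    · simp only [LinearMap.comp_apply, LinearMap.smul_apply] at ih ⊢
      simp only [scaleMap_cons, dMap_cons, map_smul, map_add, ih, smul_add]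
      by_cases h : i = j
      · subst h
        simp [smul_smul, mul_left_comm]
      · simp [h, smul_smul, mul_comm, mul_left_comm]
  exact LinearMap.congr_fun this z

theorem pMap_nil_scaleMap [DecidableEq ι] (τ : ι → ι → K) (χ : ι → K) (z : List ι →₀ K) :
    pMap τ [] (scaleMap χ z) = pMap τ [] z := by
  have : pMap τ [] ∘ₗ scaleMap χ = pMap τ [] := by
    refine lin_ext ?_ fun j z ih => ?_
    · simp [scaleMap_nil]
    · simp [scaleMap_cons, pMap_nil_cons]
  exact LinearMap.congr_fun this z

theorem scaleMap_mem [DecidableEq ι] (τ : ι → ι → K) (χ : ι → K) {z : List ι →₀ K}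
    (hz : z ∈ radical τ) : scaleMap χ z ∈ radical τ := by
  rw [mem_radical]
  intro u
  induction u generalizing z with
  | nil => rw [pMap_nil_scaleMap]; exact (mem_radical τ z).1 hz []
  | cons i u ih =>
    rw [pMap_cons, dMap_scaleMap, map_smul, ih (dMap_mem τ i hz), smul_zero]

/-- The right skew derivation attached to a twist with `τ i j = σ i j * κ i j`. -/
noncomputable def rWord [DecidableEq ι] (σ κ : ι → ι → K) (i : ι) : List ι → (List ι →₀ K)
  | [] => 0
  | j :: w => (if i = j then scaleMap (κ i) (Finsupp.single w 1) else 0)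
      + σ i j • consMap j (rWord σ κ i w)

noncomputable def rMap [DecidableEq ι] (σ κ : ι → ι → K) (i : ι) :
    (List ι →₀ K) →ₗ[K] (List ι →₀ K) :=
  Finsupp.linearCombination K (rWord σ κ i)

theorem rMap_nil [DecidableEq ι] (σ κ : ι → ι → K) (i : ι) :
    rMap σ κ i (Finsupp.single [] 1) = 0 := by
  simp [rMap, rWord]

theorem rMap_cons [DecidableEq ι] (σ κ : ι → ι → K) (i j : ι) (z : List ι →₀ K) :
    rMap σ κ i (consMap j z)
      = (if i = j then scaleMap (κ i) z else 0) + σ i j • consMap j (rMap σ κ i z) := by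
  have : rMap σ κ i ∘ₗ consMap j
      = (if i = j then scaleMap (κ i) else 0) + σ i j • (consMap j ∘ₗ rMap σ κ i) := by
    refine lin_ext' fun w => ?_
    simp only [LinearMap.comp_apply, consMap_single, LinearMap.add_apply, LinearMap.smul_apply]
    simp only [rMap, Finsupp.linearCombination_single, one_smul, rWord]
    split_ifs <;> simp
  have h := LinearMap.congr_fun this z
  simp only [LinearMap.comp_apply, LinearMap.add_apply, LinearMap.smul_apply] at h
  rw [h]
  split_ifs <;> simp

theorem dMap_rMap [DecidableEq ι] (σ κ : ι → ι → K) (hσ : ∀ i j, σ i j = σ j i)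
    (hκ : ∀ i j, κ i j = κ j i) (h2 : ∀ i j, σ i j * σ i j = 1) (i j : ι) (z : List ι →₀ K) :
    dMap (fun a b => σ a b * κ a b) i (rMap σ κ j z)
      = σ i j • rMap σ κ j (dMap (fun a b => σ a b * κ a b) i z) := by
  have : dMap (fun a b => σ a b * κ a b) i ∘ₗ rMap σ κ j
      = σ i j • (rMap σ κ j ∘ₗ dMap (fun a b => σ a b * κ a b) i) := by
    refine lin_ext ?_ fun k z ih => ?_
    · simp [rMap_nil, dMap_nil]
    · simp only [LinearMap.comp_apply, LinearMap.smul_apply] at ih ⊢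
      simp only [rMap_cons, dMap_cons, map_smul, map_add, ih, smul_add]
      by_cases h : j = k
      · subst h
        simp only [if_true, dMap_scaleMap]
        by_cases h' : i = j
        · subst h'
          simp only [if_true, smul_smul]
          match_scalars <;> first | ring1 | linear_combination (-κ i i) * h2 i i
        · simp only [h', if_false, map_zero, smul_zero, zero_add, smul_smul, hκ j i]
          match_scalars <;> first | ring1 | linear_combination (-κ i j) * h2 i j
      · by_cases h' : i = k
        · subst h'
          simp only [h, if_false, if_true, map_zero, smul_smul, zero_add, hσ j i]
          module
        · simp only [h, h', if_false, map_zero, smul_zero, zero_add, smul_smul]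
          module
  exact LinearMap.congr_fun this z

theorem pMap_nil_rMap [DecidableEq ι] (σ κ : ι → ι → K) (τ : ι → ι → K) (j : ι)
    (z : List ι →₀ K) : pMap τ [] (rMap σ κ j z) = pMap τ [] (dMap τ j z) := by
  have : pMap τ [] ∘ₗ rMap σ κ j = pMap τ [] ∘ₗ dMap τ j := by
    refine lin_ext ?_ fun k z ih => ?_
    · simp [rMap_nil, dMap_nil]
    · simp only [LinearMap.comp_apply, rMap_cons, dMap_cons, map_add, map_smul, pMap_nil_cons]
      split_ifs <;> simp [pMap_nil_scaleMap]
  exact LinearMap.congr_fun this z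

theorem rMap_mem [DecidableEq ι] (σ κ : ι → ι → K) (hσ : ∀ i j, σ i j = σ j i)
    (hκ : ∀ i j, κ i j = κ j i) (h2 : ∀ i j, σ i j * σ i j = 1) (j : ι) {z : List ι →₀ K}
    (hz : z ∈ radical (fun a b => σ a b * κ a b)) :
    rMap σ κ j z ∈ radical (fun a b => σ a b * κ a b) := by
  rw [mem_radical]
  intro u
  induction u generalizing z with
  | nil => rw [pMap_nil_rMap]; exact (mem_radical _ _).1 (dMap_mem _ j hz) []
  | cons i u ih =>
    rw [pMap_cons, dMap_rMap σ κ hσ hκ h2, map_smul, ih (dMap_mem _ i hz), smul_zero]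

theorem rMap_inv [DecidableEq ι] (σ κ : ι → ι → K) (hκ : ∀ i j, κ i j ≠ 0) (j : ι)
    (z : List ι →₀ K) :
    rMap σ (fun a b => (κ a b)⁻¹) j z
      = κ j j • dMap (fun a b => σ a b * κ a b) j (scaleMap (fun b => (κ j b)⁻¹) z) := by
  have : rMap σ (fun a b => (κ a b)⁻¹) j
      = κ j j • (dMap (fun a b => σ a b * κ a b) j ∘ₗ scaleMap (fun b => (κ j b)⁻¹)) := by
    refine lin_ext ?_ fun k z ih => ?_
    · simp [rMap_nil, dMap_nil, scaleMap_nil]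
    · simp only [LinearMap.comp_apply, LinearMap.smul_apply] at ih ⊢
      simp only [rMap_cons, scaleMap_cons, dMap_cons, map_smul, ih, smul_add, smul_smul]
      have h0 := hκ j k
      congr 1
      · by_cases h : j = k
        · subst h
          simp [hκ j j]
        · simp [h]
      · congr 1
        field_simp
  exact LinearMap.congr_fun this z

/-- The commutation of a lowering operator with a product of raising operators. -/
theorem commute_evalWord [DecidableEq ι] {A : Type*} [Ring A] [Algebra K A] (σ κ : ι → ι → K)
    (x : ι → A) (j : ι) (y a b : A) (c : K)
    (hy : ∀ i, y * x i = σ j i • (x i * y) + if j = i then c • (a - b) else 0)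
    (ha : ∀ i, a * x i = κ j i • (x i * a)) (hb : ∀ i, b * x i = (κ j i)⁻¹ • (x i * b))
    (z : List ι →₀ K) :
    y * evalWord K x z = evalWord K x (scaleMap (σ j) z) * y
      + c • (evalWord K x (rMap σ κ j z) * a)
      - c • (evalWord K x (rMap σ (fun a b => (κ a b)⁻¹) j z) * b) := by
  have comm : ∀ (a : A) (χ : ι → K), (∀ i, a * x i = χ i • (x i * a)) → ∀ z : List ι →₀ K,
      a * evalWord K x z = evalWord K x (scaleMap χ z) * a := by
    intro a χ h z
    have : LinearMap.mulLeft K a ∘ₗ evalWord K x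
        = LinearMap.mulRight K a ∘ₗ evalWord K x ∘ₗ scaleMap χ := by
      refine lin_ext ?_ fun k z ih => ?_
      · simp [evalWord_nil, scaleMap_nil]
      · simp only [LinearMap.comp_apply, LinearMap.mulLeft_apply, LinearMap.mulRight_apply]
          at ih ⊢
        rw [evalWord_cons, scaleMap_cons, map_smul, evalWord_cons, ← mul_assoc, h, smul_mul_assoc,
          mul_assoc, ih, smul_mul_assoc, mul_assoc]
    exact LinearMap.congr_fun this z
  have : LinearMap.mulLeft K y ∘ₗ evalWord K x
      = LinearMap.mulRight K y ∘ₗ evalWord K x ∘ₗ scaleMap (σ j)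
        + c • (LinearMap.mulRight K a ∘ₗ evalWord K x ∘ₗ rMap σ κ j)
        - c • (LinearMap.mulRight K b ∘ₗ evalWord K x ∘ₗ rMap σ (fun a b => (κ a b)⁻¹) j) := by
    refine lin_ext ?_ fun k z ih => ?_
    · simp [evalWord_nil, scaleMap_nil, rMap_nil]
    · simp only [LinearMap.comp_apply, LinearMap.mulLeft_apply, LinearMap.mulRight_apply,
        LinearMap.add_apply, LinearMap.sub_apply, LinearMap.smul_apply] at ih ⊢
      rw [evalWord_cons, ← mul_assoc, hy, add_mul, smul_mul_assoc, mul_assoc, ih]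
      simp only [scaleMap_cons, rMap_cons, map_smul, map_add, evalWord_cons, add_mul,
        smul_mul_assoc, mul_assoc, mul_add, mul_sub, mul_smul_comm, smul_add, smul_sub]
      by_cases h : j = k
      · subst h
        simp only [if_true, smul_mul_assoc, sub_mul, comm a _ ha, comm b _ hb, smul_smul]
        simp only [mul_comm c]
        abel
      · simp only [h, if_false, map_zero, zero_mul, add_zero, zero_add, smul_zero, smul_smul]
        simp only [mul_comm c]
  have h := LinearMap.congr_fun this z
  simpa using h

/-- A functional killed by every element of the radical stays so after a lowering operator. -/
theorem functional_step [DecidableEq ι] {M : Type*} [AddCommGroup M] [Module K M]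
    (σ κ : ι → ι → K) (hσ : ∀ i j, σ i j = σ j i) (hκ : ∀ i j, κ i j = κ j i)
    (h2 : ∀ i j, σ i j * σ i j = 1) (hκ0 : ∀ i j, κ i j ≠ 0) (x : ι → Module.End K M) (j : ι) (y a b : Module.End K M) (c : K)
    (hy : ∀ i, y * x i = σ j i • (x i * y) + if j = i then c • (a - b) else 0)
    (ha : ∀ i, a * x i = κ j i • (x i * a)) (hb : ∀ i, b * x i = (κ j i)⁻¹ • (x i * b))
    (φ : M →ₗ[K] K)
    (hφ : ∀ z ∈ radical (fun a b => σ a b * κ a b), ∀ v, φ (evalWord K x z v) = 0)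
    (z : List ι →₀ K) (hz : z ∈ radical (fun a b => σ a b * κ a b)) (v : M) :
    φ (y (evalWord K x z v)) = 0 := by
  have h := LinearMap.congr_fun (commute_evalWord σ κ x j y a b c hy ha hb z) v
  simp only [Module.End.mul_apply, LinearMap.add_apply, LinearMap.sub_apply,
    LinearMap.smul_apply] at h
  rw [h, map_sub, map_add, map_smul, map_smul, hφ _ (scaleMap_mem _ _ hz),
    hφ _ (rMap_mem σ κ hσ hκ h2 j hz), rMap_inv σ κ hκ0,
    hφ _ (Submodule.smul_mem _ _ (dMap_mem _ _ (scaleMap_mem _ _ hz)))]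
  simp

theorem functional_base [DecidableEq ι] {M : Type*} [AddCommGroup M] [Module K M] (τ : ι → ι → K)
    (x : ι → Module.End K M) (φ : M →ₗ[K] K) (hx : ∀ i v, φ (x i v) = 0)
    (z : List ι →₀ K) (hz : z ∈ radical τ) (v : M) : φ (evalWord K x z v) = 0 := by
  have : φ ∘ₗ LinearMap.applyₗ v ∘ₗ evalWord K x = φ v • pMap τ [] := by
    refine lin_ext ?_ fun k z ih => ?_
    · simp [evalWord_nil, pMap_nil_nil]
    · simp [evalWord_cons, pMap_nil_cons, hx]
  have h := LinearMap.congr_fun this z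
  simpa [(mem_radical _ _).1 hz []] using h

open scoped TensorProduct in
/-- If the radical kills `V`, it kills `V ⊗ V` for the twisted coproduct
`x ↦ g ⊗ x + x ⊗ k⁻¹`. -/
theorem tensor_kill [DecidableEq ι] {b : Type*} [Fintype b] [DecidableEq b] (τ : ι → ι → K)
    (x k ki g : ι → Module.End K (b → K)) (μ ν : ι → ι → K) (lam : ι → b → K)
    (hμν : ∀ i j, μ j i * ν i j = τ i j)
    (hk : ∀ i, ki i * k i = 1) (hk' : ∀ i j, k i * ki j = ki j * k i)
    (hgl : ∀ i a, g i (Pi.single a 1) = lam i a • Pi.single a 1)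
    (hg : ∀ j i, g j * x i = μ j i • (x i * g j))
    (hkx : ∀ i j, k i * x j = ν i j • (x j * k i))
    (hV : ∀ z ∈ radical τ, evalWord K x z = 0)
    (z : List ι →₀ K) (hz : z ∈ radical τ) :
    evalWord K (fun i => TensorProduct.map (g i) (x i) + TensorProduct.map (x i) (ki i)) z = 0 := by
  classical
  set X : ι → Module.End K ((b → K) ⊗[K] (b → K)) :=
    fun i => TensorProduct.map (g i) (x i) + TensorProduct.map (x i) (ki i) with hX
  -- reduce to vectors `e_a ⊗ v`
  suffices H : ∀ (a : b) (v : b → K), evalWord K X z ((Pi.single a 1) ⊗ₜ v) = 0 by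
    refine TensorProduct.ext' fun u v => ?_
    have hu : u = ∑ a, u a • (Pi.single a (1 : K) : b → K) := by
      ext c; simp [Finset.sum_apply, Pi.single_apply]
    rw [hu, TensorProduct.sum_tmul, map_sum]
    simp [← TensorProduct.smul_tmul', H]
  intro a v
  let XH : ι → Module.End K ((List ι →₀ K) ⊗[K] (b → K)) := fun j =>
    TensorProduct.map (lam j a • scaleMap (μ j)) (x j) + TensorProduct.map (consMap j) (ki j)
  let C : (List ι →₀ K) →ₗ[K] ((List ι →₀ K) ⊗[K] (b → K)) :=
    LinearMap.applyₗ ((Finsupp.single [] (1 : K)) ⊗ₜ[K] v) ∘ₗ evalWord K XH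
  have C_nil : C (Finsupp.single [] 1) = (Finsupp.single [] 1) ⊗ₜ v := by
    simp [C, evalWord_nil]
  have C_cons : ∀ j z, C (consMap j z) = XH j (C z) := by
    intro j z; simp [C, evalWord_cons]
  let T : ι → Module.End K ((List ι →₀ K) ⊗[K] (b → K)) := fun i =>
    TensorProduct.map (dMap τ i) (k i)
  have TX : ∀ i j, T i * XH j = (if i = j then 1 else 0) + τ i j • (XH j * T i) := by
    intro i j
    refine TensorProduct.ext' fun y u => ?_
    have h1 : k i (x j u) = ν i j • x j (k i u) := LinearMap.congr_fun (hkx i j) u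
    have h2 : k i (ki j u) = ki j (k i u) := LinearMap.congr_fun (hk' i j) u
    have h3 : ki j (k j u) = u := LinearMap.congr_fun (hk j) u
    simp only [T, XH, Module.End.mul_apply, LinearMap.add_apply, TensorProduct.map_tmul, map_add,
      LinearMap.smul_apply, map_smul, dMap_scaleMap, dMap_cons, h1, h2, TensorProduct.add_tmul,
      smul_add, TensorProduct.tmul_smul, ← TensorProduct.smul_tmul', smul_smul]
    rw [← hμν i j]
    by_cases h : i = j
    · subst h
      simp only [if_true, h3, Module.End.one_apply]
      module
    · simp only [h, if_false, TensorProduct.zero_tmul, LinearMap.zero_apply]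
      module
  have TC : ∀ i z, T i (C z) = C (dMap τ i z) := by
    intro i z
    have : T i ∘ₗ C = C ∘ₗ dMap τ i := by
      refine lin_ext ?_ fun j z ih => ?_
      · simp [C_nil, T, dMap_nil]
      · simp only [LinearMap.comp_apply] at ih ⊢
        have h := LinearMap.congr_fun (TX i j) (C z)
        simp only [Module.End.mul_apply, LinearMap.add_apply, LinearMap.smul_apply] at h
        rw [C_cons, h, ih, dMap_cons, map_add, map_smul, C_cons]
        split_ifs <;> simp
    exact LinearMap.congr_fun this z
  let R : List ι → ((List ι →₀ K) ⊗[K] (b → K)) →ₗ[K] (b → K) := fun u =>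
    TensorProduct.lift ((LinearMap.lsmul K (b → K)) ∘ₗ pMap τ u)
  have R_tmul : ∀ u y w, R u (y ⊗ₜ w) = pMap τ u y • w := by
    intro u y w; simp [R]
  have R0 : ∀ z, R [] (C z) = evalWord K x (scaleMap (fun j => lam j a) z) v := by
    intro z
    have : R [] ∘ₗ C = LinearMap.applyₗ v ∘ₗ evalWord K x ∘ₗ scaleMap (fun j => lam j a) := by
      refine lin_ext ?_ fun j z ih => ?_
      · simp [C_nil, R_tmul, scaleMap_nil, evalWord_nil, pMap_nil_nil]
      · simp only [LinearMap.comp_apply, LinearMap.applyₗ_apply_apply] at ih ⊢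
        have : ∀ y, R [] (XH j y) = lam j a • x j (R [] y) := by
          intro y
          have : R [] ∘ₗ XH j = lam j a • (x j ∘ₗ R []) := by
            refine TensorProduct.ext' fun y u => ?_
            simp [XH, R_tmul, pMap_nil_cons, pMap_nil_scaleMap, smul_smul]
          exact LinearMap.congr_fun this y
        rw [C_cons, this, ih, scaleMap_cons, map_smul, evalWord_cons]
        simp
    exact LinearMap.congr_fun this z
  have RC : ∀ u z, z ∈ radical τ → R u (C z) = 0 := by
    intro u
    induction u with
    | nil => intro z hz; rw [R0, hV _ (scaleMap_mem _ _ hz)]; simp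
    | cons i u ih =>
      intro z hz
      have h1 : ∀ y, R u (T i y) = k i (R (i :: u) y) := by
        intro y
        have : R u ∘ₗ T i = k i ∘ₗ R (i :: u) := by
          refine TensorProduct.ext' fun y u => ?_
          simp [T, R_tmul, pMap_cons]
        exact LinearMap.congr_fun this y
      have h2 := h1 (C z)
      rw [TC, ih _ (dMap_mem τ i hz)] at h2
      have h3 := LinearMap.congr_fun (hk i) (R (i :: u) (C z))
      rw [Module.End.mul_apply, ← h2] at h3
      simpa using h3.symm
  let π : (List ι →₀ K) →ₗ[K] (b → K) := LinearMap.applyₗ (Pi.single a 1) ∘ₗ evalWord K x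
  have π_scale : ∀ j y, lam j a • π (scaleMap (μ j) y) = g j (π y) := by
    intro j y
    have : lam j a • (π ∘ₗ scaleMap (μ j)) = g j ∘ₗ π := by
      refine lin_ext ?_ fun i y ih => ?_
      · simp [π, scaleMap_nil, evalWord_nil, hgl]
      · simp only [LinearMap.comp_apply, LinearMap.smul_apply] at ih ⊢
        have h := LinearMap.congr_fun (hg j i) (π y)
        simp only [Module.End.mul_apply, LinearMap.smul_apply] at h
        have e1 : ∀ y, π (consMap i y) = x i (π y) := by
          intro y; simp [π, evalWord_cons]
        rw [scaleMap_cons, map_smul, e1, e1, h, ← ih, map_smul, smul_comm]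
    exact LinearMap.congr_fun this y
  have key : evalWord K X z ((Pi.single a 1) ⊗ₜ v) = TensorProduct.map π LinearMap.id (C z) := by
    have : LinearMap.applyₗ ((Pi.single a 1) ⊗ₜ v) ∘ₗ evalWord K X
        = TensorProduct.map π LinearMap.id ∘ₗ C := by
      refine lin_ext ?_ fun j z ih => ?_
      · simp [C_nil, evalWord_nil, π]
      · simp only [LinearMap.comp_apply, LinearMap.applyₗ_apply_apply] at ih ⊢
        rw [evalWord_cons, C_cons, Module.End.mul_apply, ih]
        have : X j ∘ₗ TensorProduct.map π LinearMap.id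
            = TensorProduct.map π LinearMap.id ∘ₗ XH j := by
          refine TensorProduct.ext' fun y u => ?_
          have e1 : π (consMap j y) = x j (π y) := by simp [π, evalWord_cons]
          simp [X, XH, e1, π_scale]
        exact LinearMap.congr_fun this _
    exact LinearMap.congr_fun this z
  rw [key]
  apply (TensorProduct.piScalarRight K K (b → K) b).injective
  rw [map_zero]
  funext d
  let P : ((List ι →₀ K) ⊗[K] (b → K)) →ₗ[K] (List ι →₀ K) :=
    TensorProduct.lift ((LinearMap.lsmul K (List ι →₀ K)).flip.compl₂ (LinearMap.proj d))
  have hP : ∀ y w, P (y ⊗ₜ w) = w d • y := by intro y w; simp [P]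
  have e1 : ∀ y, (TensorProduct.piScalarRight K K (b → K) b)
      (TensorProduct.map π LinearMap.id y) d = π (P y) := by
    intro y
    induction y with
    | zero => simp
    | add y y' h h' => simp only [map_add, Pi.add_apply, h, h']
    | tmul y w => simp [hP]
  rw [e1]
  have : P (C z) ∈ radical τ := by
    rw [mem_radical]
    intro u
    have e2 : ∀ y, pMap τ u (P y) = (R u y) d := by
      intro y
      induction y with
      | zero => simp
      | add y y' h h' => simp only [map_add, Pi.add_apply, h, h']
      | tmul y w => simp [hP, R_tmul, mul_comm]
    rw [e2, RC u z hz]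
    rfl
  simp [π, hV _ this]

end
end QSerre

/-! ### The orthosymplectic quantum supergroup -/

namespace Osp

/-- The ground field `ℂ(q^{1/2})`. -/
def Kq : Type := RatFunc ℂ

noncomputable instance : Field Kq := inferInstanceAs (Field (RatFunc ℂ))

noncomputable instance : Algebra ℂ Kq := inferInstanceAs (Algebra ℂ (RatFunc ℂ))

/-- The variable `q^{1/2}`; thus `q^{k/2}` is `qh ^ k`. -/
noncomputable def qh : Kq := (RatFunc.X : RatFunc ℂ)

noncomputable def q : Kq := qh ^ 2

/-- `(-1)^x` for `x` in `ℤ/2`. -/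
def sgn (x : ZMod 2) : ℤ := if x = 0 then 1 else -1

/-- The data fixed throughout: `m`, `n` with `n` even and `m + n > 2`, the parities of the basis
vectors of `V = ℂ^{m|n}`, symmetric under `i ↦ i' = N + 1 - i`, which is `Fin.rev` here, and the
signs `θ_i`. The basis is indexed by `Fin (m + n)`, so that the index `i` of `v_i` in the usual
numbering `1, …, N` corresponds to `i - 1`. -/
structure Datum (m n : ℕ) where
  even_n : Even n
  two_lt : 2 < m + n
  parity : Fin (m + n) → ZMod 2
  card_odd : (Finset.univ.filter fun i => parity i = 1).card = n
  parity_rev : ∀ i, parity i.rev = parity i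
  theta : Fin (m + n) → ℤ
  theta_sign : ∀ i, theta i = 1 ∨ theta i = -1
  theta_even : ∀ i, parity i = 0 → theta i = 1
  theta_odd : ∀ i, parity i = 1 → theta i = -theta i.rev

variable {m n : ℕ}

/-- `s = ⌊N / 2⌋`, the number of simple roots. -/
abbrev rk (m n : ℕ) : ℕ := (m + n) / 2

namespace Datum

theorem rk_pos (D : Datum m n) : 0 < rk m n := by
  have := D.two_lt; unfold rk; omega

/-- The index of `v_s`. -/
def last (D : Datum m n) : Fin (m + n) :=
  ⟨rk m n - 1, by have := D.rk_pos; unfold rk at *; omega⟩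

/-- `m` even and `v_s` even: the Dynkin diagram has a fork. -/
def Fork (D : Datum m n) : Prop := Even m ∧ D.parity D.last = 0

/-- `m` even and `v_s` odd: the last simple root is `2ε_s`. -/
def Long (D : Datum m n) : Prop := Even m ∧ D.parity D.last = 1

/-- The `i`-th simple root is `ε_a - ε_b` with `a = fst i`, `b = snd i`:
`ε_i - ε_{i+1}` in general, `ε_{s-1} - ε_{s+1} = ε_{s-1} + ε_s` for the last root in the fork case,
and `ε_s - ε_{s+1} = 2ε_s` for the last root in the long case. -/
noncomputable def fst (D : Datum m n) (i : Fin (rk m n)) : Fin (m + n) :=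
  open Classical in
  ⟨if D.Fork ∧ (i : ℕ) = rk m n - 1 then (i : ℕ) - 1 else i, by
    have := i.2; unfold rk at *; split_ifs <;> omega⟩

/-- See `fst`. -/
def snd (D : Datum m n) (i : Fin (rk m n)) : Fin (m + n) :=
  ⟨(i : ℕ) + 1, by have := i.2; have := D.two_lt; unfold rk at *; omega⟩

/-- The functional `ε_b` on the Cartan subalgebra in the basis `ε_1, …, ε_s` of the weight lattice:
`ε_{b'} = -ε_b`, and `ε_{s+1} = 0` for odd `N`. -/
def eps (_D : Datum m n) (b : Fin (m + n)) : Fin (rk m n) → ℤ :=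
  fun r => if (b : ℕ) = r then 1 else if (b.rev : ℕ) = r then -1 else 0

/-- The bilinear form on the weight lattice, `(ε_i, ε_j) = δ_{ij} (-1)^{|i|}`. -/
def form (D : Datum m n) (μ ν : Fin (rk m n) → ℤ) : ℤ :=
  ∑ r : Fin (rk m n), sgn (D.parity ⟨r, by have := r.2; unfold rk at *; omega⟩) * μ r * ν r

/-- The simple roots. -/
noncomputable def root (D : Datum m n) (i : Fin (rk m n)) : Fin (rk m n) → ℤ :=
  D.eps (D.fst i) - D.eps (D.snd i)

/-- The symmetrized Cartan matrix. -/
noncomputable def cartan (D : Datum m n) (i j : Fin (rk m n)) : ℤ := D.form (D.root i) (D.root j)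

/-- The parity of the `i`-th simple root, i.e. of the generators `e_i` and `f_i`. -/
noncomputable def rootParity (D : Datum m n) (i : Fin (rk m n)) : ZMod 2 :=
  D.parity (D.fst i) + D.parity (D.snd i)

/-- The element `X_{ij} = E_{ij} - (-1)^{|i|(|i|+|j|)} θ_i θ_j E_{j'i'}` of `osp(V)`. -/
def X (D : Datum m n) (i j : Fin (m + n)) : Matrix (Fin (m + n)) (Fin (m + n)) ℤ :=
  Matrix.single i j 1
    - Matrix.single j.rev i.rev
        (sgn (D.parity i * (D.parity i + D.parity j)) * D.theta i * D.theta j)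

open Classical in
/-- The Chevalley generators `e_i` of `osp(V)`. -/
noncomputable def chevE (D : Datum m n) (i : Fin (rk m n)) :
    Matrix (Fin (m + n)) (Fin (m + n)) ℤ :=
  if D.Long ∧ (i : ℕ) = rk m n - 1 then Matrix.single (D.fst i) (D.snd i) 1
  else D.X (D.fst i) (D.snd i)

open Classical in
/-- The Chevalley generators `f_i` of `osp(V)`. -/
noncomputable def chevF (D : Datum m n) (i : Fin (rk m n)) :
    Matrix (Fin (m + n)) (Fin (m + n)) ℤ :=
  if D.Long ∧ (i : ℕ) = rk m n - 1 then Matrix.single (D.snd i) (D.fst i) (-2)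
  else sgn (D.parity (D.fst i)) • D.X (D.snd i) (D.fst i)

open Classical in
/-- The Chevalley generators `h_i` of `osp(V)`, which are diagonal matrices. -/
noncomputable def chevH (D : Datum m n) (i : Fin (rk m n)) :
    Matrix (Fin (m + n)) (Fin (m + n)) ℤ :=
  if D.Long ∧ (i : ℕ) = rk m n - 1 then (-2 : ℤ) • D.X (D.fst i) (D.fst i)
  else sgn (D.parity (D.fst i)) • D.X (D.fst i) (D.fst i)
    - sgn (D.parity (D.snd i)) • D.X (D.snd i) (D.snd i)

end Datum

/-- The names of the generators `e_i`, `f_i`, `q^{h_i/2}`, `q^{-h_i/2}`. -/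
inductive Gen (r : ℕ) : Type
  | e (i : Fin r)
  | f (i : Fin r)
  | k (i : Fin r)
  | kinv (i : Fin r)

namespace Datum

/-- The twist `(-1)^{|α_i||α_j|} q^{(α_i, α_j)}`. -/
noncomputable def twist (D : Datum m n) (i j : Fin (rk m n)) : Kq :=
  (sgn (D.rootParity i * D.rootParity j) : Kq) * q ^ D.cartan i j

open FreeAlgebra in
/-- The defining relations of `U_q(osp(V))`. The last two families are the (standard and higher
order) `q`-Serre relations: the ideal of `q`-Serre relations of the positive, respectively
negative, half is the radical of the standard bilinear form of the free superalgebra in the `e_i`,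
respectively the `f_i`. -/
inductive Rel (D : Datum m n) :
    FreeAlgebra Kq (Gen (rk m n)) → FreeAlgebra Kq (Gen (rk m n)) → Prop
  | k_comm (i j) : Rel D (ι Kq (.k i) * ι Kq (.k j)) (ι Kq (.k j) * ι Kq (.k i))
  | k_kinv (i) : Rel D (ι Kq (.k i) * ι Kq (.kinv i)) 1
  | kinv_k (i) : Rel D (ι Kq (.kinv i) * ι Kq (.k i)) 1
  | k_e (i j) : Rel D (ι Kq (.k i) * ι Kq (.e j) * ι Kq (.kinv i))
      (qh ^ D.cartan i j • ι Kq (.e j))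
  | k_f (i j) : Rel D (ι Kq (.k i) * ι Kq (.f j) * ι Kq (.kinv i))
      (qh ^ (-D.cartan i j) • ι Kq (.f j))
  | e_f (i j) : Rel D
      (ι Kq (.e i) * ι Kq (.f j)
        - (sgn (D.rootParity i * D.rootParity j) : Kq) • (ι Kq (.f j) * ι Kq (.e i)))
      (if i = j then (q - q⁻¹)⁻¹ • (ι Kq (.k i) ^ 2 - ι Kq (.kinv i) ^ 2) else 0)
  | serre_e (z : List (Fin (rk m n)) →₀ Kq) (hz : z ∈ QSerre.radical D.twist) :
      Rel D (QSerre.evalWord Kq (fun i => ι Kq (.e i)) z) 0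
  | serre_f (z : List (Fin (rk m n)) →₀ Kq) (hz : z ∈ QSerre.radical D.twist) :
      Rel D (QSerre.evalWord Kq (fun i => ι Kq (.f i)) z) 0

/-- The orthosymplectic quantum supergroup `U_q(osp(V))`, as an algebra over `ℂ(q^{1/2})`. -/
def Uq (D : Datum m n) : Type := RingQuot D.Rel

noncomputable instance (D : Datum m n) : Ring D.Uq := inferInstanceAs (Ring (RingQuot D.Rel))

noncomputable instance (D : Datum m n) : Algebra Kq D.Uq :=
  inferInstanceAs (Algebra Kq (RingQuot D.Rel))

/-- The generators of `U_q(osp(V))`. -/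
noncomputable def gen (D : Datum m n) (g : Gen (rk m n)) : D.Uq :=
  RingQuot.mkAlgHom Kq D.Rel (FreeAlgebra.ι Kq g)

/-- The underlying space of the first fundamental representation, with coordinates relative to the
basis `v_1, …, v_N`. -/
abbrev V (_D : Datum m n) : Type := Fin (m + n) → Kq

/-- The basis vector `v_b`. -/
noncomputable def v (D : Datum m n) (b : Fin (m + n)) : D.V := Pi.single b 1

open Classical in
/-- The scalar `κ_i`. -/
noncomputable def kappa (D : Datum m n) (i : Fin (rk m n)) : Kq :=
  if D.Long ∧ (i : ℕ) = rk m n - 1 then (q + q⁻¹) / 2 else 1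

/-- The matrices by which the generators act on `V`: `e_i`, `κ_i f_i`, `q^{± h_i/2}`. -/
noncomputable def mat (D : Datum m n) :
    Gen (rk m n) → Matrix (Fin (m + n)) (Fin (m + n)) Kq
  | .e i => (D.chevE i).map (fun x : ℤ => (x : Kq))
  | .f i => D.kappa i • (D.chevF i).map (fun x : ℤ => (x : Kq))
  | .k i => Matrix.diagonal fun b => qh ^ D.chevH i b b
  | .kinv i => Matrix.diagonal fun b => qh ^ (-D.chevH i b b)

/-- The operators by which the generators act on `V`. -/
noncomputable def op (D : Datum m n) (g : Gen (rk m n)) : Module.End Kq D.V :=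
  Matrix.toLin' (D.mat g)

/-- The operator `v_b ↦ (-1)^{|x||b|} v_b` on `V`, where `x` is a parity. -/
noncomputable def signOp (D : Datum m n) (x : ZMod 2) : Module.End Kq D.V :=
  Matrix.toLin' (Matrix.diagonal fun b => (sgn (x * D.parity b) : Kq))

open scoped TensorProduct

/-- The operators by which the generators act on `V ⊗ V`, through the coproduct
`Δ(e_i) = q^{h_i/2} ⊗ e_i + e_i ⊗ q^{-h_i/2}`, `Δ(f_i) = q^{h_i/2} ⊗ f_i + f_i ⊗ q^{-h_i/2}`,
`Δ(q^{± h_i/2}) = q^{± h_i/2} ⊗ q^{± h_i/2}`, and the rule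
`(x ⊗ y)(v ⊗ w) = (-1)^{|y||v|} x v ⊗ y w`. -/
noncomputable def op₂ (D : Datum m n) : Gen (rk m n) → Module.End Kq (D.V ⊗[Kq] D.V)
  | .e i => TensorProduct.map (D.op (.k i) * D.signOp (D.rootParity i)) (D.op (.e i))
      + TensorProduct.map (D.op (.e i)) (D.op (.kinv i))
  | .f i => TensorProduct.map (D.op (.k i) * D.signOp (D.rootParity i)) (D.op (.f i))
      + TensorProduct.map (D.op (.f i)) (D.op (.kinv i))
  | .k i => TensorProduct.map (D.op (.k i)) (D.op (.k i))
  | .kinv i => TensorProduct.map (D.op (.kinv i)) (D.op (.kinv i))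

/-! The lemmas below show that these operators satisfy the defining relations. -/

theorem sgn_add (x y : ZMod 2) : sgn (x + y) = sgn x * sgn y := by revert x y; decide
theorem sgn_sq (x : ZMod 2) : sgn x * sgn x = 1 := by revert x; decide
theorem sgn_sq' (x : ZMod 2) : (sgn x : Kq) * (sgn x : Kq) = 1 := by
  rw [← Int.cast_mul, sgn_sq, Int.cast_one]
theorem par_cases (x : ZMod 2) : x = 0 ∨ x = 1 := by revert x; decide

theorem fst_val (D : Datum m n) (i : Fin (rk m n)) :
    (D.Fork ∧ (i : ℕ) = rk m n - 1 ∧ (D.fst i : ℕ) = i - 1) ∨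
      (¬ (D.Fork ∧ (i : ℕ) = rk m n - 1) ∧ (D.fst i : ℕ) = i) := by
  unfold fst
  by_cases h : D.Fork ∧ (i : ℕ) = rk m n - 1
  · left; simp [h]
  · right; exact ⟨h, by simp [h]⟩

theorem snd_val (D : Datum m n) (i : Fin (rk m n)) : (D.snd i : ℕ) = i + 1 := rfl

theorem fork_even (D : Datum m n) (h : D.Fork) : Even (m + n) := h.1.add D.even_n
theorem long_even (D : Datum m n) (h : D.Long) : Even (m + n) := h.1.add D.even_n
theorem not_fork_of_long (D : Datum m n) (h : D.Long) : ¬ D.Fork := by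
  intro h'
  have := h.2.symm.trans h'.2
  exact absurd this (by decide)

theorem fork_or_long (D : Datum m n) (h : Even (m + n)) : D.Fork ∨ D.Long := by
  have hm : Even m := by
    have := D.even_n
    rw [Nat.even_add] at h
    exact h.2 this
  rcases par_cases (D.parity D.last) with h' | h'
  · exact Or.inl ⟨hm, h'⟩
  · exact Or.inr ⟨hm, h'⟩

theorem long_iff (D : Datum m n) (i : Fin (rk m n)) :
    (D.Long ∧ (i : ℕ) = rk m n - 1) ↔ D.snd i = (D.fst i).rev := by
  rw [Fin.ext_iff, Fin.val_rev, snd_val]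
  have hi := i.2
  have h2 := D.two_lt
  constructor
  · rintro ⟨h, h'⟩
    have := D.long_even h
    have hf := D.not_fork_of_long h
    rcases D.fst_val i with ⟨h1, _⟩ | ⟨_, h1⟩
    · exact absurd h1 hf
    · rw [h1]; unfold rk at *; rw [Nat.even_iff] at this; omega
  · intro h
    rcases D.fst_val i with ⟨h1, h3, h4⟩ | ⟨h1, h3⟩
    · have := D.fork_even h1
      rw [h4] at h; unfold rk at *; rw [Nat.even_iff] at this; omega
    · rw [h3] at h
      have hi' : (i : ℕ) = rk m n - 1 := by unfold rk at *; omega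
      have he : Even (m + n) := by rw [Nat.even_iff]; unfold rk at *; omega
      rcases D.fork_or_long he with hf | hl
      · exact absurd ⟨hf, hi'⟩ h1
      · exact ⟨hl, hi'⟩

theorem fst_lt_snd (D : Datum m n) (i : Fin (rk m n)) : (D.fst i : ℕ) < D.snd i := by
  rw [snd_val]; rcases D.fst_val i with ⟨_, _, h⟩ | ⟨_, h⟩ <;> omega

theorem fst_lt_rk (D : Datum m n) (i : Fin (rk m n)) : (D.fst i : ℕ) < rk m n := by
  have := i.2; rcases D.fst_val i with ⟨_, _, h⟩ | ⟨_, h⟩ <;> omega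

theorem theta_sq (D : Datum m n) (b : Fin (m + n)) : D.theta b * D.theta b = 1 := by
  rcases D.theta_sign b with h | h <;> rw [h] <;> rfl

theorem eps_rev (D : Datum m n) (b : Fin (m + n)) : D.eps b.rev = - D.eps b := by
  funext r
  have := r.2
  have := b.2
  simp only [eps, Pi.neg_apply, Fin.val_rev]
  unfold rk at *
  split_ifs <;> first | rfl | omega

theorem form_eps (D : Datum m n) (x : Fin (m + n)) (μ : Fin (rk m n) → ℤ) :
    D.form (D.eps x) μ = if h : (x : ℕ) < rk m n then sgn (D.parity x) * μ ⟨x, h⟩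
      else if h' : (x.rev : ℕ) < rk m n then - (sgn (D.parity x) * μ ⟨x.rev, h'⟩) else 0 := by
  have hx := x.2
  unfold form eps
  split_ifs with h h'
  · rw [Finset.sum_eq_single ⟨x, h⟩]
    · simp
    · intro r _ hr
      have hr' : (x : ℕ) ≠ r := fun e => hr (Fin.ext e.symm)
      have : (x.rev : ℕ) ≠ r := by
        have := r.2; rw [Fin.val_rev]; unfold rk at *; omega
      simp only [hr', this, if_false, mul_zero, zero_mul]
    · simp
  · rw [Finset.sum_eq_single ⟨x.rev, h'⟩]
    · have : (x : ℕ) ≠ x.rev := by rw [Fin.val_rev] at *; unfold rk at *; omega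
      simp only [this, if_false, if_true]
      rw [show (⟨(x.rev : ℕ), _⟩ : Fin (m + n)) = x.rev from rfl, D.parity_rev]
      ring
    · intro r _ hr
      have hr' : (x.rev : ℕ) ≠ r := fun e => hr (Fin.ext e.symm)
      have : (x : ℕ) ≠ r := by
        have := r.2; unfold rk at *; omega
      simp only [hr', this, if_false, mul_zero, zero_mul]
    · simp
  · apply Finset.sum_eq_zero
    intro r _
    have h1 : (x : ℕ) ≠ r := by have := r.2; unfold rk at *; omega
    have h2 : (x.rev : ℕ) ≠ r := by have := r.2; unfold rk at *; omega
    simp only [h1, h2, if_false, mul_zero, zero_mul]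

theorem form_eps_eps (D : Datum m n) (x y : Fin (m + n)) :
    D.form (D.eps x) (D.eps y)
      = sgn (D.parity y) * ((if x = y then 1 else 0) - (if x = y.rev then 1 else 0)) := by
  rw [form_eps]
  have hx := x.2
  have hy := y.2
  have e1 : x = y → sgn (D.parity x) = sgn (D.parity y) := by rintro rfl; rfl
  have e2 : x = y.rev → sgn (D.parity x) = sgn (D.parity y) := by
    rintro rfl; rw [D.parity_rev]
  simp only [eps, Fin.ext_iff, Fin.val_rev] at *
  unfold rk
  split_ifs <;> omega

theorem form_comm (D : Datum m n) (μ ν : Fin (rk m n) → ℤ) : D.form μ ν = D.form ν μ := by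
  unfold form
  exact Finset.sum_congr rfl fun r _ => by ring

theorem form_sub_left (D : Datum m n) (μ μ' ν : Fin (rk m n) → ℤ) :
    D.form (μ - μ') ν = D.form μ ν - D.form μ' ν := by
  unfold form
  rw [← Finset.sum_sub_distrib]
  exact Finset.sum_congr rfl fun r _ => by simp only [Pi.sub_apply]; ring

theorem form_sub_right (D : Datum m n) (μ ν ν' : Fin (rk m n) → ℤ) :
    D.form μ (ν - ν') = D.form μ ν - D.form μ ν' := by
  rw [form_comm, form_sub_left, form_comm, D.form_comm ν']

theorem form_neg_left (D : Datum m n) (μ ν : Fin (rk m n) → ℤ) :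
    D.form (-μ) ν = - D.form μ ν := by
  unfold form
  rw [← Finset.sum_neg_distrib]
  exact Finset.sum_congr rfl fun r _ => by simp only [Pi.neg_apply]; ring

theorem cartan_comm (D : Datum m n) (i j : Fin (rk m n)) : D.cartan i j = D.cartan j i :=
  D.form_comm _ _

theorem X_self (D : Datum m n) (a : Fin (m + n)) :
    D.X a a = Matrix.single a a 1 - Matrix.single a.rev a.rev 1 := by
  unfold X
  have : sgn (D.parity a * (D.parity a + D.parity a)) = 1 := by
    generalize D.parity a = x; revert x; decide
  rw [this, one_mul, theta_sq]

theorem chevH_eq (D : Datum m n) (i : Fin (rk m n)) :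
    D.chevH i = sgn (D.parity (D.fst i)) • D.X (D.fst i) (D.fst i)
      - sgn (D.parity (D.snd i)) • D.X (D.snd i) (D.snd i) := by
  unfold chevH
  split_ifs with h
  · have h1 := (D.long_iff i).1 h
    have hl := D.not_fork_of_long h.1
    have h2 : D.fst i = D.last := by
      rcases D.fst_val i with ⟨h1, _⟩ | ⟨_, h1⟩
      · exact absurd h1 hl
      · apply Fin.ext; rw [h1, h.2]; rfl
    have h3 : sgn (D.parity (D.fst i)) = -1 := by rw [h2, h.1.2]; rfl
    rw [h1, D.parity_rev, h3, X_self, X_self, Fin.rev_rev]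
    module
  · rfl

theorem chevH_apply (D : Datum m n) (i : Fin (rk m n)) (x y : Fin (m + n)) :
    D.chevH i x y = if x = y then D.form (D.eps x) (D.root i) else 0 := by
  rw [chevH_eq, X_self, X_self, root, form_sub_right, form_eps_eps, form_eps_eps]
  simp only [Matrix.sub_apply, Matrix.smul_apply, Matrix.single_apply, smul_eq_mul]
  by_cases h : x = y
  · subst h
    simp only [and_self, if_true, eq_comm (b := x)]
  · have : ∀ c : Fin (m + n), ¬ (c = x ∧ c = y) := by rintro c ⟨rfl, rfl⟩; exact h rfl
    simp [h, this]

theorem chevE_weight (D : Datum m n) (i : Fin (rk m n)) (x y : Fin (m + n))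
    (h : D.chevE i x y ≠ 0) : D.eps x - D.eps y = D.root i := by
  have : (D.fst i = x ∧ D.snd i = y) ∨ ((D.snd i).rev = x ∧ (D.fst i).rev = y) := by
    by_contra hc
    push Not at hc
    apply h
    unfold chevE X
    split_ifs
    · rw [Matrix.single_apply, if_neg (fun e => hc.1 e.1 e.2)]
    · rw [Matrix.sub_apply, Matrix.single_apply, if_neg (fun e => hc.1 e.1 e.2),
        Matrix.single_apply, if_neg (fun e => hc.2 e.1 e.2), sub_zero]
  rcases this with ⟨rfl, rfl⟩ | ⟨rfl, rfl⟩
  · rfl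
  · rw [eps_rev, eps_rev, root]; abel

theorem chevF_weight (D : Datum m n) (i : Fin (rk m n)) (x y : Fin (m + n))
    (h : D.chevF i x y ≠ 0) : D.eps x - D.eps y = - D.root i := by
  have : (D.snd i = x ∧ D.fst i = y) ∨ ((D.fst i).rev = x ∧ (D.snd i).rev = y) := by
    by_contra hc
    push Not at hc
    apply h
    unfold chevF X
    split_ifs
    · rw [Matrix.single_apply, if_neg (fun e => hc.1 e.1 e.2)]
    · rw [Matrix.smul_apply, Matrix.sub_apply, Matrix.single_apply,
        if_neg (fun e => hc.1 e.1 e.2),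
        Matrix.single_apply, if_neg (fun e => hc.2 e.1 e.2), sub_zero, smul_zero]
  rcases this with ⟨rfl, rfl⟩ | ⟨rfl, rfl⟩
  · rw [root]; abel
  · rw [eps_rev, eps_rev, root]; abel

theorem single_mul (a b c d : Fin (m + n)) (x y : ℤ) :
    Matrix.single a b x * Matrix.single c d y = if b = c then Matrix.single a d (x * y) else 0 := by
  split_ifs with h
  · subst h; rw [Matrix.single_mul_single_same]
  · rw [Matrix.single_mul_single_of_ne (h := h)]

theorem single_neg (a b : Fin (m + n)) :
    (Matrix.single a b (-1) : Matrix _ _ ℤ) = - Matrix.single a b 1 := by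
  ext x y
  rw [Matrix.neg_apply, Matrix.single_apply, Matrix.single_apply]
  split_ifs <;> rfl

theorem classical_same (D : Datum m n) (i : Fin (rk m n)) :
    D.chevE i * D.chevF i - sgn (D.rootParity i * D.rootParity i) • (D.chevF i * D.chevE i)
      = D.chevH i := by
  by_cases h : D.Long ∧ (i : ℕ) = rk m n - 1
  · have h1 := (D.long_iff i).1 h
    have h2 : sgn (D.rootParity i * D.rootParity i) = 1 := by
      unfold rootParity
      rw [h1, D.parity_rev]
      generalize D.parity (D.fst i) = x; revert x; decide
    unfold chevE chevF chevH
    rw [if_pos h, if_pos h, if_pos h, h2, X_self, h1, single_mul, single_mul, if_pos rfl,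
      if_pos rfl]
    ext x y
    simp only [Matrix.sub_apply, Matrix.smul_apply, Matrix.single_apply, smul_eq_mul]
    split_ifs <;> simp
  · have h1 : D.snd i ≠ (D.fst i).rev := fun e => h ((D.long_iff i).2 e)
    have h2 := D.fst_lt_snd i
    have h3 : D.fst i ≠ D.snd i := fun e => by rw [e] at h2; omega
    rw [chevH_eq, X_self, X_self]
    unfold chevE chevF rootParity
    rw [if_neg h, if_neg h]
    generalize D.fst i = a at *
    generalize D.snd i = b at *
    have h4 : a.rev ≠ b := fun e => h1 e.symm
    have h5 : a ≠ b.rev := fun e => h1 (by rw [e, Fin.rev_rev])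
    have h6 : b.rev ≠ a := fun e => h5 e.symm
    unfold X
    rw [mul_smul_comm, smul_mul_assoc]
    simp only [mul_sub, sub_mul, single_mul, h1, h4, h5, h6, if_true, if_false]
    rcases par_cases (D.parity a) with ha | ha <;> rcases par_cases (D.parity b) with hb | hb <;>
    rcases D.theta_sign a with ta | ta <;> rcases D.theta_sign b with tb | tb <;>
    · simp only [ha, hb, ta, tb]
      simp (decide := true) [sgn, single_neg]
      try abel

theorem classical_ne (D : Datum m n) (i j : Fin (rk m n)) (hij : i ≠ j) :
    D.chevE i * D.chevF j - sgn (D.rootParity i * D.rootParity j) • (D.chevF j * D.chevE i)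
      = 0 := by
  have hij' : (i : ℕ) ≠ j := fun e => hij (Fin.ext e)
  have hi := i.2
  have hj := j.2
  have h2 := D.two_lt
  have si := D.snd_val i
  have sj := D.snd_val j
  have c1 : D.snd i ≠ D.snd j := by rw [Ne, Fin.ext_iff]; omega
  have c1' : (D.snd j).rev ≠ (D.snd i).rev := fun e => c1 (Fin.rev_injective e).symm
  have gen : ∀ i j : Fin (rk m n), (i : ℕ) ≠ j → D.snd i ≠ (D.fst j).rev := by
    intro i j hij h
    have hi := i.2
    have hj := j.2
    rw [Fin.ext_iff, Fin.val_rev, snd_val] at h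
    rcases D.fst_val j with ⟨hf, h1, h3⟩ | ⟨_, h1⟩
    · have := D.fork_even hf
      rw [Nat.even_iff] at this; unfold rk at *; omega
    · unfold rk at *; omega
  have c2 := gen i j hij'
  have c3' := gen j i (Ne.symm hij')
  have c2' : D.fst j ≠ (D.snd i).rev := fun e => c2 (by rw [e, Fin.rev_rev])
  have c3 : (D.fst i).rev ≠ D.snd j := fun e => c3' e.symm
  have c3'' : (D.snd j).rev ≠ D.fst i := fun e => c3' (by rw [← e, Fin.rev_rev])
  by_cases hf : D.fst i = D.fst j
  · -- the two branches of the fork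
    have hF : D.Fork := by
      rcases D.fst_val i with ⟨h, _⟩ | ⟨_, hi1⟩
      · exact h
      rcases D.fst_val j with ⟨h, _⟩ | ⟨_, hj1⟩
      · exact h
      rw [hf] at hi1; omega
    have hl : ¬ D.Long := fun h => D.not_fork_of_long h hF
    have he := D.fork_even hF
    rw [Nat.even_iff] at he
    have hb : D.snd i = (D.snd j).rev ∧ (D.snd i = D.last ∨ D.snd j = D.last) := by
      have hl : (D.last : ℕ) = rk m n - 1 := rfl
      simp only [Fin.ext_iff, Fin.val_rev] at hf ⊢
      rw [hl]
      rcases D.fst_val i with ⟨_, hi1, hi2⟩ | ⟨_, hi2⟩ <;>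
      rcases D.fst_val j with ⟨_, hj1, hj2⟩ | ⟨_, hj2⟩ <;> unfold rk at * <;> omega
    have hpi : D.parity (D.snd i) = 0 := by
      rcases hb.2 with h | h
      · rw [h]; exact hF.2
      · rw [hb.1, D.parity_rev, h]; exact hF.2
    have hpj : D.parity (D.snd j) = 0 := by
      rw [← hpi, hb.1, D.parity_rev]
    have hb' : D.snd j = (D.snd i).rev := by rw [hb.1, Fin.rev_rev]
    unfold chevE chevF rootParity
    rw [if_neg (fun h => hl h.1), if_neg (fun h => hl h.1)]
    have ti := D.theta_even _ hpi
    have tj := D.theta_even _ hpj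
    clear hb c3' gen hij hij' hi hj si sj
    rw [← hf] at c2 c2' ⊢
    rw [hb'] at c1 c1' c3 c3'' hpj tj ⊢
    generalize D.fst i = a at *
    generalize D.snd i = b at *
    rw [Fin.rev_rev] at c1' c3''
    unfold X
    rw [mul_smul_comm, smul_mul_assoc]
    simp only [mul_sub, sub_mul, single_mul, c1, c2, c3, c2', c3'', if_true, if_false,
      hpi, hpj, ti, tj, Fin.rev_rev]
    rcases par_cases (D.parity a) with ha | ha <;> rcases D.theta_sign a with ta | ta <;>
    · simp only [ha, ta]
      simp (decide := true) [sgn, single_neg]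
  · have c4 : (D.fst i).rev ≠ (D.fst j).rev := fun e => hf (Fin.rev_injective e)
    have c4' : D.fst j ≠ D.fst i := fun e => hf e.symm
    unfold chevE chevF X
    split_ifs <;>
    simp only [mul_smul_comm, smul_mul_assoc, mul_sub, sub_mul, single_mul, c1, c2, c3, c1', c2',
      c3'', c4, c4', if_false, smul_zero, sub_zero]

instance : CharZero Kq := inferInstanceAs (CharZero (RatFunc ℂ))

theorem qh_ne : (qh : Kq) ≠ 0 := (RatFunc.X_ne_zero : (RatFunc.X : RatFunc ℂ) ≠ 0)

theorem qh_pow_ne_one (k : ℕ) (hk : 0 < k) : (qh : Kq) ^ k ≠ 1 := by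
  have h1 : (RatFunc.X : RatFunc ℂ) ^ k ≠ 1 := by
    intro h
    have h2 : algebraMap (Polynomial ℂ) (RatFunc ℂ) (Polynomial.X ^ k)
        = algebraMap (Polynomial ℂ) (RatFunc ℂ) 1 := by
      rw [map_pow, map_one, RatFunc.algebraMap_X]; exact h
    have h3 := RatFunc.algebraMap_injective ℂ h2
    have h4 := congrArg Polynomial.natDegree h3
    rw [Polynomial.natDegree_X_pow, Polynomial.natDegree_one] at h4
    omega
  exact h1

theorem q_ne : (q : Kq) ≠ 0 := pow_ne_zero _ qh_ne

theorem q_sq_sub (_D : Datum m n) : (q : Kq) - q⁻¹ ≠ 0 := by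
  intro h
  have h1 : q * q = 1 := by
    have := sub_eq_zero.1 h
    nth_rewrite 1 [this]
    exact inv_mul_cancel₀ q_ne
  apply qh_pow_ne_one 4 (by norm_num)
  rw [← h1, q]; ring

theorem q_sq_add : (q : Kq) + q⁻¹ ≠ 0 := by
  intro h
  have h1 : q * q = -1 := by
    have := eq_neg_of_add_eq_zero_left h
    nth_rewrite 1 [this]
    rw [neg_mul, inv_mul_cancel₀ q_ne]
  apply qh_pow_ne_one 8 (by norm_num)
  have : qh ^ 8 = (q * q) * (q * q) := by rw [q]; ring
  rw [this, h1]; ring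

theorem kappa_ne (D : Datum m n) (i : Fin (rk m n)) : D.kappa i ≠ 0 := by
  unfold kappa
  split_ifs
  · exact div_ne_zero q_sq_add two_ne_zero
  · exact one_ne_zero

/-- `q^{ℓ h_i / 2}` as a matrix. -/
noncomputable def kmat (D : Datum m n) (i : Fin (rk m n)) (l : ℤ) :
    Matrix (Fin (m + n)) (Fin (m + n)) Kq :=
  Matrix.diagonal fun b => qh ^ (l * D.chevH i b b)

theorem kmat_mul (D : Datum m n) (i : Fin (rk m n)) (l l' : ℤ) :
    D.kmat i l * D.kmat i l' = D.kmat i (l + l') := by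
  unfold kmat
  rw [Matrix.diagonal_mul_diagonal]
  congr 1
  funext b
  rw [← zpow_add₀ qh_ne, add_mul]

theorem kmat_comm (D : Datum m n) (i j : Fin (rk m n)) (l l' : ℤ) :
    D.kmat i l * D.kmat j l' = D.kmat j l' * D.kmat i l := by
  unfold kmat
  rw [Matrix.diagonal_mul_diagonal, Matrix.diagonal_mul_diagonal]
  congr 1
  funext b
  rw [mul_comm]

theorem kmat_zero (D : Datum m n) (i : Fin (rk m n)) : D.kmat i 0 = 1 := by
  unfold kmat
  simp

theorem mat_k (D : Datum m n) (i : Fin (rk m n)) : D.mat (.k i) = D.kmat i 1 := by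
  simp [mat, kmat]

theorem mat_kinv (D : Datum m n) (i : Fin (rk m n)) : D.mat (.kinv i) = D.kmat i (-1) := by
  simp [mat, kmat]

theorem chevH_diff (D : Datum m n) (i : Fin (rk m n)) (x y : Fin (m + n)) :
    D.chevH i x x - D.chevH i y y = D.form (D.eps x - D.eps y) (D.root i) := by
  rw [chevH_apply, chevH_apply, if_pos rfl, if_pos rfl, form_sub_left]

theorem kmat_e (D : Datum m n) (i j : Fin (rk m n)) (l : ℤ) :
    D.kmat i l * D.mat (.e j) = qh ^ (l * D.cartan i j) • (D.mat (.e j) * D.kmat i l) := by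
  ext x y
  unfold kmat
  rw [Matrix.smul_apply, Matrix.diagonal_mul, Matrix.mul_diagonal, smul_eq_mul]
  show _ * (D.chevE j x y : Kq) = _ * ((D.chevE j x y : Kq) * _)
  by_cases h : D.chevE j x y = 0
  · rw [h]; simp
  · have h1 := D.chevH_diff i x y
    rw [D.chevE_weight j x y h] at h1
    have h2 : D.chevH i x x = D.cartan i j + D.chevH i y y := by
      rw [D.cartan_comm, cartan]; omega
    rw [h2, mul_add, zpow_add₀ qh_ne]
    ring

theorem kmat_f (D : Datum m n) (i j : Fin (rk m n)) (l : ℤ) :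
    D.kmat i l * D.mat (.f j) = qh ^ (-(l * D.cartan i j)) • (D.mat (.f j) * D.kmat i l) := by
  ext x y
  unfold kmat
  rw [Matrix.smul_apply, Matrix.diagonal_mul, Matrix.mul_diagonal, smul_eq_mul]
  show _ * (D.kappa j * (D.chevF j x y : Kq)) = _ * ((D.kappa j * (D.chevF j x y : Kq)) * _)
  by_cases h : D.chevF j x y = 0
  · rw [h]; simp
  · have h1 := D.chevH_diff i x y
    rw [D.chevF_weight j x y h, form_neg_left] at h1
    have h2 : D.chevH i x x = -D.cartan i j + D.chevH i y y := by
      rw [D.cartan_comm, cartan]; omega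
    rw [h2, mul_add, zpow_add₀ qh_ne]
    ring_nf

theorem kappa_chevH (D : Datum m n) (i : Fin (rk m n)) (x : Fin (m + n)) :
    D.kappa i * (D.chevH i x x : Kq)
      = (q - q⁻¹)⁻¹ * (qh ^ (2 * D.chevH i x x) - qh ^ (-2 * D.chevH i x x)) := by
  have e : ∀ k : ℤ, qh ^ (2 * k) = q ^ k := by
    intro k; rw [zpow_mul, q]; norm_cast
  have e' : ∀ k : ℤ, qh ^ (-2 * k) = (q ^ k)⁻¹ := by
    intro k; rw [neg_mul, zpow_neg, e]
  rw [e, e']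
  have h0 := D.q_sq_sub
  have h1 := q_ne
  have e1 := D.chevH_apply i x x
  rw [if_pos rfl, root, form_sub_right, form_eps_eps, form_eps_eps] at e1
  rw [eq_inv_mul_iff_mul_eq₀ h0]
  have s1 : sgn (D.parity (D.fst i)) = 1 ∨ sgn (D.parity (D.fst i)) = -1 := by
    generalize D.parity (D.fst i) = y; revert y; decide
  have s2 : sgn (D.parity (D.snd i)) = 1 ∨ sgn (D.parity (D.snd i)) = -1 := by
    generalize D.parity (D.snd i) = y; revert y; decide
  unfold kappa
  split_ifs with hl
  · have h := (D.long_iff i).1 hl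
    rw [h, D.parity_rev, Fin.rev_rev] at e1
    have hne : D.fst i ≠ (D.fst i).rev := by
      rw [← h]; intro hh; have := D.fst_lt_snd i; rw [← hh] at this; omega
    have : D.chevH i x x = 0 ∨ D.chevH i x x = 2 ∨ D.chevH i x x = -2 := by
      rw [e1]
      by_cases a1 : x = D.fst i
      · have : x ≠ (D.fst i).rev := fun e => hne (a1.symm.trans e)
        rcases s1 with s | s <;> simp [s, a1, hne]
      · by_cases a2 : x = (D.fst i).rev
        · rcases s1 with s | s <;> simp [s, a2, hne.symm]
        · simp [a1, a2]
    rcases this with h | h | h <;> rw [h]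
    · simp
    · push_cast; rw [zpow_ofNat]; field_simp; ring
    · push_cast; rw [zpow_neg, zpow_ofNat]; field_simp; ring
  · have hs : D.snd i ≠ (D.fst i).rev := fun e => hl ((D.long_iff i).2 e)
    have hne : D.fst i ≠ D.snd i := fun e => by
      have := D.fst_lt_snd i; rw [e] at this; omega
    have hs' : D.fst i ≠ (D.snd i).rev := fun e => hs (by rw [e, Fin.rev_rev])
    have hne' : (D.fst i).rev ≠ (D.snd i).rev := fun e => hne (Fin.rev_injective e)
    have : D.chevH i x x = 0 ∨ D.chevH i x x = 1 ∨ D.chevH i x x = -1 := by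
      rw [e1]
      have hlt := D.fst_lt_rk i
      have hfix : D.fst i ≠ (D.fst i).rev := by
        rw [Ne, Fin.ext_iff, Fin.val_rev]; unfold rk at *; omega
      by_cases a1 : x = D.fst i
      · rcases s1 with s | s <;> simp [s, a1, hne, hs', hfix]
      by_cases a2 : x = (D.fst i).rev
      · rcases s1 with s | s <;> simp [s, a2, hs.symm, hne', hfix.symm]
      rw [if_neg a1, if_neg a2]
      split_ifs <;> rcases s2 with s | s <;> simp [s]
    rcases this with h | h | h <;> rw [h] <;> simp

theorem mat_ef (D : Datum m n) (i j : Fin (rk m n)) :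
    D.mat (.e i) * D.mat (.f j)
        - (sgn (D.rootParity i * D.rootParity j) : Kq) • (D.mat (.f j) * D.mat (.e i))
      = if i = j then (q - q⁻¹)⁻¹ • (D.kmat i 2 - D.kmat i (-2)) else 0 := by
  have hc : ∀ A B : Matrix (Fin (m + n)) (Fin (m + n)) ℤ,
      A.map (fun x : ℤ => (x : Kq)) * B.map (fun x : ℤ => (x : Kq))
        = (A * B).map (fun x : ℤ => (x : Kq)) := by
    intro A B
    exact (Matrix.map_mul (f := Int.castRingHom Kq)).symm
  have h1 : D.mat (.e i) * D.mat (.f j)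
        - (sgn (D.rootParity i * D.rootParity j) : Kq) • (D.mat (.f j) * D.mat (.e i))
      = D.kappa j • (D.chevE i * D.chevF j - sgn (D.rootParity i * D.rootParity j) •
          (D.chevF j * D.chevE i)).map (fun x : ℤ => (x : Kq)) := by
    simp only [mat, mul_smul_comm, smul_mul_assoc, hc]
    ext x y
    simp only [Matrix.sub_apply, Matrix.smul_apply, Matrix.map_apply, smul_eq_mul, Int.cast_sub,
      Int.cast_mul]
    ring
  rw [h1]
  by_cases hij : i = j
  · subst hij
    rw [classical_same, if_pos rfl]
    ext x y
    simp only [Matrix.smul_apply, Matrix.sub_apply, Matrix.map_apply, smul_eq_mul, kmat]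
    by_cases hxy : x = y
    · subst hxy
      rw [Matrix.diagonal_apply_eq, Matrix.diagonal_apply_eq]
      exact D.kappa_chevH i x
    · rw [Matrix.diagonal_apply_ne _ hxy, Matrix.diagonal_apply_ne _ hxy, chevH_apply, if_neg hxy]
      simp
  · rw [classical_ne D i j hij, if_neg hij]
    ext x y
    simp

theorem twist_eq (D : Datum m n) : D.twist = fun a b =>
    (fun a b => (sgn (D.rootParity a * D.rootParity b) : Kq)) a b
      * (fun a b => q ^ D.cartan a b) a b := rfl

theorem q_zpow (k : ℤ) : (q : Kq) ^ k = qh ^ (2 * k) := by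
  rw [zpow_mul, q]; norm_cast

theorem sgn_ne (x : ZMod 2) : sgn x ≠ 0 := by revert x; decide

theorem theta_ne (D : Datum m n) (b : Fin (m + n)) : D.theta b ≠ 0 := by
  rcases D.theta_sign b with h | h <;> rw [h] <;> decide

theorem rows (D : Datum m n) (i : Fin (rk m n)) :
    (D.chevF i (D.snd i) (D.fst i) ≠ 0 ∧ ∀ y, y ≠ D.fst i → D.chevF i (D.snd i) y = 0) ∧
    (D.chevE i (D.fst i) (D.snd i) ≠ 0 ∧ ∀ y, y ≠ D.snd i → D.chevE i (D.fst i) y = 0) ∧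
    (D.snd i ≠ (D.fst i).rev →
      (D.chevF i (D.fst i).rev (D.snd i).rev ≠ 0 ∧
        ∀ y, y ≠ (D.snd i).rev → D.chevF i (D.fst i).rev y = 0) ∧
      (D.chevE i (D.snd i).rev (D.fst i).rev ≠ 0 ∧
        ∀ y, y ≠ (D.fst i).rev → D.chevE i (D.snd i).rev y = 0)) := by
  by_cases h : D.Long ∧ (i : ℕ) = rk m n - 1
  · have h1 := (D.long_iff i).1 h
    unfold chevE chevF
    rw [if_pos h, if_pos h]
    refine ⟨⟨?_, fun y hy => ?_⟩, ⟨?_, fun y hy => ?_⟩, fun h' => absurd h1 h'⟩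
    · simp
    · simp [hy.symm]
    · simp
    · simp [hy.symm]
  · have h1 : D.snd i ≠ (D.fst i).rev := fun e => h ((D.long_iff i).2 e)
    have h2 : (D.fst i).rev ≠ D.snd i := h1.symm
    have h3 : (D.snd i).rev ≠ D.fst i := fun e => h1 (by rw [← e, Fin.rev_rev])
    have h4 : D.fst i ≠ (D.snd i).rev := h3.symm
    unfold chevE chevF X
    rw [if_neg h, if_neg h]
    refine ⟨⟨?_, fun y hy => ?_⟩, ⟨?_, fun y hy => ?_⟩, fun _ => ⟨⟨?_, fun y hy => ?_⟩,
      ⟨?_, fun y hy => ?_⟩⟩⟩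
    · simp [h2, sgn_ne]
    · simp [h2, hy.symm]
    · simp [h3]
    · simp [h3, hy.symm]
    · simp [h1, sgn_ne, theta_ne]
    · simp [h1, hy.symm]
    · simp [h4, sgn_ne, theta_ne]
    · simp [h4, hy.symm]

theorem mulVec_row (M : Matrix (Fin (m + n)) (Fin (m + n)) Kq) (b c : Fin (m + n))
    (h : ∀ y, y ≠ c → M b y = 0) (u : Fin (m + n) → Kq) :
    Matrix.toLin' M u b = M b c * u c := by
  rw [Matrix.toLin'_apply, Matrix.mulVec, dotProduct]
  apply Finset.sum_eq_single c
  · intro y _ hy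
    rw [h y hy, zero_mul]
  · simp

theorem op_f_row (D : Datum m n) (j : Fin (rk m n)) (b c : Fin (m + n))
    (h : D.chevF j b c ≠ 0 ∧ ∀ y, y ≠ c → D.chevF j b y = 0) :
    ∃ r : Kq, r ≠ 0 ∧ ∀ u : D.V, D.op (.f j) u b = r * u c := by
  refine ⟨D.mat (.f j) b c, ?_, fun u => mulVec_row _ b c (fun y hy => ?_) u⟩
  · show D.kappa j * (D.chevF j b c : Kq) ≠ 0
    exact mul_ne_zero (D.kappa_ne j) (by exact_mod_cast h.1)
  · show D.kappa j * (D.chevF j b y : Kq) = 0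
    rw [h.2 y hy]; simp

theorem op_e_row (D : Datum m n) (j : Fin (rk m n)) (b c : Fin (m + n))
    (h : D.chevE j b c ≠ 0 ∧ ∀ y, y ≠ c → D.chevE j b y = 0) :
    ∃ r : Kq, r ≠ 0 ∧ ∀ u : D.V, D.op (.e j) u b = r * u c := by
  refine ⟨D.mat (.e j) b c, ?_, fun u => mulVec_row _ b c (fun y hy => ?_) u⟩
  · show (D.chevE j b c : Kq) ≠ 0
    exact_mod_cast h.1
  · show (D.chevE j b y : Kq) = 0
    rw [h.2 y hy]; simp

/-- Every coordinate but the last is reached from a later one by a lowering operator. -/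
theorem row_f (D : Datum m n) (c : Fin (m + n)) (hc : (c : ℕ) + 1 < m + n) :
    ∃ (j : Fin (rk m n)) (b : Fin (m + n)) (r : Kq), (c : ℕ) < b ∧ r ≠ 0 ∧
      ∀ u : D.V, D.op (.f j) u b = r * u c := by
  have h2 := D.two_lt
  by_cases h1 : (c : ℕ) < rk m n ∧ ¬ (D.Fork ∧ (c : ℕ) = rk m n - 1)
  · let j : Fin (rk m n) := ⟨c, h1.1⟩
    have hj : D.fst j = c := by
      apply Fin.ext
      rcases D.fst_val j with ⟨hF, h3, _⟩ | ⟨_, h3⟩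
      · exact absurd ⟨hF, h3⟩ h1.2
      · exact h3
    obtain ⟨r, hr, hu⟩ := D.op_f_row j _ _ (D.rows j).1
    refine ⟨j, D.snd j, r, ?_, hr, ?_⟩
    · rw [← hj]; exact D.fst_lt_snd j
    · rw [hj] at hu; exact hu
  · have h3 : m + n - 2 - (c : ℕ) < rk m n := by
      by_cases h : (c : ℕ) < rk m n
      · have h4 : D.Fork ∧ (c : ℕ) = rk m n - 1 := by
          by_contra h5; exact h1 ⟨h, h5⟩
        have := D.fork_even h4.1
        rw [Nat.even_iff] at this; unfold rk at *; omega
      · unfold rk at *; omega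
    let j : Fin (rk m n) := ⟨m + n - 2 - c, h3⟩
    have hj : (D.snd j).rev = c := by
      apply Fin.ext
      rw [Fin.val_rev, snd_val]
      show m + n - (m + n - 2 - (c : ℕ) + 1 + 1) = c
      omega
    have hl : D.snd j ≠ (D.fst j).rev := by
      intro h
      have h4 := (D.long_iff j).2 h
      have he := D.long_even h4.1
      have h5 : m + n - 2 - (c : ℕ) = rk m n - 1 := h4.2
      have h6 := D.not_fork_of_long h4.1
      apply h1
      refine ⟨?_, fun h => h6 h.1⟩
      rw [Nat.even_iff] at he; unfold rk at *; omega
    obtain ⟨r, hr, hu⟩ := D.op_f_row j _ _ ((D.rows j).2.2 hl).1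
    refine ⟨j, (D.fst j).rev, r, ?_, hr, ?_⟩
    · rw [← hj, Fin.val_rev, Fin.val_rev]
      have := D.fst_lt_snd j
      have := (D.snd j).2
      omega
    · rw [hj] at hu; exact hu

/-- Every coordinate but the first is reached from an earlier one by a raising operator. -/
theorem row_e (D : Datum m n) (c : Fin (m + n)) (hc : 0 < (c : ℕ)) :
    ∃ (j : Fin (rk m n)) (b : Fin (m + n)) (r : Kq), (b : ℕ) < c ∧ r ≠ 0 ∧
      ∀ u : D.V, D.op (.e j) u b = r * u c := by
  have h2 := D.two_lt
  have hc' := c.2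
  by_cases h1 : (c : ℕ) - 1 < rk m n
  · let j : Fin (rk m n) := ⟨(c : ℕ) - 1, h1⟩
    have hj : D.snd j = c := by
      apply Fin.ext
      rw [snd_val]
      show (c : ℕ) - 1 + 1 = c
      omega
    obtain ⟨r, hr, hu⟩ := D.op_e_row j _ _ (D.rows j).2.1
    refine ⟨j, D.fst j, r, ?_, hr, ?_⟩
    · rw [← hj]; exact D.fst_lt_snd j
    · rw [hj] at hu; exact hu
  · have h3 : m + n - 1 - (c : ℕ) < rk m n := by unfold rk at *; omega
    let j : Fin (rk m n) := ⟨m + n - 1 - c, h3⟩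
    have hjv : (j : ℕ) = m + n - 1 - c := rfl
    have hj : D.fst j = c.rev := by
      apply Fin.ext
      rw [Fin.val_rev]
      rcases D.fst_val j with ⟨hF, h4, _⟩ | ⟨_, h4⟩
      · have := D.fork_even hF
        rw [Nat.even_iff] at this; unfold rk at *; omega
      · rw [h4, hjv]; omega
    have hj' : (D.fst j).rev = c := by rw [hj, Fin.rev_rev]
    have hl : D.snd j ≠ (D.fst j).rev := by
      rw [hj', Ne, Fin.ext_iff, snd_val, hjv]
      unfold rk at *; omega
    obtain ⟨r, hr, hu⟩ := D.op_e_row j _ _ ((D.rows j).2.2 hl).2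
    refine ⟨j, (D.snd j).rev, r, ?_, hr, ?_⟩
    · rw [← hj', Fin.val_rev, Fin.val_rev]
      have := D.fst_lt_snd j
      have := (D.snd j).2
      omega
    · rw [hj'] at hu; exact hu

theorem op_e_last (D : Datum m n) (i : Fin (rk m n)) (u : D.V) (b : Fin (m + n))
    (hb : (b : ℕ) + 1 = m + n) : D.op (.e i) u b = 0 := by
  have : ∀ y, D.mat (.e i) b y = 0 := by
    intro y
    show (D.chevE i b y : Kq) = 0
    have h1 := D.fst_lt_snd i
    have h2 := (D.snd i).2
    have e1 : D.fst i ≠ b := by rw [Ne, Fin.ext_iff]; omega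
    have e2 : (D.snd i).rev ≠ b := by rw [Ne, Fin.ext_iff, Fin.val_rev]; omega
    have : D.chevE i b y = 0 := by
      unfold chevE X
      split_ifs <;> simp [e1, e2]
    rw [this]; simp
  rw [op, Matrix.toLin'_apply, Matrix.mulVec, dotProduct]
  exact Finset.sum_eq_zero fun y _ => by rw [this, zero_mul]

theorem op_f_first (D : Datum m n) (i : Fin (rk m n)) (u : D.V) (b : Fin (m + n))
    (hb : (b : ℕ) = 0) : D.op (.f i) u b = 0 := by
  have : ∀ y, D.mat (.f i) b y = 0 := by
    intro y
    show D.kappa i * (D.chevF i b y : Kq) = 0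
    have h1 := D.fst_lt_snd i
    have h2 := (D.snd i).2
    have e1 : D.snd i ≠ b := by rw [Ne, Fin.ext_iff]; omega
    have e2 : (D.fst i).rev ≠ b := by rw [Ne, Fin.ext_iff, Fin.val_rev]; omega
    have : D.chevF i b y = 0 := by
      unfold chevF X
      split_ifs <;> simp [e1, e2]
    rw [this]; simp
  rw [op, Matrix.toLin'_apply, Matrix.mulVec, dotProduct]
  exact Finset.sum_eq_zero fun y _ => by rw [this, zero_mul]

/-- `q^{ℓ h_i / 2}` as an operator on `V`. -/
noncomputable def kop (D : Datum m n) (i : Fin (rk m n)) (l : ℤ) : Module.End Kq D.V :=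
  Matrix.toLin' (D.kmat i l)

theorem op_k (D : Datum m n) (i : Fin (rk m n)) : D.op (.k i) = D.kop i 1 := by
  rw [op, mat_k, kop]

theorem op_kinv (D : Datum m n) (i : Fin (rk m n)) : D.op (.kinv i) = D.kop i (-1) := by
  rw [op, mat_kinv, kop]

theorem kop_mul (D : Datum m n) (i : Fin (rk m n)) (l l' : ℤ) :
    D.kop i l * D.kop i l' = D.kop i (l + l') := by
  rw [kop, kop, kop, ← kmat_mul, Matrix.toLin'_mul]; rfl

theorem kop_comm (D : Datum m n) (i j : Fin (rk m n)) (l l' : ℤ) :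
    D.kop i l * D.kop j l' = D.kop j l' * D.kop i l := by
  have := congrArg Matrix.toLin' (D.kmat_comm i j l l')
  rw [Matrix.toLin'_mul, Matrix.toLin'_mul] at this
  exact this

theorem kop_zero (D : Datum m n) (i : Fin (rk m n)) : D.kop i 0 = 1 := by
  rw [kop, kmat_zero, Matrix.toLin'_one]; rfl

theorem kop_e (D : Datum m n) (i j : Fin (rk m n)) (l : ℤ) :
    D.kop i l * D.op (.e j) = qh ^ (l * D.cartan i j) • (D.op (.e j) * D.kop i l) := by
  have := congrArg Matrix.toLin' (D.kmat_e i j l)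
  rw [map_smul, Matrix.toLin'_mul, Matrix.toLin'_mul] at this
  exact this

theorem kop_f (D : Datum m n) (i j : Fin (rk m n)) (l : ℤ) :
    D.kop i l * D.op (.f j) = qh ^ (-(l * D.cartan i j)) • (D.op (.f j) * D.kop i l) := by
  have := congrArg Matrix.toLin' (D.kmat_f i j l)
  rw [map_smul, Matrix.toLin'_mul, Matrix.toLin'_mul] at this
  exact this

theorem op_ef (D : Datum m n) (i j : Fin (rk m n)) :
    D.op (.e i) * D.op (.f j)
        - (sgn (D.rootParity i * D.rootParity j) : Kq) • (D.op (.f j) * D.op (.e i))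
      = if i = j then (q - q⁻¹)⁻¹ • (D.kop i 2 - D.kop i (-2)) else 0 := by
  have := congrArg Matrix.toLin' (D.mat_ef i j)
  rw [map_sub, map_smul, Matrix.toLin'_mul, Matrix.toLin'_mul] at this
  refine Eq.trans this ?_
  split_ifs
  · rw [map_smul, map_sub]; rfl
  · rw [map_zero]

theorem sgn_rp_comm (D : Datum m n) (i j : Fin (rk m n)) :
    (sgn (D.rootParity i * D.rootParity j) : Kq) = sgn (D.rootParity j * D.rootParity i) := by
  rw [mul_comm]

theorem serre_e_V (D : Datum m n) (z : List (Fin (rk m n)) →₀ Kq)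
    (hz : z ∈ QSerre.radical D.twist) :
    QSerre.evalWord Kq (fun i => D.op (.e i)) z = 0 := by
  have key : ∀ (k : ℕ) (c : Fin (m + n)), m + n - (c : ℕ) ≤ k →
      ∀ z ∈ QSerre.radical D.twist, ∀ u : D.V,
        QSerre.evalWord Kq (fun i => D.op (.e i)) z u c = 0 := by
    intro k
    induction k with
    | zero => intro c hc; have := c.2; omega
    | succ k ih =>
      intro c hc z hz u
      by_cases h : (c : ℕ) + 1 = m + n
      · exact QSerre.functional_base D.twist (fun i => D.op (.e i)) (LinearMap.proj c)
          (fun i v => D.op_e_last i v c h) z hz u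
      · obtain ⟨j, b, r, hcb, hr, hu⟩ := D.row_f c (by have := c.2; omega)
        have h3 := QSerre.functional_step (M := D.V)
          (fun a b => (sgn (D.rootParity a * D.rootParity b) : Kq))
          (fun a b => q ^ D.cartan a b) D.sgn_rp_comm (fun a b => by rw [cartan_comm])
          (fun a b => sgn_sq' _) (fun a b => zpow_ne_zero _ q_ne) (fun i => D.op (.e i)) j
          (D.op (.f j)) (D.kop j 2) (D.kop j (-2))
          (-(sgn (D.rootParity j * D.rootParity j) : Kq) * (q - q⁻¹)⁻¹)
          (fun i => ?_) (fun i => ?_) (fun i => ?_) (LinearMap.proj b)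
          (fun z hz v => ih b (by have := b.2; omega) z hz v) z hz u
        · have h4 : r * QSerre.evalWord Kq (fun i => D.op (.e i)) z u c = 0 := by
            rw [← hu]; exact h3
          exact (mul_eq_zero.1 h4).resolve_left hr
        · have h4 := D.op_ef i j
          have h5 := sgn_sq' (D.rootParity i * D.rootParity j)
          rw [sub_eq_iff_eq_add] at h4
          rw [h4, smul_add, smul_smul, D.sgn_rp_comm j i, h5, one_smul]
          by_cases hij : i = j
          · subst hij
            rw [if_pos rfl, if_pos rfl]
            module
          · rw [if_neg hij, if_neg (Ne.symm hij)]
            simp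
        · rw [D.kop_e, q_zpow]
        · rw [D.kop_e, q_zpow, ← zpow_neg, neg_mul]
  refine LinearMap.ext fun u => funext fun c => ?_
  exact key _ c le_rfl z hz u

theorem serre_f_V (D : Datum m n) (z : List (Fin (rk m n)) →₀ Kq)
    (hz : z ∈ QSerre.radical D.twist) :
    QSerre.evalWord Kq (fun i => D.op (.f i)) z = 0 := by
  have key : ∀ (k : ℕ) (c : Fin (m + n)), (c : ℕ) ≤ k →
      ∀ z ∈ QSerre.radical D.twist, ∀ u : D.V,
        QSerre.evalWord Kq (fun i => D.op (.f i)) z u c = 0 := by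
    have base : ∀ (c : Fin (m + n)), (c : ℕ) = 0 →
      ∀ z ∈ QSerre.radical D.twist, ∀ u : D.V,
        QSerre.evalWord Kq (fun i => D.op (.f i)) z u c = 0 := fun c hc z hz u =>
      QSerre.functional_base D.twist (fun i => D.op (.f i)) (LinearMap.proj c)
          (fun i v => D.op_f_first i v c hc) z hz u
    intro k
    induction k with
    | zero => intro c hc; exact base c (by omega)
    | succ k ih =>
      intro c hc z hz u
      by_cases h : (c : ℕ) = 0
      · exact base c h z hz u
      · obtain ⟨j, b, r, hcb, hr, hu⟩ := D.row_e c (by omega)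
        have h3 := QSerre.functional_step (M := D.V)
          (fun a b => (sgn (D.rootParity a * D.rootParity b) : Kq))
          (fun a b => q ^ D.cartan a b) D.sgn_rp_comm (fun a b => by rw [cartan_comm])
          (fun a b => sgn_sq' _) (fun a b => zpow_ne_zero _ q_ne) (fun i => D.op (.f i)) j
          (D.op (.e j)) (D.kop j (-2)) (D.kop j 2)
          (-(q - q⁻¹)⁻¹)
          (fun i => ?_) (fun i => ?_) (fun i => ?_) (LinearMap.proj b)
          (fun z hz v => ih b (by omega) z hz v) z hz u
        · have h4 : r * QSerre.evalWord Kq (fun i => D.op (.f i)) z u c = 0 := by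
            rw [← hu]; exact h3
          exact (mul_eq_zero.1 h4).resolve_left hr
        · have h4 := D.op_ef j i
          rw [sub_eq_iff_eq_add] at h4
          rw [h4]
          refine (add_comm _ _).trans ?_
          congr 1
          split_ifs
          · module
          · rfl
        · rw [D.kop_f, q_zpow, neg_mul, neg_neg]
        · rw [D.kop_f, q_zpow, ← zpow_neg]
  refine LinearMap.ext fun u => funext fun c => ?_
  exact key _ c le_rfl z hz u

theorem signOp_basis (D : Datum m n) (x : ZMod 2) (b : Fin (m + n)) :
    D.signOp x (Pi.single b 1) = (sgn (x * D.parity b) : Kq) • (Pi.single b 1 : D.V) := by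
  rw [signOp, Matrix.toLin'_apply, Matrix.mulVec_single_one]
  ext c
  by_cases h : c = b
  · subst h; simp
  · simp [h]

theorem sgn_weight_e (D : Datum m n) (i : Fin (rk m n)) (b c : Fin (m + n))
    (h : D.chevE i b c ≠ 0) : D.parity b + D.parity c = D.rootParity i := by
  by_contra hc
  apply h
  have h1 : ¬ (D.fst i = b ∧ D.snd i = c) := by rintro ⟨rfl, rfl⟩; exact hc rfl
  have h2 : ¬ ((D.snd i).rev = b ∧ (D.fst i).rev = c) := by
    rintro ⟨rfl, rfl⟩; apply hc; rw [D.parity_rev, D.parity_rev, add_comm]; rfl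
  unfold chevE X
  split_ifs
  · rw [Matrix.single_apply, if_neg h1]
  · rw [Matrix.sub_apply, Matrix.single_apply, if_neg h1, Matrix.single_apply, if_neg h2, sub_zero]

theorem sgn_weight_f (D : Datum m n) (i : Fin (rk m n)) (b c : Fin (m + n))
    (h : D.chevF i b c ≠ 0) : D.parity b + D.parity c = D.rootParity i := by
  by_contra hc
  apply h
  have h1 : ¬ (D.snd i = b ∧ D.fst i = c) := by
    rintro ⟨rfl, rfl⟩; apply hc; rw [add_comm]; rfl
  have h2 : ¬ ((D.fst i).rev = b ∧ (D.snd i).rev = c) := by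
    rintro ⟨rfl, rfl⟩; apply hc; rw [D.parity_rev, D.parity_rev]; rfl
  unfold chevF X
  split_ifs
  · rw [Matrix.single_apply, if_neg h1]
  · rw [Matrix.smul_apply, Matrix.sub_apply, Matrix.single_apply, if_neg h1, Matrix.single_apply,
      if_neg h2, sub_zero, smul_zero]

theorem sgn_shift (x p b c : ZMod 2) (h : b + c = p) :
    (sgn (x * b) : Kq) = sgn (x * p) * sgn (x * c) := by
  have : sgn (x * b) = sgn (x * p) * sgn (x * c) := by subst h; revert x b c; decide
  rw [this]; push_cast; rfl

theorem signOp_comm (D : Datum m n) (x : ZMod 2) (i : Fin (rk m n))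
    (M : Matrix (Fin (m + n)) (Fin (m + n)) Kq)
    (h : ∀ b c, M b c ≠ 0 → D.parity b + D.parity c = D.rootParity i) :
    D.signOp x * Matrix.toLin' M
      = (sgn (x * D.rootParity i) : Kq) • ((Matrix.toLin' M : Module.End Kq D.V) * D.signOp x) := by
  have : Matrix.diagonal (fun b => (sgn (x * D.parity b) : Kq)) * M
      = (sgn (x * D.rootParity i) : Kq) •
        (M * Matrix.diagonal (fun b => (sgn (x * D.parity b) : Kq))) := by
    ext b c
    rw [Matrix.smul_apply, Matrix.diagonal_mul, Matrix.mul_diagonal, smul_eq_mul]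
    by_cases h0 : M b c = 0
    · rw [h0]; simp
    · rw [sgn_shift x _ _ _ (h b c h0)]; ring
  have := congrArg Matrix.toLin' this
  rw [map_smul, Matrix.toLin'_mul, Matrix.toLin'_mul] at this
  exact this

theorem signOp_e (D : Datum m n) (x : ZMod 2) (i : Fin (rk m n)) :
    D.signOp x * D.op (.e i)
      = (sgn (x * D.rootParity i) : Kq) • (D.op (.e i) * D.signOp x) := by
  refine D.signOp_comm x i _ fun b c h => D.sgn_weight_e i b c ?_
  intro h0
  apply h
  show (D.chevE i b c : Kq) = 0
  rw [h0]; simp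

theorem signOp_f (D : Datum m n) (x : ZMod 2) (i : Fin (rk m n)) :
    D.signOp x * D.op (.f i)
      = (sgn (x * D.rootParity i) : Kq) • (D.op (.f i) * D.signOp x) := by
  refine D.signOp_comm x i _ fun b c h => D.sgn_weight_f i b c ?_
  intro h0
  apply h
  show D.kappa i * (D.chevF i b c : Kq) = 0
  rw [h0]; simp

theorem signOp_kop (D : Datum m n) (x : ZMod 2) (i : Fin (rk m n)) (l : ℤ) :
    D.signOp x * D.kop i l = D.kop i l * D.signOp x := by
  have : Matrix.diagonal (fun b => (sgn (x * D.parity b) : Kq)) * D.kmat i l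
      = D.kmat i l * Matrix.diagonal (fun b => (sgn (x * D.parity b) : Kq)) := by
    unfold kmat
    rw [Matrix.diagonal_mul_diagonal, Matrix.diagonal_mul_diagonal]
    congr 1
    funext b
    rw [mul_comm]
  have := congrArg Matrix.toLin' this
  rw [Matrix.toLin'_mul, Matrix.toLin'_mul] at this
  exact this

theorem signOp_sq (D : Datum m n) (x : ZMod 2) : D.signOp x * D.signOp x = 1 := by
  have : Matrix.diagonal (fun b => (sgn (x * D.parity b) : Kq))
      * Matrix.diagonal (fun b => (sgn (x * D.parity b) : Kq)) = 1 := by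
    rw [Matrix.diagonal_mul_diagonal]
    simp only [sgn_sq', Matrix.diagonal_one]
  have := congrArg Matrix.toLin' this
  rw [Matrix.toLin'_mul, Matrix.toLin'_one] at this
  exact this

theorem kop_basis (D : Datum m n) (i : Fin (rk m n)) (l : ℤ) (b : Fin (m + n)) :
    D.kop i l (Pi.single b 1) = qh ^ (l * D.chevH i b b) • (Pi.single b 1 : D.V) := by
  rw [kop, Matrix.toLin'_apply, Matrix.mulVec_single_one]
  ext c
  by_cases h : c = b
  · subst h; simp [kmat]
  · simp [kmat, h]

/-- `q^{h_i/2}` with the sign of the root `i`. -/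
noncomputable def gop (D : Datum m n) (i : Fin (rk m n)) (l : ℤ) : Module.End Kq D.V :=
  D.kop i l * D.signOp (D.rootParity i)

theorem gop_e (D : Datum m n) (i j : Fin (rk m n)) (l : ℤ) :
    D.gop i l * D.op (.e j)
      = ((sgn (D.rootParity i * D.rootParity j) : Kq) * qh ^ (l * D.cartan i j)) •
        (D.op (.e j) * D.gop i l) := by
  rw [gop, mul_assoc, signOp_e, mul_smul_comm, ← mul_assoc, kop_e, smul_mul_assoc, smul_smul,
    mul_assoc]

theorem gop_f (D : Datum m n) (i j : Fin (rk m n)) (l : ℤ) :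
    D.gop i l * D.op (.f j)
      = ((sgn (D.rootParity i * D.rootParity j) : Kq) * qh ^ (-(l * D.cartan i j))) •
        (D.op (.f j) * D.gop i l) := by
  rw [gop, mul_assoc, signOp_f, mul_smul_comm, ← mul_assoc, kop_f, smul_mul_assoc, smul_smul,
    mul_assoc]

theorem gop_kop (D : Datum m n) (i j : Fin (rk m n)) (l l' : ℤ) :
    D.gop i l * D.kop j l' = D.kop j l' * D.gop i l := by
  rw [gop, mul_assoc, signOp_kop, ← mul_assoc, kop_comm, mul_assoc]

theorem gop_gop (D : Datum m n) (i : Fin (rk m n)) (l l' : ℤ) :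
    D.gop i l * D.gop i l' = D.kop i (l + l') := by
  rw [gop, gop, mul_assoc, ← mul_assoc (D.signOp _), signOp_kop, mul_assoc (D.kop i l'),
    signOp_sq, mul_one, kop_mul]

theorem signOp_mul_comm (D : Datum m n) (x y : ZMod 2) :
    D.signOp x * D.signOp y = D.signOp y * D.signOp x := by
  have : Matrix.diagonal (fun b => (sgn (x * D.parity b) : Kq))
      * Matrix.diagonal (fun b => (sgn (y * D.parity b) : Kq))
      = Matrix.diagonal (fun b => (sgn (y * D.parity b) : Kq))
      * Matrix.diagonal (fun b => (sgn (x * D.parity b) : Kq)) := by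
    rw [Matrix.diagonal_mul_diagonal, Matrix.diagonal_mul_diagonal]
    simp only [mul_comm]
  have := congrArg Matrix.toLin' this
  rw [Matrix.toLin'_mul, Matrix.toLin'_mul] at this
  exact this

theorem gop_comm (D : Datum m n) (i j : Fin (rk m n)) (l l' : ℤ) :
    D.gop i l * D.gop j l' = D.gop j l' * D.gop i l := by
  have h1 : D.gop i l * D.gop j l' = (D.gop i l * D.kop j l') * D.signOp (D.rootParity j) := by
    rw [gop, gop, mul_assoc, mul_assoc, mul_assoc]
  rw [h1, gop_kop, mul_assoc, gop, gop, mul_assoc, signOp_mul_comm, ← mul_assoc (D.kop i l),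
    ← signOp_kop, mul_assoc, ← mul_assoc (D.kop j l')]

theorem op₂_e (D : Datum m n) (i : Fin (rk m n)) : D.op₂ (.e i)
    = TensorProduct.map (D.gop i 1) (D.op (.e i))
      + TensorProduct.map (D.op (.e i)) (D.kop i (-1)) := by
  rw [op₂, op_k, op_kinv]; rfl

theorem op₂_f (D : Datum m n) (i : Fin (rk m n)) : D.op₂ (.f i)
    = TensorProduct.map (D.gop i 1) (D.op (.f i))
      + TensorProduct.map (D.op (.f i)) (D.kop i (-1)) := by
  rw [op₂, op_k, op_kinv]; rfl

theorem op₂_k (D : Datum m n) (i : Fin (rk m n)) : D.op₂ (.k i)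
    = TensorProduct.map (D.kop i 1) (D.kop i 1) := by
  rw [op₂, op_k]

theorem op₂_kinv (D : Datum m n) (i : Fin (rk m n)) : D.op₂ (.kinv i)
    = TensorProduct.map (D.kop i (-1)) (D.kop i (-1)) := by
  rw [op₂, op_kinv]

theorem serre_e_VV (D : Datum m n) (z : List (Fin (rk m n)) →₀ Kq)
    (hz : z ∈ QSerre.radical D.twist) :
    QSerre.evalWord Kq (fun i => D.op₂ (.e i)) z = 0 := by
  simp only [op₂_e]
  refine QSerre.tensor_kill D.twist (fun i => D.op (.e i)) (fun i => D.kop i 1)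
    (fun i => D.kop i (-1)) (fun i => D.gop i 1)
    (fun i j => (sgn (D.rootParity i * D.rootParity j) : Kq) * qh ^ (1 * D.cartan i j))
    (fun i j => qh ^ (1 * D.cartan i j))
    (fun i b => sgn (D.rootParity i * D.parity b) * qh ^ (1 * D.chevH i b b))
    (fun i j => ?_) (fun i => ?_) (fun i j => D.kop_comm i j _ _) (fun i b => ?_)
    (fun j i => D.gop_e j i 1) (fun i j => D.kop_e i j 1) D.serre_e_V z hz
  · rw [twist, q_zpow, mul_assoc, ← zpow_add₀ qh_ne, D.cartan_comm j i, mul_comm (D.rootParity j)]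
    ring_nf
  · rw [kop_mul]; exact D.kop_zero i
  · rw [gop, Module.End.mul_apply, signOp_basis, map_smul, kop_basis, smul_smul]

theorem serre_f_VV (D : Datum m n) (z : List (Fin (rk m n)) →₀ Kq)
    (hz : z ∈ QSerre.radical D.twist) :
    QSerre.evalWord Kq (fun i => D.op₂ (.f i)) z = 0 := by
  have h := QSerre.tensor_kill D.twist (fun i => D.op (.f i)) (fun i => D.gop i (-1))
    (fun i => D.gop i 1) (fun i => D.kop i (-1))
    (fun i j => qh ^ (-(-1 * D.cartan i j)))
    (fun i j => (sgn (D.rootParity i * D.rootParity j) : Kq) * qh ^ (-(-1 * D.cartan i j)))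
    (fun i b => qh ^ (-1 * D.chevH i b b))
    (fun i j => ?_) (fun i => ?_) (fun i j => D.gop_comm i j _ _) (fun i b => D.kop_basis i _ b)
    (fun j i => D.kop_f j i (-1)) (fun i j => D.gop_f i j (-1)) D.serre_f_V z hz
  · let c := TensorProduct.comm Kq D.V D.V
    have hc : ∀ z, QSerre.evalWord Kq (fun i => D.op₂ (.f i)) z ∘ₗ c.toLinearMap
        = c.toLinearMap ∘ₗ QSerre.evalWord Kq (fun i =>
          TensorProduct.map (D.kop i (-1)) (D.op (.f i))
            + TensorProduct.map (D.op (.f i)) (D.gop i 1)) z := by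
      intro z
      have : LinearMap.lcomp Kq _ c.toLinearMap ∘ₗ QSerre.evalWord Kq (fun i => D.op₂ (.f i))
        = LinearMap.llcomp Kq _ _ _ c.toLinearMap ∘ₗ QSerre.evalWord Kq (fun i =>
          TensorProduct.map (D.kop i (-1)) (D.op (.f i))
            + TensorProduct.map (D.op (.f i)) (D.gop i 1)) := by
        refine QSerre.lin_ext ?_ fun j z ih => ?_
        · rw [LinearMap.comp_apply, LinearMap.comp_apply, QSerre.evalWord_nil,
            QSerre.evalWord_nil]
          rfl
        · have e1 : D.op₂ (.f j) ∘ₗ c.toLinearMap = c.toLinearMap ∘ₗ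
              (TensorProduct.map (D.kop j (-1)) (D.op (.f j))
                + TensorProduct.map (D.op (.f j)) (D.gop j 1)) := by
            rw [op₂_f]
            refine TensorProduct.ext' fun x y => ?_
            simp [c, add_comm]
          rw [LinearMap.comp_apply, LinearMap.comp_apply, QSerre.evalWord_cons,
            QSerre.evalWord_cons]
          refine LinearMap.ext fun y => ?_
          have e2 := LinearMap.congr_fun ih y
          have e3 := LinearMap.congr_fun e1
          simp only [LinearMap.comp_apply] at e3
          have e4 : QSerre.evalWord Kq (fun i => D.op₂ (.f i)) z (c y) = c (QSerre.evalWord Kq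
            (fun i => TensorProduct.map (D.kop i (-1)) (D.op (.f i))
            + TensorProduct.map (D.op (.f i)) (D.gop i 1)) z y) := e2
          show D.op₂ (.f j) (QSerre.evalWord Kq (fun i => D.op₂ (.f i)) z (c y)) = _
          rw [e4]
          exact e3 _
      exact LinearMap.congr_fun this z
    have h2 := hc z
    rw [h] at h2
    refine LinearMap.ext fun y => ?_
    have h3 := LinearMap.congr_fun h2 (c.symm y)
    simpa using h3
  · rw [twist, q_zpow, mul_left_comm, ← zpow_add₀ qh_ne, D.cartan_comm j i]
    ring_nf
  · rw [gop_gop]; exact D.kop_zero i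

theorem map_mul' (D : Datum m n) (a b c d : Module.End Kq D.V) :
    (TensorProduct.map a b : Module.End Kq (D.V ⊗[Kq] D.V)) * TensorProduct.map c d
      = TensorProduct.map (a * c) (b * d) :=
  (TensorProduct.map_comp a b c d).symm

theorem map_sub_left' (D : Datum m n) (a b c : Module.End Kq D.V) :
    (TensorProduct.map (a - b) c : Module.End Kq (D.V ⊗[Kq] D.V))
      = TensorProduct.map a c - TensorProduct.map b c :=
  TensorProduct.ext' fun x y => by simp [TensorProduct.sub_tmul]

theorem map_sub_right' (D : Datum m n) (a b c : Module.End Kq D.V) :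
    (TensorProduct.map a (b - c) : Module.End Kq (D.V ⊗[Kq] D.V))
      = TensorProduct.map a b - TensorProduct.map a c :=
  TensorProduct.ext' fun x y => by simp [TensorProduct.tmul_sub]

theorem op₂_ef (D : Datum m n) (i j : Fin (rk m n)) :
    D.op₂ (.e i) * D.op₂ (.f j)
        - (sgn (D.rootParity i * D.rootParity j) : Kq) • (D.op₂ (.f j) * D.op₂ (.e i))
      = if i = j then (q - q⁻¹)⁻¹ • (D.op₂ (.k i) ^ 2 - D.op₂ (.kinv i) ^ 2) else 0 := by
  have hs := sgn_sq' (D.rootParity i * D.rootParity j)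
  have hef := D.op_ef i j
  have h1 := D.gop_f i j 1
  have h2 := D.kop_e j i (-1)
  have h3 := D.gop_e j i 1
  have h4 := D.kop_f i j (-1)
  have hg := D.gop_comm j i 1 1
  have hk := D.kop_comm j i (-1) (-1)
  rw [D.cartan_comm j i] at h2 h3
  rw [mul_comm (D.rootParity j)] at h3
  rw [op₂_e, op₂_f, op₂_k, op₂_kinv, pow_two, pow_two]
  simp only [mul_add, add_mul, map_mul', kop_mul]
  rw [h1, h2, h3, h4, hg, hk]
  generalize (sgn (D.rootParity i * D.rootParity j) : Kq) = s at *
  generalize D.cartan i j = a at *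
  have ht : (qh : Kq) ^ (-(1 * a)) = (qh ^ a)⁻¹ := by rw [one_mul, zpow_neg]
  have ht1 : (qh : Kq) ^ (-1 * a) = (qh ^ a)⁻¹ := by rw [neg_mul, one_mul, zpow_neg]
  have ht2 : (qh : Kq) ^ (-(-1 * a)) = qh ^ a := by rw [neg_mul, one_mul, neg_neg]
  have ht3 : (qh : Kq) ^ (1 * a) = qh ^ a := by rw [one_mul]
  have ht0 : (qh : Kq) ^ a ≠ 0 := zpow_ne_zero _ qh_ne
  rw [ht, ht1, ht2, ht3]
  generalize (qh : Kq) ^ a = t at *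
  simp only [TensorProduct.map_smul_left, TensorProduct.map_smul_right, smul_add, smul_smul]
  have e0 : s * (s * t) = t := by rw [← mul_assoc, hs, one_mul]
  have e1 : D.op (.e i) * D.op (.f j) = s • (D.op (.f j) * D.op (.e i))
      + if i = j then (q - q⁻¹)⁻¹ • (D.kop i 2 - D.kop i (-2)) else 0 := by
    rw [← hef]; abel
  rw [e0, e1, TensorProduct.map_add_left, TensorProduct.map_add_right,
    TensorProduct.map_smul_left, TensorProduct.map_smul_right]
  by_cases hij : i = j
  · subst hij
    simp only [if_true, gop_gop, kop_mul, TensorProduct.map_smul_left,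
      TensorProduct.map_smul_right, map_sub_left', map_sub_right']
    have n1 : D.kop i (1 + 1) = D.kop i 2 := by norm_num
    have n2 : D.kop i (-1 + -1) = D.kop i (-2) := by norm_num
    rw [n1, n2]
    module
  · simp only [hij, if_false, TensorProduct.map_zero_left, TensorProduct.map_zero_right]
    module

theorem op₂_relations (D : Datum m n) (i j : Fin (rk m n)) :
    D.op₂ (.k i) * D.op₂ (.k j) = D.op₂ (.k j) * D.op₂ (.k i) ∧
    D.op₂ (.k i) * D.op₂ (.kinv i) = 1 ∧ D.op₂ (.kinv i) * D.op₂ (.k i) = 1 ∧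
    D.op₂ (.k i) * D.op₂ (.e j) * D.op₂ (.kinv i) = qh ^ D.cartan i j • D.op₂ (.e j) ∧
    D.op₂ (.k i) * D.op₂ (.f j) * D.op₂ (.kinv i) = qh ^ (-D.cartan i j) • D.op₂ (.f j) := by
  have hk : ∀ l : ℤ, D.kop i 1 * D.kop j l * D.kop i (-1) = D.kop j l := by
    intro l
    rw [kop_comm, mul_assoc, kop_mul, add_neg_cancel, kop_zero, mul_one]
  have hg : D.kop i 1 * D.gop j 1 * D.kop i (-1) = D.gop j 1 := by
    rw [← gop_kop, mul_assoc, kop_mul, add_neg_cancel, kop_zero, mul_one]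
  have he : D.kop i 1 * D.op (.e j) * D.kop i (-1) = qh ^ D.cartan i j • D.op (.e j) := by
    rw [kop_e, smul_mul_assoc, mul_assoc, kop_mul, add_neg_cancel, kop_zero, mul_one, one_mul]
  have hf : D.kop i 1 * D.op (.f j) * D.kop i (-1) = qh ^ (-D.cartan i j) • D.op (.f j) := by
    rw [kop_f, smul_mul_assoc, mul_assoc, kop_mul, add_neg_cancel, kop_zero, mul_one, one_mul]
  refine ⟨?_, ?_, ?_, ?_, ?_⟩
  · rw [op₂_k, op₂_k, map_mul', map_mul', kop_comm]
  · rw [op₂_k, op₂_kinv, map_mul', kop_mul, add_neg_cancel, kop_zero]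
    exact TensorProduct.map_one
  · rw [op₂_k, op₂_kinv, map_mul', kop_mul, neg_add_cancel, kop_zero]
    exact TensorProduct.map_one
  · rw [op₂_k, op₂_kinv, op₂_e, mul_add, add_mul, map_mul', map_mul', map_mul', map_mul', hk, hg,
      he, TensorProduct.map_smul_left, TensorProduct.map_smul_right, smul_add]
  · rw [op₂_k, op₂_kinv, op₂_f, mul_add, add_mul, map_mul', map_mul', map_mul', map_mul', hk, hg,
      hf, TensorProduct.map_smul_left, TensorProduct.map_smul_right, smul_add]

theorem lift_evalWord {A B ι : Type*} [Semiring A] [Algebra Kq A] [Semiring B] [Algebra Kq B]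
    (φ : A →ₐ[Kq] B) (x : ι → A) (z : List ι →₀ Kq) :
    φ (QSerre.evalWord Kq x z) = QSerre.evalWord Kq (fun i => φ (x i)) z := by
  have : φ.toLinearMap ∘ₗ QSerre.evalWord Kq x = QSerre.evalWord Kq (fun i => φ (x i)) := by
    refine QSerre.lin_ext ?_ fun j z ih => ?_
    · simp [QSerre.evalWord_nil]
    · simp only [LinearMap.comp_apply, AlgHom.toLinearMap_apply] at ih ⊢
      rw [QSerre.evalWord_cons, QSerre.evalWord_cons, map_mul, ih]
  exact LinearMap.congr_fun this z

theorem op₂_rel (D : Datum m n) {x y : FreeAlgebra Kq (Gen (rk m n))} (h : D.Rel x y) :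
    FreeAlgebra.lift Kq D.op₂ x = FreeAlgebra.lift Kq D.op₂ y := by
  have hr := D.op₂_relations
  cases h with
  | k_comm i j => simpa using (hr i j).1
  | k_kinv i => simpa using (hr i i).2.1
  | kinv_k i => simpa using (hr i i).2.2.1
  | k_e i j => simpa using (hr i j).2.2.2.1
  | k_f i j => simpa using (hr i j).2.2.2.2
  | e_f i j =>
    have h := D.op₂_ef i j
    rw [apply_ite (FreeAlgebra.lift Kq D.op₂)]
    simpa only [map_sub, map_mul, map_smul, map_pow, map_zero, FreeAlgebra.lift_ι_apply] using h
  | serre_e z hz =>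
    rw [lift_evalWord, map_zero]
    simpa only [FreeAlgebra.lift_ι_apply] using D.serre_e_VV z hz
  | serre_f z hz =>
    rw [lift_evalWord, map_zero]
    simpa only [FreeAlgebra.lift_ι_apply] using D.serre_f_VV z hz

/-- The representation of `U_q(osp(V))` on `V ⊗ V`. -/
noncomputable def rho₂ (D : Datum m n) : D.Uq →ₐ[Kq] Module.End Kq (D.V ⊗[Kq] D.V) :=
  RingQuot.liftAlgHom Kq ⟨FreeAlgebra.lift Kq D.op₂, fun _ _ h => D.op₂_rel h⟩

theorem rho₂_gen (D : Datum m n) (g : Gen (rk m n)) : D.rho₂ (D.gen g) = D.op₂ g := by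
  have := RingQuot.liftAlgHom_mkAlgHom_apply Kq (FreeAlgebra.lift Kq D.op₂)
    (fun _ _ h => D.op₂_rel h) (FreeAlgebra.ι Kq g)
  rw [FreeAlgebra.lift_ι_apply] at this
  exact this

/-- The `U_q(osp(V))`-module `V ⊗ V`. -/
def TensorSquare (D : Datum m n) : Type := D.V ⊗[Kq] D.V

noncomputable instance (D : Datum m n) : AddCommGroup D.TensorSquare :=
  inferInstanceAs (AddCommGroup (D.V ⊗[Kq] D.V))

noncomputable instance (D : Datum m n) : Module Kq D.TensorSquare :=
  inferInstanceAs (Module Kq (D.V ⊗[Kq] D.V))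

noncomputable instance (D : Datum m n) : Module D.Uq D.TensorSquare :=
  Module.compHom (D.V ⊗[Kq] D.V) D.rho₂.toRingHom

instance (D : Datum m n) : IsScalarTower Kq D.Uq D.TensorSquare where
  smul_assoc x u w := LinearMap.congr_fun (map_smul D.rho₂ x u) w

theorem gen_smul (D : Datum m n) (g : Gen (rk m n)) (w : D.TensorSquare) :
    D.gen g • w = (D.op₂ g : Module.End Kq (D.V ⊗[Kq] D.V)) w :=
  LinearMap.congr_fun (D.rho₂_gen g) w

/-- The vector `v_a ⊗ v_b`. -/
noncomputable def vv (D : Datum m n) (a b : Fin (m + n)) : D.TensorSquare :=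
  D.v a ⊗ₜ[Kq] D.v b

/-! ### Highest weight vectors -/

/-- The value `μ(h_i)` for a weight `μ`, given in the basis `ε_1, …, ε_s`. -/
noncomputable def weightH (D : Datum m n) (μ : Fin (rk m n) → ℤ) (i : Fin (rk m n)) : ℤ :=
  ∑ r : Fin (rk m n), μ r *
    D.chevH i ⟨r, by have := r.2; unfold rk at *; omega⟩ ⟨r, by have := r.2; unfold rk at *; omega⟩

/-- `w` is a highest weight vector of weight `μ`. -/
def IsHighestWeight (D : Datum m n) {W : Type*} [AddCommGroup W] [Module Kq W] [Module D.Uq W]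
    [IsScalarTower Kq D.Uq W] (μ : Fin (rk m n) → ℤ) (w : W) : Prop :=
  w ≠ 0 ∧ ∀ i, D.gen (.e i) • w = 0 ∧ D.gen (.k i) • w = qh ^ D.weightH μ i • w

/-- The index of `v_1`. -/
def one (D : Datum m n) : Fin (m + n) := ⟨0, by have := D.two_lt; omega⟩

/-- The index of `v_2`. -/
def two (D : Datum m n) : Fin (m + n) := ⟨1, by have := D.two_lt; omega⟩

noncomputable def w₁ (D : Datum m n) : D.TensorSquare := D.vv D.one D.one

noncomputable def w₂ (D : Datum m n) : D.TensorSquare :=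
  D.vv D.one D.two
    - ((sgn (D.parity D.one * (D.parity D.one + D.parity D.two)) : Kq) * q ^ sgn (D.parity D.one)) •
      D.vv D.two D.one

noncomputable def w₃ (D : Datum m n) (c : Fin (m + n) → Kq) : D.TensorSquare :=
  ∑ i, c i • D.vv i i.rev

/-- The relations that determine the coefficients `c_i` of `w_3`. -/
structure IsCoeff (D : Datum m n) (c : Fin (m + n) → Kq) : Prop where
  one : c D.one = 1
  /-- `c_{a+1}` in terms of `c_a` for `1 ≤ a < s`; here `b` stands for `a + 1`. -/
  step : ∀ a b : Fin (m + n), (b : ℕ) = a + 1 → (b : ℕ) < rk m n →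
    c b = qh ^ (sgn (D.parity a) + sgn (D.parity b)) * (D.theta a * D.theta b : ℤ) * c a
  /-- `c_{a'}` in terms of `c_{(a+1)'}` for `1 ≤ a < s`; here `b` stands for `a + 1`. -/
  step_rev : ∀ a b : Fin (m + n), (b : ℕ) = a + 1 → (b : ℕ) < rk m n →
    c a.rev = sgn (D.parity a + D.parity b) * qh ^ (sgn (D.parity a) + sgn (D.parity b))
      * (D.theta a * D.theta b : ℤ) * c b.rev
  /-- For odd `m`: `c_{s+1}` in terms of `c_s`; here `b` stands for `s + 1`. -/
  odd : Odd m → ∀ b : Fin (m + n), (b : ℕ) = D.last + 1 →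
    c b = qh ^ sgn (D.parity D.last) * (D.theta D.last * D.theta b : ℤ) * c D.last
  /-- For odd `m`: `c_{s+2}` in terms of `c_{s+1}`; here `b`, `d` stand for `s + 1`, `s + 2`. -/
  odd_rev : Odd m → ∀ b d : Fin (m + n), (b : ℕ) = D.last + 1 → (d : ℕ) = D.last + 2 →
    c d = sgn (D.parity D.last + D.parity b) * qh ^ sgn (D.parity D.last)
      * (D.theta D.last * D.theta b : ℤ) * c b
  /-- For even `m` and even `v_s`: `c_{s+1}` in terms of `c_{s-1}`; here `a`, `b` stand for `s - 1`,
  `s + 1`. -/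
  fork : D.Fork → ∀ a b : Fin (m + n), (D.last : ℕ) = a + 1 → (b : ℕ) = D.last + 1 →
    c b = qh ^ (sgn (D.parity D.last) + sgn (D.parity a)) * (D.theta a * D.theta b : ℤ) * c a
  /-- For even `m` and odd `v_s`: `c_{s+1}` in terms of `c_s`; here `b` stands for `s + 1`. -/
  long : D.Long → ∀ b : Fin (m + n), (b : ℕ) = D.last + 1 → c b = -q ^ (-2 : ℤ) * c D.last

end Datum
end Osp

namespace Osp
namespace Datum
open scoped TensorProduct
variable {m n : ℕ}

/-! ### The Chevalley generators on basis vectors -/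

/-! For generation, pass to the dual space. A proper submodule `M` of `V ⊗ V` is annihilated by some
nonzero functional `φ`. If `φ ∘ f_i ≠ 0` for some `i`, then `φ ∘ f_i` again annihilates `M`. Since
every `f_i` strictly raises the index sum of `v_a ⊗ v_b`, replacing `φ` by `φ ∘ f_i` can be repeated
only finitely often, so there is a nonzero `φ` that annihilates `M` and all images of the `f_i`
(`exists_isColowest`, `submodule_eq_top`). It remains to compute these "colowest" functionals, that
is, the dual of the quotient of `V ⊗ V` by the sum of the images of the `f_i`, and to see that the
proposed generators leave none but zero.

Every index other than `1` is the head of an arrow of some `f_i` (`exists_arrow`). If that `f_i`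
kills the other tensor factor, then `φ` vanishes on the pair. Outside weight zero only `v_1 ⊗ v_1`,
`v_1 ⊗ v_2`, `v_2 ⊗ v_1` survive, together with `v_1 ⊗ v_3`, `v_3 ⊗ v_1` if the diagram is a fork
and `N = 4`. The vector `w_1` settles the first of these. The second and third satisfy one relation
coming from `f_1 (v_1 ⊗ v_1)`, and `φ w_2 = 0` is an independent one because `1 + q^{±2} ≠ 0`.

On the zero weight space the `f_i` give the same recursion as the one that defines the `c_a`, up to
a sign: `φ (v_a ⊗ v_{a'})` equals `± c_a φ (v_1 ⊗ v_{1'})` (`IsColowest.zero_weight`). So `φ` is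
determined there by one value, and `v_1 ⊗ v_{1'}` or `v_{1'} ⊗ v_1` forces that value to vanish. For
`w_3` one finds `φ w_3 = ± φ (v_1 ⊗ v_{1'}) ∑ (-1)^{|a|} c_a²`. The sum is a quantum superdimension;
after multiplication by `q - q⁻¹` it telescopes in each half of the basis and factors explicitly,
and it is nonzero when `m ≠ n` (`sum_expo_ne_zero`). In the exceptional case with `N = 4`, part (c)
recovers the missing value by applying `e_1`.

Both the recursion for `c_a` and that for `φ` are governed by one exponent function `expo`, which
changes by `(α_i, α_i)` along each arrow of the `i`-th simple root (`expo_edge`), whatever the shape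
of the diagram. It yields the closed form `coeff` of the coefficients and the cancellation in `e_i
w_3`. -/

theorem toLin'_v (D : Datum m n) (M : Matrix (Fin (m + n)) (Fin (m + n)) Kq) (b : Fin (m + n)) :
    Matrix.toLin' M (D.v b) = fun a => M a b := by
  rw [v, Matrix.toLin'_apply, Matrix.mulVec_single_one]
  rfl

/-- The coefficient of `v_{b'}` in `e_i v_{a'}`, where the `i`-th simple root is `ε_a - ε_b`. -/
noncomputable def coeffE (D : Datum m n) (i : Fin (rk m n)) : ℤ :=
  -(sgn (D.parity (D.fst i) * (D.parity (D.fst i) + D.parity (D.snd i)))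
    * D.theta (D.fst i) * D.theta (D.snd i))

/-- The ratio of the coefficient of `v_{a'}` in `f_i v_{b'}` and that of `v_b` in `f_i v_a`, where
the `i`-th simple root is `ε_a - ε_b`. -/
noncomputable def coeffF (D : Datum m n) (i : Fin (rk m n)) : ℤ :=
  -(sgn (D.parity (D.snd i) * (D.parity (D.fst i) + D.parity (D.snd i)))
    * D.theta (D.fst i) * D.theta (D.snd i))

theorem long_fst (D : Datum m n) (i : Fin (rk m n)) (h : D.snd i = (D.fst i).rev) :
    D.Long ∧ D.fst i = D.last ∧ D.parity (D.fst i) = 1 ∧ D.parity (D.snd i) = 1 ∧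
      D.theta (D.snd i) = - D.theta (D.fst i) := by
  have hl := (D.long_iff i).2 h
  have hf := D.not_fork_of_long hl.1
  have h2 : D.fst i = D.last := by
    rcases D.fst_val i with ⟨h1, _⟩ | ⟨_, h1⟩
    · exact absurd h1 hf
    · apply Fin.ext; rw [h1, hl.2]; rfl
  have hp : D.parity (D.fst i) = 1 := by rw [h2]; exact hl.1.2
  refine ⟨hl.1, h2, hp, ?_, ?_⟩
  · rw [h, D.parity_rev, hp]
  · have := D.theta_odd _ hp
    rw [h, this, neg_neg]

/-- When `α_i = 2ε_s`, the arrows `v_b ↦ v_a` and `v_{a'} ↦ v_{b'}` are the same, so the general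
formula must give the coefficient `1` of `E_{s,s+1}`. It does, because `θ_{s'} = -θ_s`. Thanks to
this the long root needs no separate formulas below. -/
theorem coeffE_long (D : Datum m n) (i : Fin (rk m n)) (h : D.snd i = (D.fst i).rev) :
    D.coeffE i = 1 := by
  obtain ⟨-, -, h1, h2, h3⟩ := D.long_fst i h
  have := D.theta_sq (D.fst i)
  rw [coeffE, h1, h2, h3, show sgn (1 * (1 + 1)) = 1 from by decide]
  linarith

theorem coeffF_long (D : Datum m n) (i : Fin (rk m n)) (h : D.snd i = (D.fst i).rev) :
    D.coeffF i = 1 := by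
  obtain ⟨-, -, h1, h2, h3⟩ := D.long_fst i h
  have := D.theta_sq (D.fst i)
  rw [coeffF, h1, h2, h3, show sgn (1 * (1 + 1)) = 1 from by decide]
  linarith

/-- One formula for all diagrams: for the long root the two columns coincide and the first branch
takes precedence. -/
theorem chevE_apply (D : Datum m n) (i : Fin (rk m n)) (x y : Fin (m + n)) :
    D.chevE i x y = if y = D.snd i then (if x = D.fst i then 1 else 0)
      else if y = (D.fst i).rev then (if x = (D.snd i).rev then D.coeffE i else 0) else 0 := by
  by_cases h : D.snd i = (D.fst i).rev
  · unfold chevE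
    rw [if_pos ((D.long_iff i).2 h), Matrix.single_apply, ← h]
    simp only [eq_comm (a := D.fst i), eq_comm (a := D.snd i)]
    split_ifs <;> simp_all
  · unfold chevE X coeffE
    rw [if_neg (fun e => h ((D.long_iff i).1 e)), Matrix.sub_apply, Matrix.single_apply,
      Matrix.single_apply]
    simp only [eq_comm (a := D.fst i), eq_comm (a := D.snd i), eq_comm (a := (D.fst i).rev),
      eq_comm (a := (D.snd i).rev)]
    split_ifs <;> simp_all

/-- The normalization `α` depends on the type of the root, but only `α ≠ 0` and the ratio `coeffF`
matter for functionals that vanish on the image of `f_i`. -/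
theorem chevF_apply (D : Datum m n) (i : Fin (rk m n)) : ∃ α : ℤ, α ≠ 0 ∧ ∀ x y,
    D.chevF i x y = if y = D.fst i then (if x = D.snd i then α else 0)
      else if y = (D.snd i).rev then (if x = (D.fst i).rev then α * D.coeffF i else 0) else 0 := by
  by_cases h : D.snd i = (D.fst i).rev
  · refine ⟨-2, by decide, fun x y => ?_⟩
    unfold chevF
    rw [if_pos ((D.long_iff i).2 h), Matrix.single_apply, ← h, coeffF_long D i h, h, Fin.rev_rev]
    simp only [eq_comm (a := D.fst i), eq_comm (a := (D.fst i).rev)]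
    split_ifs <;> simp_all
  · refine ⟨sgn (D.parity (D.fst i)), sgn_ne _, fun x y => ?_⟩
    have h' : D.fst i ≠ (D.snd i).rev := fun e => h (by rw [e, Fin.rev_rev])
    unfold chevF X coeffF
    rw [if_neg (fun e => h ((D.long_iff i).1 e)), Matrix.smul_apply, Matrix.sub_apply,
      Matrix.single_apply, Matrix.single_apply, add_comm (D.parity (D.snd i))]
    simp only [eq_comm (a := D.fst i), eq_comm (a := D.snd i), eq_comm (a := (D.fst i).rev),
      eq_comm (a := (D.snd i).rev), smul_eq_mul]
    split_ifs <;> simp_all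
    exact Or.inl (by ring)

theorem op_e_snd (D : Datum m n) (i : Fin (rk m n)) :
    D.op (.e i) (D.v (D.snd i)) = D.v (D.fst i) := by
  rw [op, toLin'_v]
  funext x
  simp [mat, chevE_apply, v, Pi.single_apply]

theorem op_e_fst_rev (D : Datum m n) (i : Fin (rk m n)) :
    D.op (.e i) (D.v (D.fst i).rev) = (D.coeffE i : Kq) • D.v (D.snd i).rev := by
  by_cases h : D.snd i = (D.fst i).rev
  · have := D.op_e_snd i
    rw [coeffE_long D i h, ← h, this, h, Fin.rev_rev, Int.cast_one, one_smul]
  · rw [op, toLin'_v]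
    funext x
    simp [mat, chevE_apply, v, Pi.single_apply, Ne.symm h]

theorem op_e_other (D : Datum m n) (i : Fin (rk m n)) (b : Fin (m + n)) (h : b ≠ D.snd i)
    (h' : b ≠ (D.fst i).rev) : D.op (.e i) (D.v b) = 0 := by
  rw [op, toLin'_v]
  funext x
  simp [mat, chevE_apply, h, h']

/-- The action of `f_i` on basis vectors. -/
theorem op_f_v (D : Datum m n) (i : Fin (rk m n)) : ∃ α : Kq, α ≠ 0 ∧
    D.op (.f i) (D.v (D.fst i)) = α • D.v (D.snd i) ∧
    D.op (.f i) (D.v (D.snd i).rev) = (α * D.coeffF i) • D.v (D.fst i).rev ∧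
    ∀ b, b ≠ D.fst i → b ≠ (D.snd i).rev → D.op (.f i) (D.v b) = 0 := by
  obtain ⟨α, hα, hF⟩ := D.chevF_apply i
  have h1 : D.op (.f i) (D.v (D.fst i)) = (D.kappa i * α : Kq) • D.v (D.snd i) := by
    rw [op, toLin'_v]
    funext x
    simp [mat, hF, v, Pi.single_apply]
  refine ⟨D.kappa i * α, mul_ne_zero (D.kappa_ne i) (Int.cast_ne_zero.2 hα), h1, ?_, ?_⟩
  · by_cases h : D.snd i = (D.fst i).rev
    · rw [coeffF_long D i h, ← h, h, Fin.rev_rev, ← h, h1, Int.cast_one, mul_one]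
    · have h' : (D.snd i).rev ≠ D.fst i := fun e => h (by rw [← e, Fin.rev_rev])
      rw [op, toLin'_v]
      funext x
      simp [mat, hF, v, Pi.single_apply, h', mul_assoc]
  · intro b h h'
    rw [op, toLin'_v]
    funext x
    simp [mat, hF, h, h']

/-! ### The coproduct on the basis `v_a ⊗ v_b`, and coordinates. -/

theorem op₂_e_vv (D : Datum m n) (i : Fin (rk m n)) (a b : Fin (m + n)) :
    D.op₂ (.e i) (D.v a ⊗ₜ[Kq] D.v b)
      = ((sgn (D.rootParity i * D.parity a) : Kq) * qh ^ D.chevH i a a) •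
          (D.v a ⊗ₜ[Kq] D.op (.e i) (D.v b))
        + qh ^ (-D.chevH i b b) • (D.op (.e i) (D.v a) ⊗ₜ[Kq] D.v b) := by
  rw [op₂_e, LinearMap.add_apply, TensorProduct.map_tmul, TensorProduct.map_tmul, gop,
    Module.End.mul_apply]
  simp only [v, signOp_basis, kop_basis, map_smul, smul_smul, one_mul, neg_one_mul,
    ← TensorProduct.smul_tmul', TensorProduct.tmul_smul]

theorem op₂_f_vv (D : Datum m n) (i : Fin (rk m n)) (a b : Fin (m + n)) :
    D.op₂ (.f i) (D.v a ⊗ₜ[Kq] D.v b)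
      = ((sgn (D.rootParity i * D.parity a) : Kq) * qh ^ D.chevH i a a) •
          (D.v a ⊗ₜ[Kq] D.op (.f i) (D.v b))
        + qh ^ (-D.chevH i b b) • (D.op (.f i) (D.v a) ⊗ₜ[Kq] D.v b) := by
  rw [op₂_f, LinearMap.add_apply, TensorProduct.map_tmul, TensorProduct.map_tmul, gop,
    Module.End.mul_apply]
  simp only [v, signOp_basis, kop_basis, map_smul, smul_smul, one_mul, neg_one_mul,
    ← TensorProduct.smul_tmul', TensorProduct.tmul_smul]

theorem op₂_k_vv (D : Datum m n) (i : Fin (rk m n)) (a b : Fin (m + n)) :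
    D.op₂ (.k i) (D.v a ⊗ₜ[Kq] D.v b)
      = qh ^ (D.chevH i a a + D.chevH i b b) • (D.v a ⊗ₜ[Kq] D.v b) := by
  rw [op₂_k, TensorProduct.map_tmul]
  simp only [v, kop_basis, smul_smul, one_mul, ← TensorProduct.smul_tmul',
    TensorProduct.tmul_smul, zpow_add₀ qh_ne, mul_comm (qh ^ D.chevH i a a)]

theorem tmul_basis (D : Datum m n) (a b : Fin (m + n)) :
    ((Pi.basisFun Kq (Fin (m + n))).tensorProduct (Pi.basisFun Kq (Fin (m + n)))) (a, b)
      = D.v a ⊗ₜ[Kq] D.v b := by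
  simp [v]

theorem functional_ext (D : Datum m n) (φ : D.V ⊗[Kq] D.V →ₗ[Kq] Kq)
    (h : ∀ a b, φ (D.v a ⊗ₜ[Kq] D.v b) = 0) : φ = 0 := by
  refine ((Pi.basisFun Kq (Fin (m + n))).tensorProduct (Pi.basisFun Kq (Fin (m + n)))).ext ?_
  rintro ⟨a, b⟩
  rw [D.tmul_basis, h, LinearMap.zero_apply]

/-- The coordinate function of `v_a ⊗ v_b`. -/
noncomputable def coordVV (D : Datum m n) (a b : Fin (m + n)) : D.V ⊗[Kq] D.V →ₗ[Kq] Kq :=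
  ((Pi.basisFun Kq (Fin (m + n))).tensorProduct (Pi.basisFun Kq (Fin (m + n)))).coord (a, b)

theorem coordVV_apply (D : Datum m n) (a b c d : Fin (m + n)) :
    D.coordVV a b (D.v c ⊗ₜ[Kq] D.v d) = if c = a ∧ d = b then 1 else 0 := by
  rw [← D.tmul_basis, coordVV, Module.Basis.coord_apply, Module.Basis.repr_self,
    Finsupp.single_apply]
  simp only [Prod.mk.injEq]

/-! ### The exponents -/

theorem theta_rev (D : Datum m n) (a : Fin (m + n)) :
    D.theta a.rev = sgn (D.parity a) * D.theta a := by
  rcases par_cases (D.parity a) with h | h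
  · rw [D.theta_even a h, D.theta_even a.rev (by rw [D.parity_rev, h]), h]; decide
  · rw [D.theta_odd a h, h, show sgn 1 = -1 from by decide]; ring

/-- For an odd self-dual index the sign condition would read `θ = -θ`. -/
theorem parity_mid (D : Datum m n) (a : Fin (m + n)) (h : a.rev = a) : D.parity a = 0 := by
  rcases par_cases (D.parity a) with h' | h'
  · exact h'
  · have h1 := D.theta_odd a h'
    rw [h] at h1
    exact absurd (show D.theta a = 0 by omega) (D.theta_ne a)

/-- Twice the sum of the signs `(-1)^{|j|}` over `j < a`. -/
def height (D : Datum m n) (a : Fin (m + n)) : ℤ :=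
  ∑ j, if j < a then 2 * sgn (D.parity j) else 0

/-- Twice the superdimension of `V`. -/
def sdim₂ (D : Datum m n) : ℤ := ∑ j, 2 * sgn (D.parity j)

/-- The correction of the exponent in the second half of the basis. -/
def shift (_D : Datum m n) (a : Fin (m + n)) : ℤ :=
  if (a : ℕ) < rk m n then 0 else if (a.rev : ℕ) < rk m n then -2 else -1

/-- Up to a constant, the exponent of `q^{1/2}` in the coefficient `c_a` of `w₃`. -/
def expo (D : Datum m n) (a : Fin (m + n)) : ℤ :=
  D.height a + sgn (D.parity a) + D.shift a

theorem height_step (D : Datum m n) (a b : Fin (m + n)) (h : (b : ℕ) = a + 1) :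
    D.height b = D.height a + 2 * sgn (D.parity a) := by
  have : 2 * sgn (D.parity a) = ∑ j, if j = a then 2 * sgn (D.parity j) else 0 := by simp
  rw [height, height, this, ← Finset.sum_add_distrib]
  refine Finset.sum_congr rfl fun j _ => ?_
  simp only [Fin.lt_def, Fin.ext_iff, h]
  split_ifs <;> omega

/-- The reflection preserves parities, so the height of `a'` is the sum over `j > a`; together with
`j < a` and `j = a` this exhausts the basis. -/
theorem height_rev (D : Datum m n) (a : Fin (m + n)) :
    D.height a + D.height a.rev + 2 * sgn (D.parity a) = D.sdim₂ := by
  have h1 : D.height a.rev = ∑ j, if a < j then 2 * sgn (D.parity j) else 0 := by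
    rw [height, ← Equiv.sum_comp Fin.revPerm]
    simp only [Fin.revPerm_apply, D.parity_rev, Fin.rev_lt_rev]
  have h2 : 2 * sgn (D.parity a) = ∑ j, if j = a then 2 * sgn (D.parity j) else 0 := by simp
  rw [h1, h2, height, sdim₂, ← Finset.sum_add_distrib, ← Finset.sum_add_distrib]
  refine Finset.sum_congr rfl fun j _ => ?_
  simp only [Fin.lt_def, Fin.ext_iff]
  split_ifs <;> omega

theorem shift_rev (D : Datum m n) (a : Fin (m + n)) : D.shift a + D.shift a.rev = -2 := by
  have := a.2
  simp only [shift, Fin.rev_rev, Fin.val_rev]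
  unfold rk
  split_ifs <;> omega

theorem expo_rev (D : Datum m n) (a : Fin (m + n)) : D.expo a + D.expo a.rev = D.sdim₂ - 2 := by
  have h1 := D.height_rev a
  have h2 := D.shift_rev a
  rw [expo, expo, D.parity_rev]
  omega

theorem expo_step (D : Datum m n) (a b : Fin (m + n)) (h : (b : ℕ) = a + 1) :
    D.expo b - D.expo a = sgn (D.parity a) + sgn (D.parity b) + (D.shift b - D.shift a) := by
  rw [expo, expo, D.height_step a b h]
  ring

theorem chevH_fst (D : Datum m n) (i : Fin (rk m n)) :
    D.chevH i (D.fst i) (D.fst i) = sgn (D.parity (D.fst i))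
      + if D.snd i = (D.fst i).rev then sgn (D.parity (D.fst i)) else 0 := by
  have h1 := D.fst_lt_snd i
  have h2 := D.fst_lt_rk i
  have e1 : D.fst i ≠ D.snd i := by rw [Ne, Fin.ext_iff]; omega
  have e2 : D.fst i ≠ (D.fst i).rev := by
    rw [Ne, Fin.ext_iff, Fin.val_rev]; unfold rk at *; omega
  rw [chevH_apply, if_pos rfl, root, form_sub_right, form_eps_eps, form_eps_eps, if_pos rfl,
    if_neg e1, if_neg e2]
  by_cases h : D.snd i = (D.fst i).rev
  · rw [if_pos h, if_pos (by rw [h, Fin.rev_rev]), h, D.parity_rev]; ring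
  · rw [if_neg h, if_neg (fun e => h (by rw [e, Fin.rev_rev]))]; ring

/-- This is `(-ε_b, α_i)` for `α_i = ε_a - ε_b`. The first condition singles out the middle vector
for odd `N`, which has weight zero, and the second the root `2ε_s`. -/
theorem chevH_snd_rev (D : Datum m n) (i : Fin (rk m n)) :
    D.chevH i (D.snd i).rev (D.snd i).rev
      = (if (D.snd i).rev = D.snd i then 0 else sgn (D.parity (D.snd i)))
      + if D.snd i = (D.fst i).rev then sgn (D.parity (D.fst i)) else 0 := by
  have h1 := D.fst_lt_snd i
  have e1 : (D.snd i).rev ≠ (D.fst i).rev := by rw [Ne, Fin.rev_inj, Fin.ext_iff]; omega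
  rw [chevH_apply, if_pos rfl, root, form_sub_right, form_eps_eps, form_eps_eps, if_pos rfl,
    if_neg e1]
  have e : (D.snd i).rev = D.fst i ↔ D.snd i = (D.fst i).rev := by
    constructor
    · intro e; rw [← e, Fin.rev_rev]
    · intro e; rw [e, Fin.rev_rev]
  simp only [e]
  split_ifs <;> ring

theorem chevH_rev (D : Datum m n) (i : Fin (rk m n)) (a : Fin (m + n)) :
    D.chevH i a.rev a.rev = - D.chevH i a a := by
  rw [chevH_apply, chevH_apply, if_pos rfl, if_pos rfl, eps_rev, form_neg_left]

/-- The right side is `(ε_a, α_i) + (-ε_b, α_i) = (α_i, α_i)`. Thus `expo` plays the role of `-(2ρ,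
ε_a)` up to a constant, and the jumps of `shift` in the middle of the basis are chosen to make this
true for every type of last root. -/
theorem expo_edge (D : Datum m n) (i : Fin (rk m n)) :
    D.expo (D.snd i) - D.expo (D.fst i)
      = D.chevH i (D.fst i) (D.fst i) + D.chevH i (D.snd i).rev (D.snd i).rev := by
  have hi := i.2
  have hN := D.two_lt
  have hs := D.snd_val i
  rw [chevH_fst, chevH_snd_rev]
  by_cases hl : D.snd i = (D.fst i).rev
  · obtain ⟨hL, -, hp, hp', -⟩ := D.long_fst i hl
    have hf : (D.snd i : ℕ) = D.fst i + 1 := by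
      rcases D.fst_val i with ⟨h, -⟩ | ⟨-, h⟩
      · exact absurd h (D.not_fork_of_long hL)
      · omega
    have h3 := D.fst_lt_rk i
    have hlv := congrArg Fin.val hl
    rw [Fin.val_rev] at hlv
    have e1 : (D.snd i).rev ≠ D.snd i := by
      rw [Ne, Fin.ext_iff, Fin.val_rev]; omega
    -- Both sides are `-4`: on the left, `-1 - 1` from the two odd vectors and `-2` from the jump of
    -- `shift`.
    rw [D.expo_step _ _ hf, if_pos hl, if_neg e1, hp, hp', shift, shift, if_pos h3,
      if_neg (by unfold rk at *; omega), if_pos (by rw [hl, Fin.rev_rev]; exact h3)]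
    decide
  rw [if_neg hl]
  rcases D.fst_val i with ⟨hF, h1, h2⟩ | ⟨hF, h1⟩
  · have he := D.fork_even hF
    rw [Nat.even_iff] at he
    have hlast : (D.last : ℕ) = rk m n - 1 := rfl
    have e0 : (D.snd i) = D.last.rev := by
      rw [Fin.ext_iff, Fin.val_rev]; unfold rk at *; omega
    have hp : D.parity (D.snd i) = 0 := by rw [e0, D.parity_rev]; exact hF.2
    have hi2 : 2 ≤ rk m n := by unfold rk at *; omega
    -- The fork root skips the index `s`, so the difference is taken in two steps. The second
    -- contributes `1 + 1 - 2 = 0`: the exponents at `s` and `s + 1` agree.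
    have s1 := D.expo_step (D.fst i) D.last (by omega)
    have s2 := D.expo_step D.last (D.snd i) (by omega)
    have e1 : (D.snd i).rev ≠ D.snd i := by
      rw [Ne, Fin.ext_iff, Fin.val_rev]; unfold rk at *; omega
    have t1 : D.shift (D.fst i) = 0 := if_pos (by omega)
    have t2 : D.shift D.last = 0 := if_pos (by omega)
    have t3 : D.shift (D.snd i) = -2 := by
      rw [shift, if_neg (by omega), if_pos (by rw [Fin.val_rev]; unfold rk at *; omega)]
    have hs0 : sgn 0 = 1 := by decide
    rw [hF.2] at s1 s2
    rw [if_neg e1]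
    rw [hp] at s2 ⊢
    omega
  · have hf : (D.snd i : ℕ) = D.fst i + 1 := by omega
    have t1 : D.shift (D.fst i) = 0 := if_pos (by omega)
    rw [D.expo_step _ _ hf, t1]
    by_cases hb : (D.snd i : ℕ) < rk m n
    · have e1 : (D.snd i).rev ≠ D.snd i := by
        rw [Ne, Fin.ext_iff, Fin.val_rev]; unfold rk at *; omega
      rw [if_neg e1, shift, if_pos hb]
      ring
    -- The head is the middle vector for odd `N`. It is even, and its sign `1` is cancelled by the
    -- value `-1` of `shift`.
    · have e1 : (D.snd i).rev = D.snd i := by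
        rw [Fin.ext_iff, Fin.val_rev] at hl
        rw [Fin.ext_iff, Fin.val_rev]; unfold rk at *; omega
      rw [if_pos e1, shift, if_neg hb, e1, if_neg hb, D.parity_mid _ e1]
      simp [sgn]

theorem expo_edge_rev (D : Datum m n) (i : Fin (rk m n)) :
    D.expo (D.fst i).rev - D.expo (D.snd i).rev
      = D.chevH i (D.fst i) (D.fst i) + D.chevH i (D.snd i).rev (D.snd i).rev := by
  have h1 := D.expo_rev (D.fst i)
  have h2 := D.expo_rev (D.snd i)
  rw [← expo_edge]
  omega

/-! ### The coefficients of `w₃`: closed form, existence and uniqueness. -/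

/-- The closed form of the coefficients of `w₃`. -/
noncomputable def coeff (D : Datum m n) (a : Fin (m + n)) : Kq :=
  (D.theta D.one * D.theta a : ℤ) * qh ^ (D.expo a - D.expo D.one)

theorem coeff_ratio (D : Datum m n) (a b : Fin (m + n)) (k : ℤ) (h : D.expo b - D.expo a = k) :
    D.coeff b = qh ^ k * (D.theta a * D.theta b : ℤ) * D.coeff a := by
  have h1 : ((D.theta a : ℤ) : Kq) * D.theta a = 1 := by exact_mod_cast D.theta_sq a
  have h2 : D.expo b - D.expo D.one = k + (D.expo a - D.expo D.one) := by omega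
  rw [coeff, coeff, h2, zpow_add₀ qh_ne]
  push_cast
  linear_combination (-(D.theta D.one * D.theta b * qh ^ k * qh ^ (D.expo a - D.expo D.one) : Kq))
    * h1

theorem theta_mul_rev (D : Datum m n) (a b : Fin (m + n)) :
    D.theta a.rev * D.theta b.rev
      = sgn (D.parity a + D.parity b) * (D.theta a * D.theta b) := by
  rw [theta_rev, theta_rev, sgn_add]; ring

/-- By `expo_rev` the mirrored arrow, from `b'` to `a'`, has the same difference of exponents. Only
the product of the `θ`'s changes, by a sign. -/
theorem coeff_edge_rev (D : Datum m n) (a b : Fin (m + n)) (k : ℤ)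
    (h : D.expo b - D.expo a = k) :
    D.coeff a.rev = sgn (D.parity a + D.parity b) * qh ^ k
      * (D.theta a * D.theta b : ℤ) * D.coeff b.rev := by
  have h1 := D.expo_rev a
  have h2 := D.expo_rev b
  rw [D.coeff_ratio b.rev a.rev k (by omega), theta_mul_rev, add_comm (D.parity b)]
  push_cast
  ring

/-- Each recursion is an instance of `coeff_ratio` or `coeff_edge_rev` once the increment of `expo`
is known. Within the first half this is the sum of two signs; `shift` enters only at the middle. -/
theorem isCoeff_coeff (D : Datum m n) : D.IsCoeff D.coeff := by
  have hN := D.two_lt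
  have hl : (D.last : ℕ) = rk m n - 1 := rfl
  have h0 := D.rk_pos
  have hodd : Odd m → (m + n) % 2 = 1 := by
    intro h
    have := h.add_even D.even_n
    exact Nat.odd_iff.1 this
  have step : ∀ a b : Fin (m + n), (b : ℕ) = a + 1 → (b : ℕ) < rk m n →
      D.expo b - D.expo a = sgn (D.parity a) + sgn (D.parity b) := by
    intro a b h h'
    rw [D.expo_step a b h, shift, shift, if_pos h', if_pos (by omega)]
    ring
  have odd : Odd m → ∀ b : Fin (m + n), (b : ℕ) = D.last + 1 →
      b.rev = b ∧ D.expo b - D.expo D.last = sgn (D.parity D.last) := by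
    intro hm b hb
    have := hodd hm
    have h1 : b.rev = b := by
      rw [Fin.ext_iff, Fin.val_rev]; unfold rk at *; omega
    refine ⟨h1, ?_⟩
    rw [D.expo_step _ b hb, shift, shift, h1, D.parity_mid b h1, if_neg (by omega),
      if_neg (by omega), if_pos (by omega), show sgn 0 = 1 from rfl]
    ring
  refine ⟨?_, fun a b h h' => ?_, fun a b h h' => ?_, fun hm b hb => ?_, fun hm b d hb hd => ?_,
    fun hF a b ha hb => ?_, fun hL b hb => ?_⟩
  · rw [coeff, D.theta_sq]; simp
  · exact D.coeff_ratio a b _ (step a b h h')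
  · exact D.coeff_edge_rev a b _ (step a b h h')
  · exact D.coeff_ratio _ b _ (odd hm b hb).2
  · have h1 := odd hm b hb
    have h2 := D.coeff_edge_rev D.last b _ h1.2
    have h3 : d = D.last.rev := by
      have := hodd hm
      rw [Fin.ext_iff, Fin.val_rev]; unfold rk at *; omega
    rw [h3, h2, h1.1]
  · have he := D.fork_even hF
    rw [Nat.even_iff] at he
    -- The increment from `s - 1` to `s + 1` is that from `s - 1` to `s`, since the step from `s` to
    -- `s + 1` contributes nothing.
    have h1 := step a D.last ha (by omega)
    have h2 := D.expo_step D.last b hb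
    have h3 : b = D.last.rev := by
      rw [Fin.ext_iff, Fin.val_rev]; unfold rk at *; omega
    have h4 : D.parity b = 0 := by rw [h3, D.parity_rev, hF.2]
    apply D.coeff_ratio
    rw [shift, shift, if_neg (by omega), if_pos (by rw [h3, Fin.rev_rev]; omega),
      if_pos (by omega), h4, hF.2, show sgn 0 = 1 from rfl] at h2
    rw [hF.2, show sgn 0 = 1 from rfl] at *
    omega
  · have he := D.long_even hL
    rw [Nat.even_iff] at he
    have h2 := D.expo_step D.last b hb
    have h3 : b = D.last.rev := by
      rw [Fin.ext_iff, Fin.val_rev]; unfold rk at *; omega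
    have h4 : D.parity b = 1 := by rw [h3, D.parity_rev, hL.2]
    rw [shift, shift, if_neg (by omega), if_pos (by rw [h3, Fin.rev_rev]; omega),
      if_pos (by omega), h4, hL.2, show sgn 1 = -1 from rfl] at h2
    -- The exponent `-4` of `q^{1/2}` is `-1 - 1` from the odd vectors and `-2` from `shift`; the
    -- minus sign of the recursion is `θ_s θ_{s'} = -1`.
    rw [D.coeff_ratio D.last b (-4) (by omega), h3, theta_rev, hL.2, show sgn 1 = -1 from rfl,
      q_zpow]
    have := D.theta_sq D.last
    rw [show D.theta D.last * (-1 * D.theta D.last) = -1 by linarith]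
    norm_num

/-- Every index but the first is the target of one of the recursions, whose source is an earlier
index; the closed form satisfies the same recursions. -/
theorem IsCoeff.eq_coeff {D : Datum m n} {c : Fin (m + n) → Kq} (h : D.IsCoeff c) :
    c = D.coeff := by
  have h' := D.isCoeff_coeff
  have hN := D.two_lt
  have hl : (D.last : ℕ) = rk m n - 1 := rfl
  have h0 := D.rk_pos
  have key : ∀ (k : ℕ) (hk : k < m + n), c ⟨k, hk⟩ = D.coeff ⟨k, hk⟩ := by
    intro k
    -- Strong induction is needed because in the fork case `c_{s+1}` is given in terms of `c_{s-1}`.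
    induction k using Nat.strong_induction_on with
    | _ k ih =>
      intro hk
      rcases Nat.eq_zero_or_pos k with rfl | hk0
      · exact h.one.trans h'.one.symm
      let a : Fin (m + n) := ⟨k - 1, by omega⟩
      let b : Fin (m + n) := ⟨k, hk⟩
      have hab : (b : ℕ) = a + 1 := by show k = k - 1 + 1; omega
      have iha : c a = D.coeff a := ih (k - 1) (by omega) _
      show c b = D.coeff b
      have hbk : (b : ℕ) = k := rfl
      by_cases c1 : k < rk m n
      · rw [h.step a b hab c1, h'.step a b hab c1, iha]
      -- In the second half, apply the mirrored recursion to the consecutive indices `b'` and `a' =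
      -- b' + 1`.
      by_cases c2 : (a.rev : ℕ) < rk m n
      · have h1 := h.step_rev b.rev a.rev (by rw [Fin.val_rev, Fin.val_rev]; omega) c2
        have h2 := h'.step_rev b.rev a.rev (by rw [Fin.val_rev, Fin.val_rev]; omega) c2
        rw [Fin.rev_rev, Fin.rev_rev] at h1 h2
        rw [h1, h2, iha]
      rw [Fin.val_rev] at c2
      rcases Nat.even_or_odd m with hm | hm
      · have hb : (b : ℕ) = D.last + 1 := by
          have := hm.add D.even_n
          rw [Nat.even_iff] at this; unfold rk at *; omega
        rcases par_cases (D.parity D.last) with hp | hp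
        · have hr : 2 ≤ rk m n := by
            have := hm.add D.even_n
            rw [Nat.even_iff] at this; unfold rk at *; omega
          let a' : Fin (m + n) := ⟨k - 2, by omega⟩
          have ha' : (D.last : ℕ) = a' + 1 := by show (D.last : ℕ) = k - 2 + 1; omega
          rw [h.fork ⟨hm, hp⟩ a' b ha' hb, h'.fork ⟨hm, hp⟩ a' b ha' hb, ih (k - 2) (by omega) _]
        · have ha : a = D.last := Fin.ext (by omega)
          rw [h.long ⟨hm, hp⟩ b hb, h'.long ⟨hm, hp⟩ b hb, ← ha, iha]
      · have ho := Nat.odd_iff.1 (hm.add_even D.even_n)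
        by_cases hb : (b : ℕ) = D.last + 1
        · have ha : a = D.last := Fin.ext (by omega)
          rw [h.odd hm b hb, h'.odd hm b hb, ← ha, iha]
        · have ha : (a : ℕ) = D.last + 1 := by unfold rk at *; omega
          rw [h.odd_rev hm a b ha (by omega), h'.odd_rev hm a b ha (by omega), iha]
  funext a
  exact key a a.2

/-! ### Highest weight vectors -/

theorem form_add_left (D : Datum m n) (μ μ' ν : Fin (rk m n) → ℤ) :
    D.form (μ + μ') ν = D.form μ ν + D.form μ' ν := by
  unfold form
  rw [← Finset.sum_add_distrib]
  exact Finset.sum_congr rfl fun r _ => by simp only [Pi.add_apply]; ring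

theorem weightH_eq_form (D : Datum m n) (μ : Fin (rk m n) → ℤ) (i : Fin (rk m n)) :
    D.weightH μ i = D.form μ (D.root i) := by
  unfold weightH
  rw [form]
  refine Finset.sum_congr rfl fun r _ => ?_
  rw [chevH_apply, if_pos rfl, form_eps, dif_pos r.2]
  ring

theorem weightH_eps_add (D : Datum m n) (a b : Fin (m + n)) (i : Fin (rk m n)) :
    D.weightH (D.eps a + D.eps b) i = D.chevH i a a + D.chevH i b b := by
  rw [weightH_eq_form, form_add_left, chevH_apply, chevH_apply, if_pos rfl, if_pos rfl]

theorem weightH_zero (D : Datum m n) (i : Fin (rk m n)) : D.weightH 0 i = 0 := by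
  simp [weightH]

theorem isHighestWeight_iff (D : Datum m n) (μ : Fin (rk m n) → ℤ) (w : D.V ⊗[Kq] D.V) :
    D.IsHighestWeight μ (show D.TensorSquare from w) ↔
      w ≠ 0 ∧ ∀ i, D.op₂ (.e i) w = 0 ∧ D.op₂ (.k i) w = qh ^ D.weightH μ i • w := by
  refine and_congr Iff.rfl (forall_congr' fun i => and_congr ?_ ?_)
  · exact Iff.of_eq (congrArg (· = 0) (D.gen_smul (.e i) w))
  · exact Iff.of_eq (congrArg (· = qh ^ D.weightH μ i • w) (D.gen_smul (.k i) w))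

theorem w₁_eq (D : Datum m n) : D.w₁ = D.v D.one ⊗ₜ[Kq] D.v D.one := rfl

theorem w₂_eq (D : Datum m n) : D.w₂ = D.v D.one ⊗ₜ[Kq] D.v D.two
    - ((sgn (D.parity D.one * (D.parity D.one + D.parity D.two)) : Kq) * q ^ sgn (D.parity D.one)) •
      (D.v D.two ⊗ₜ[Kq] D.v D.one) := rfl

theorem w₃_eq (D : Datum m n) (c : Fin (m + n) → Kq) :
    D.w₃ c = ∑ i, c i • (D.v i ⊗ₜ[Kq] D.v i.rev) := rfl

theorem one_val (D : Datum m n) : (D.one : ℕ) = 0 := rfl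

theorem two_val (D : Datum m n) : (D.two : ℕ) = 1 := rfl

theorem op_e_one (D : Datum m n) (i : Fin (rk m n)) : D.op (.e i) (D.v D.one) = 0 := by
  have h := D.fst_lt_snd i
  have h' := (D.snd i).2
  apply op_e_other
  · rw [Ne, Fin.ext_iff, one_val]; omega
  · rw [Ne, Fin.ext_iff, one_val, Fin.val_rev]; omega

theorem isHighestWeight_w₁ (D : Datum m n) : D.IsHighestWeight (2 • D.eps D.one) D.w₁ := by
  refine (D.isHighestWeight_iff _ _).2 ⟨fun h => ?_, fun i => ⟨?_, ?_⟩⟩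
  · have := congrArg (D.coordVV D.one D.one) h
    simp [w₁_eq, coordVV_apply] at this
  · rw [w₁_eq, op₂_e_vv, op_e_one]
    simp
  · rw [w₁_eq, op₂_k_vv, two_nsmul, weightH_eps_add]

theorem fst_zero (D : Datum m n) (i : Fin (rk m n)) (h : (i : ℕ) = 0) : D.fst i = D.one := by
  rw [Fin.ext_iff, one_val]
  rcases D.fst_val i with ⟨_, _, h'⟩ | ⟨_, h'⟩ <;> omega

theorem snd_zero (D : Datum m n) (i : Fin (rk m n)) (h : (i : ℕ) = 0) : D.snd i = D.two := by
  rw [Fin.ext_iff, two_val, snd_val]; omega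

/-- The additional term of `chevH_fst` would require `2 = 1'`, which `N > 2` excludes. -/
theorem chevH_one (D : Datum m n) (i : Fin (rk m n)) (h : (i : ℕ) = 0) :
    D.chevH i D.one D.one = sgn (D.parity D.one) := by
  have h1 := D.chevH_fst i
  rw [D.fst_zero i h, D.snd_zero i h] at h1
  rw [h1, if_neg, add_zero]
  rw [Fin.ext_iff, Fin.val_rev, two_val, one_val]
  have := D.two_lt
  omega

theorem isHighestWeight_w₂ (D : Datum m n) :
    D.IsHighestWeight (D.eps D.one + D.eps D.two) D.w₂ := by
  have h12 : D.two ≠ D.one := by rw [Ne, Fin.ext_iff, one_val, two_val]; decide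
  refine (D.isHighestWeight_iff _ _).2 ⟨fun h => ?_, fun i => ⟨?_, ?_⟩⟩
  · have := congrArg (D.coordVV D.one D.two) h
    simp [w₂_eq, coordVV_apply, h12] at this
  · rw [w₂_eq, map_sub, map_smul, op₂_e_vv, op₂_e_vv, op_e_one]
    -- Only `e_1` moves `v_2`. It sends both summands to multiples of `v_1 ⊗ v_1`, and the
    -- coefficient in `w_2` is the one for which these cancel.
    by_cases hi : (i : ℕ) = 0
    · have h1 := D.op_e_snd i
      have hp : D.rootParity i = D.parity D.one + D.parity D.two := by
        rw [rootParity, D.fst_zero i hi, D.snd_zero i hi]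
      rw [D.fst_zero i hi, D.snd_zero i hi] at h1
      rw [h1, D.chevH_one i hi, hp, q_zpow, mul_comm (D.parity D.one)]
      simp only [TensorProduct.zero_tmul, TensorProduct.tmul_zero, smul_zero, zero_add, add_zero,
        smul_smul]
      rw [mul_assoc, ← zpow_add₀ qh_ne, two_mul, add_neg_cancel_right, sub_self]
    · have h1 : D.op (.e i) (D.v D.two) = 0 := by
        have h2 := D.snd_val i
        have h3 := i.2
        have h4 := D.fst_lt_snd i
        have h5 := D.two_lt
        apply op_e_other
        · rw [Ne, Fin.ext_iff, two_val]; omega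
        · rw [Ne, Fin.ext_iff, two_val, Fin.val_rev]; unfold rk at *; omega
      rw [h1]
      simp
  · rw [w₂_eq, map_sub, map_smul, op₂_k_vv, op₂_k_vv, weightH_eps_add,
      add_comm (D.chevH i D.two D.two)]
    module

/-! ### Cancellation in `e_i w_3`. -/

theorem op_e_e_edge (D : Datum m n) (i : Fin (rk m n)) :
    (sgn (D.rootParity i * D.parity (D.fst i)) : Kq) * D.coeffE i
      + (D.theta (D.fst i) * D.theta (D.snd i) : ℤ) = 0 := by
  have : sgn (D.rootParity i * D.parity (D.fst i)) * D.coeffE i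
      + D.theta (D.fst i) * D.theta (D.snd i) = 0 := by
    have h := sgn_sq (D.rootParity i * D.parity (D.fst i))
    rw [coeffE, ← rootParity, mul_comm (D.parity _)]
    linear_combination (-(D.theta (D.fst i) * D.theta (D.snd i))) * h
  exact_mod_cast this

/-- Like `op_e_e_edge`, a pure sign identity: it compares the sign from moving `e_i` past the first
tensor factor with the `θ`'s in the ratio of two coefficients of `w_3`. This one serves the mirrored
arrow. -/
theorem op_e_e_edge_rev (D : Datum m n) (i : Fin (rk m n)) :
    (sgn (D.rootParity i * D.parity (D.snd i)) : Kq) + D.coeffE i *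
      (sgn (D.parity (D.fst i) + D.parity (D.snd i)) * (D.theta (D.fst i) * D.theta (D.snd i) : ℤ))
       = 0 := by
  have h0 : ∀ a b : ZMod 2, sgn ((a + b) * b) = sgn (a * (a + b)) * sgn (a + b) := by decide
  have : sgn (D.rootParity i * D.parity (D.snd i)) + D.coeffE i *
      (sgn (D.parity (D.fst i) + D.parity (D.snd i)) * (D.theta (D.fst i) * D.theta (D.snd i)))
       = 0 := by
    have h1 := D.theta_sq (D.fst i)
    have h2 := D.theta_sq (D.snd i)
    rw [coeffE, rootParity, h0]
    generalize D.theta (D.fst i) = x at *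
    generalize D.theta (D.snd i) = y at *
    generalize sgn (D.parity (D.fst i) * (D.parity (D.fst i) + D.parity (D.snd i))) = u at *
    generalize sgn (D.parity (D.fst i) + D.parity (D.snd i)) = w at *
    linear_combination (-u * w * y * y) * h1 - u * w * h2
  exact_mod_cast this

/-- For `α_i = ε_a - ε_b`, the image of `w_3` involves only `v_a ⊗ v_{b'}` and `v_{b'} ⊗ v_a`. Each
is produced twice, once by `e_i` acting on the right factor and once on the left. The two
contributions cancel by the recursion of the coefficients along the arrow, the powers of `q`
matching by `expo_edge`. -/
theorem op₂_e_w₃ (D : Datum m n) (i : Fin (rk m n)) : D.op₂ (.e i) (D.w₃ D.coeff) = 0 := by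
  have hN := D.two_lt
  have hi := i.2
  have hlt := D.fst_lt_snd i
  set t₁ : Fin (m + n) → D.V ⊗[Kq] D.V := fun a =>
    (D.coeff a * (sgn (D.rootParity i * D.parity a) * qh ^ D.chevH i a a)) •
      (D.v a ⊗ₜ[Kq] D.op (.e i) (D.v a.rev)) with ht₁
  set t₂ : Fin (m + n) → D.V ⊗[Kq] D.V := fun a =>
    (D.coeff a * qh ^ D.chevH i a a) • (D.op (.e i) (D.v a) ⊗ₜ[Kq] D.v a.rev) with ht₂
  have hsum : D.op₂ (.e i) (D.w₃ D.coeff) = ∑ a, t₁ a + ∑ a, t₂ a := by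
    rw [w₃_eq, map_sum, ← Finset.sum_add_distrib]
    refine Finset.sum_congr rfl fun a _ => ?_
    rw [map_smul, op₂_e_vv, smul_add, smul_smul, smul_smul, chevH_rev, neg_neg]
  -- Both terms are multiples of `v_a ⊗ v_{b'}`.
  have k1 : t₁ (D.fst i) + t₂ (D.snd i) = 0 := by
    have h1 := D.coeff_ratio _ _ _ (D.expo_edge i)
    simp only [ht₁, ht₂, op_e_fst_rev, op_e_snd, TensorProduct.tmul_smul, smul_smul]
    rw [← add_smul, h1, zpow_add₀ qh_ne, chevH_rev, zpow_neg]
    convert zero_smul Kq _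
    have h2 := D.op_e_e_edge i
    have h3 : (qh : Kq) ^ D.chevH i (D.snd i) (D.snd i) ≠ 0 := zpow_ne_zero _ qh_ne
    field_simp
    linear_combination (D.coeff (D.fst i) * qh ^ D.chevH i (D.fst i) (D.fst i)) * h2
  -- Both terms are multiples of `v_{b'} ⊗ v_a`.
  have k2 : t₁ (D.snd i).rev + t₂ (D.fst i).rev = 0 := by
    have h1 := D.coeff_edge_rev _ _ _ (D.expo_edge i)
    simp only [ht₁, ht₂, Fin.rev_rev, op_e_fst_rev, op_e_snd, ← TensorProduct.smul_tmul', smul_smul,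
      D.parity_rev]
    rw [← add_smul, h1, zpow_add₀ qh_ne, D.chevH_rev i (D.fst i), zpow_neg]
    convert zero_smul Kq _
    have h2 := D.op_e_e_edge_rev i
    have h3 : (qh : Kq) ^ D.chevH i (D.fst i) (D.fst i) ≠ 0 := zpow_ne_zero _ qh_ne
    field_simp
    linear_combination
      (D.coeff (D.snd i).rev * qh ^ D.chevH i (D.snd i).rev (D.snd i).rev) * h2
  have z1 : ∀ a, a ≠ D.fst i → a ≠ (D.snd i).rev → t₁ a = 0 := by
    intro a h h'
    simp only [ht₁]
    rw [D.op_e_other i a.rev (fun e => h' (by rw [← e, Fin.rev_rev]))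
      (fun e => h (Fin.rev_injective e)), TensorProduct.tmul_zero, smul_zero]
  have z2 : ∀ a, a ≠ D.snd i → a ≠ (D.fst i).rev → t₂ a = 0 := by
    intro a h h'
    simp only [ht₂]
    rw [D.op_e_other i a h h', TensorProduct.zero_tmul, smul_zero]
  rw [hsum]
  -- For the long root `b = a'`, so the two pairs are one and must be counted once.
  by_cases hl : D.snd i = (D.fst i).rev
  · rw [Fintype.sum_eq_single (D.fst i) fun a ha => z1 a ha (by rw [hl, Fin.rev_rev]; exact ha),
      Fintype.sum_eq_single (D.snd i) fun a ha => z2 a ha (by rw [← hl]; exact ha), k1]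
  · rw [Fintype.sum_eq_add (D.fst i) (D.snd i).rev (fun e => hl (by rw [e, Fin.rev_rev]))
      fun a ha => z1 a ha.1 ha.2,
      Fintype.sum_eq_add (D.snd i) (D.fst i).rev hl fun a ha => z2 a ha.1 ha.2, add_add_add_comm,
      k1, k2, add_zero]

theorem isHighestWeight_w₃ (D : Datum m n) : D.IsHighestWeight 0 (D.w₃ D.coeff) := by
  refine (D.isHighestWeight_iff _ _).2 ⟨fun h => ?_, fun i => ⟨D.op₂_e_w₃ i, ?_⟩⟩
  · have := congrArg (D.coordVV D.one D.one.rev) h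
    rw [w₃_eq, map_sum, Fintype.sum_eq_single D.one] at this
    · simp [coordVV_apply, D.isCoeff_coeff.one] at this
    · intro a ha
      simp [coordVV_apply, ha]
  · rw [w₃_eq, map_sum, weightH_zero, zpow_zero, one_smul]
    refine Finset.sum_congr rfl fun a _ => ?_
    rw [map_smul, op₂_k_vv, chevH_rev, add_neg_cancel, zpow_zero, one_smul]

/-! ### Functionals that vanish on the images of the lowering operators -/

/-- A functional on `V ⊗ V` that vanishes on the images of all `f_i`. -/
def IsColowest (D : Datum m n) (φ : D.V ⊗[Kq] D.V →ₗ[Kq] Kq) : Prop :=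
  ∀ i, φ ∘ₗ D.op₂ (.f i) = 0

/-- On `V` each `f_i` sends a basis vector to zero or to a multiple of one with a larger index, so
on `V ⊗ V` it raises the index sum. Hence composing with `f_i` lowers by one the bound above which
`φ` vanishes. -/
theorem op₂_f_raises (D : Datum m n) (i : Fin (rk m n)) (k : ℕ)
    (φ : D.V ⊗[Kq] D.V →ₗ[Kq] Kq)
    (h : ∀ a b : Fin (m + n), k + 1 ≤ (a : ℕ) + b → φ (D.v a ⊗ₜ[Kq] D.v b) = 0)
    (a b : Fin (m + n)) (hab : k ≤ (a : ℕ) + b) :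
    φ (D.op₂ (.f i) (D.v a ⊗ₜ[Kq] D.v b)) = 0 := by
  have hlt := D.fst_lt_snd i
  have hs := (D.snd i).2
  have key : ∀ b, D.op (.f i) (D.v b) = 0 ∨
      ∃ (r : Kq) (c : Fin (m + n)), b < c ∧ D.op (.f i) (D.v b) = r • D.v c := by
    intro b
    obtain ⟨α, -, h1, h2, h3⟩ := D.op_f_v i
    by_cases e1 : b = D.fst i
    · exact Or.inr ⟨_, _, by rw [e1]; exact hlt, by rw [e1]; exact h1⟩
    by_cases e2 : b = (D.snd i).rev
    · exact Or.inr ⟨_, _, by rw [e2]; exact Fin.rev_lt_rev.2 hlt, by rw [e2]; exact h2⟩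
    exact Or.inl (h3 b e1 e2)
  rw [op₂_f_vv, map_add, map_smul, map_smul]
  have z1 : φ (D.v a ⊗ₜ[Kq] D.op (.f i) (D.v b)) = 0 := by
    rcases key b with e | ⟨r, c, hc, e⟩
    · rw [e, TensorProduct.tmul_zero, map_zero]
    · rw [e, TensorProduct.tmul_smul, map_smul, h a c (by rw [Fin.lt_def] at hc; omega), smul_zero]
  have z2 : φ (D.op (.f i) (D.v a) ⊗ₜ[Kq] D.v b) = 0 := by
    rcases key a with e | ⟨r, c, hc, e⟩
    · rw [e, TensorProduct.zero_tmul, map_zero]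
    · rw [e, ← TensorProduct.smul_tmul', map_smul, h c b (by rw [Fin.lt_def] at hc; omega),
        smul_zero]
  rw [z1, z2, smul_zero, smul_zero, add_zero]

/-- Nakayama's lemma for the lowering operators. -/
theorem exists_isColowest (D : Datum m n) (M : Submodule Kq (D.V ⊗[Kq] D.V))
    (hM : ∀ i, ∀ w ∈ M, D.op₂ (.f i) w ∈ M) (φ : D.V ⊗[Kq] D.V →ₗ[Kq] Kq) (h0 : φ ≠ 0)
    (hφ : ∀ w ∈ M, φ w = 0) : ∃ ψ, D.IsColowest ψ ∧ ψ ≠ 0 ∧ ∀ w ∈ M, ψ w = 0 := by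
  -- Induction on a bound `k` such that `φ` vanishes on index sums at least `k`. If `φ` is not yet
  -- colowest, some `φ ∘ f_i ≠ 0` has a smaller bound; the bound `0` would mean `φ = 0`.
  have key : ∀ (k : ℕ) (φ : D.V ⊗[Kq] D.V →ₗ[Kq] Kq), φ ≠ 0 → (∀ w ∈ M, φ w = 0) →
      (∀ a b : Fin (m + n), k ≤ (a : ℕ) + b → φ (D.v a ⊗ₜ[Kq] D.v b) = 0) →
      ∃ ψ, D.IsColowest ψ ∧ ψ ≠ 0 ∧ ∀ w ∈ M, ψ w = 0 := by
    intro k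
    induction k with
    | zero =>
      intro φ h0 _ h
      exact absurd (D.functional_ext φ fun a b => h a b (Nat.zero_le _)) h0
    | succ k ih =>
      intro φ h0 hφ h
      by_cases hc : D.IsColowest φ
      · exact ⟨φ, hc, h0, hφ⟩
      · obtain ⟨i, hi⟩ := not_forall.1 hc
        exact ih _ hi (fun w hw => hφ _ (hM i w hw)) fun a b hab => D.op₂_f_raises i k φ h a b hab
  -- No index sum reaches `2N`, so this bound holds for every functional.
  refine key (2 * (m + n)) φ h0 hφ fun a b hab => ?_
  have := a.2
  have := b.2
  omega

/-- A proper submodule lies in the kernel of a nonzero functional, which stability under the `f_i`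
allows to be chosen colowest. -/
theorem submodule_eq_top (D : Datum m n) (M : Submodule D.Uq D.TensorSquare)
    (h : ∀ φ : D.V ⊗[Kq] D.V →ₗ[Kq] Kq, D.IsColowest φ → (∀ w ∈ M, φ w = 0) → φ = 0) :
    M = ⊤ := by
  by_contra hM
  let M' : Submodule Kq (D.V ⊗[Kq] D.V) := M.restrictScalars Kq
  have hM' : M' < ⊤ := by
    rw [lt_top_iff_ne_top]
    intro e
    apply hM
    rw [eq_top_iff]
    intro w _
    have : w ∈ M' := by rw [e]; trivial
    exact this
  obtain ⟨φ, h0, hφ⟩ := Submodule.exists_le_ker_of_lt_top M' hM'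
  obtain ⟨ψ, h1, h2, h3⟩ := D.exists_isColowest M' (fun i (w : D.TensorSquare) hw => by
    have h4 : D.gen (.f i) • w ∈ M := M.smul_mem _ hw
    rw [gen_smul] at h4
    exact h4) φ h0 hφ
  exact h2 (h ψ h1 h3)

/-! ### The values of colowest functionals on basis vectors. -/

section IsColowest
variable {D : Datum m n} {φ : D.V ⊗[Kq] D.V →ₗ[Kq] Kq}

theorem IsColowest.apply (h : D.IsColowest φ) (i : Fin (rk m n)) (a b : Fin (m + n)) :
    (sgn (D.rootParity i * D.parity a) : Kq) * qh ^ D.chevH i a a *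
        φ (D.v a ⊗ₜ[Kq] D.op (.f i) (D.v b))
      + qh ^ (-D.chevH i b b) * φ (D.op (.f i) (D.v a) ⊗ₜ[Kq] D.v b) = 0 := by
  have := LinearMap.congr_fun (h i) (D.v a ⊗ₜ[Kq] D.v b)
  rw [LinearMap.comp_apply, op₂_f_vv, map_add, map_smul, map_smul] at this
  exact this

theorem sgn_cast_ne (x : ZMod 2) : (sgn x : Kq) ≠ 0 := Int.cast_ne_zero.2 (sgn_ne x)

theorem coeffF_ne (D : Datum m n) (i : Fin (rk m n)) : (D.coeffF i : Kq) ≠ 0 :=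
  Int.cast_ne_zero.2 (neg_ne_zero.2 (mul_ne_zero (mul_ne_zero (sgn_ne _) (D.theta_ne _))
    (D.theta_ne _)))

/-- `c` is hit by `f_i` and `a` is killed by it. -/
theorem IsColowest.eq_zero (h : D.IsColowest φ) (i : Fin (rk m n)) (a c : Fin (m + n))
    (hc : c = D.snd i ∨ c = (D.fst i).rev) (ha : a ≠ D.fst i) (ha' : a ≠ (D.snd i).rev) :
    φ (D.v a ⊗ₜ[Kq] D.v c) = 0 ∧ φ (D.v c ⊗ₜ[Kq] D.v a) = 0 := by
  obtain ⟨α, hα, h1, h2, h3⟩ := D.op_f_v i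
  have hz := h3 a ha ha'
  have : ∃ (b : Fin (m + n)) (r : Kq), r ≠ 0 ∧ D.op (.f i) (D.v b) = r • D.v c := by
    rcases hc with rfl | rfl
    · exact ⟨_, _, hα, h1⟩
    · exact ⟨_, _, mul_ne_zero hα (D.coeffF_ne i), h2⟩
  obtain ⟨b, r, hr, hb⟩ := this
  have e1 := h.apply i a b
  have e2 := h.apply i b a
  rw [hz, hb, TensorProduct.zero_tmul, map_zero, mul_zero, add_zero, TensorProduct.tmul_smul,
    map_smul, smul_eq_mul] at e1
  rw [hz, hb, TensorProduct.tmul_zero, map_zero, mul_zero, zero_add, ← TensorProduct.smul_tmul',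
    map_smul, smul_eq_mul] at e2
  simp only [mul_eq_zero, hr, sgn_cast_ne, zpow_ne_zero _ qh_ne, false_or] at e1 e2
  exact ⟨e1, e2⟩

/-- The sign of moving `f_i` past `v_a`, combined with the ratio of the two coefficients of `f_i`.
The factor `(-1)^{|α_i|}` that remains is what distinguishes the recursion for `φ` from that for the
`c_a`. -/
theorem coeffF_edge (D : Datum m n) (i : Fin (rk m n)) :
    -((sgn (D.rootParity i * D.parity (D.fst i)) : Kq) * D.coeffF i)
      = sgn (D.rootParity i) * (D.theta (D.fst i) * D.theta (D.snd i) : ℤ) := by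
  have h0 : ∀ a b : ZMod 2, sgn ((a + b) * a) * sgn (b * (a + b)) = sgn (a + b) := by decide
  have : -(sgn (D.rootParity i * D.parity (D.fst i)) * D.coeffF i)
      = sgn (D.rootParity i) * (D.theta (D.fst i) * D.theta (D.snd i)) := by
    rw [coeffF, rootParity, ← h0]
    ring
  exact_mod_cast this

theorem coeffF_edge_rev (D : Datum m n) (i : Fin (rk m n)) :
    (sgn (D.rootParity i * D.parity (D.snd i)) : Kq)
      = -(D.coeffF i * (D.theta (D.fst i) * D.theta (D.snd i) : ℤ)) := by
  have : sgn (D.rootParity i * D.parity (D.snd i))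
      = -(D.coeffF i * (D.theta (D.fst i) * D.theta (D.snd i))) := by
    have h1 := D.theta_sq (D.fst i)
    have h2 := D.theta_sq (D.snd i)
    rw [coeffF, rootParity, mul_comm (_ + _)]
    generalize D.theta (D.fst i) = x at *
    generalize D.theta (D.snd i) = y at *
    generalize sgn _ = u at *
    linear_combination (-u * y * y) * h1 - u * h2
  exact_mod_cast this

/-- Evaluate `φ ∘ f_i = 0` at `v_a ⊗ v_{b'}`, where `α_i = ε_a - ε_b`: acting on the left factor
gives `v_b ⊗ v_{b'}`, on the right `v_a ⊗ v_{a'}`. -/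
theorem IsColowest.edge (h : D.IsColowest φ) (i : Fin (rk m n)) :
    φ (D.v (D.snd i) ⊗ₜ[Kq] D.v (D.snd i).rev)
      = sgn (D.rootParity i) * (qh ^ (D.expo (D.snd i) - D.expo (D.fst i))
        * (D.theta (D.fst i) * D.theta (D.snd i) : ℤ))
        * φ (D.v (D.fst i) ⊗ₜ[Kq] D.v (D.fst i).rev) := by
  obtain ⟨α, hα, h1, h2, -⟩ := D.op_f_v i
  have e := h.apply i (D.fst i) (D.snd i).rev
  have hF := D.coeffF_edge i
  rw [h1, h2, TensorProduct.tmul_smul, ← TensorProduct.smul_tmul', map_smul, map_smul, smul_eq_mul,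
    smul_eq_mul, zpow_neg] at e
  rw [expo_edge, zpow_add₀ qh_ne]
  have h3 : (qh : Kq) ^ D.chevH i (D.snd i).rev (D.snd i).rev ≠ 0 := zpow_ne_zero _ qh_ne
  field_simp at e
  -- The common scalar `α` of `f_i`, which includes `κ_i`, drops out.
  replace e := (mul_eq_zero.1 (e.trans (mul_zero _))).resolve_left hα
  linear_combination e - (qh ^ D.chevH i (D.fst i) (D.fst i)
    * qh ^ D.chevH i (D.snd i).rev (D.snd i).rev
    * φ (D.v (D.fst i) ⊗ₜ[Kq] D.v (D.fst i).rev)) * -hF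

/-- Now `φ ∘ f_i = 0` is evaluated at `v_{b'} ⊗ v_a`, which relates the values on `v_{a'} ⊗ v_a` and
`v_{b'} ⊗ v_b`. -/
theorem IsColowest.edge_rev (h : D.IsColowest φ) (i : Fin (rk m n)) :
    φ (D.v (D.fst i).rev ⊗ₜ[Kq] D.v (D.fst i))
      = qh ^ (D.expo (D.fst i).rev - D.expo (D.snd i).rev)
        * (D.theta (D.fst i) * D.theta (D.snd i) : ℤ)
        * φ (D.v (D.snd i).rev ⊗ₜ[Kq] D.v (D.snd i)) := by
  obtain ⟨α, hα, h1, h2, -⟩ := D.op_f_v i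
  have e := h.apply i (D.snd i).rev (D.fst i)
  have hF := D.coeffF_edge_rev i
  rw [h1, h2, TensorProduct.tmul_smul, ← TensorProduct.smul_tmul', map_smul, map_smul, smul_eq_mul,
    smul_eq_mul, zpow_neg, D.parity_rev, hF] at e
  rw [expo_edge_rev, zpow_add₀ qh_ne]
  have h3 : (qh : Kq) ^ D.chevH i (D.fst i) (D.fst i) ≠ 0 := zpow_ne_zero _ qh_ne
  have h4 := D.coeffF_ne i
  have h5 : α * D.coeffF i * (φ (D.v (D.fst i).rev ⊗ₜ[Kq] D.v (D.fst i))
      - qh ^ D.chevH i (D.fst i) (D.fst i) * qh ^ D.chevH i (D.snd i).rev (D.snd i).rev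
        * (D.theta (D.fst i) * D.theta (D.snd i) : ℤ)
        * φ (D.v (D.snd i).rev ⊗ₜ[Kq] D.v (D.snd i))) = 0 := by
    field_simp at e ⊢
    linear_combination e
  have h6 := (mul_eq_zero.1 h5).resolve_left (mul_ne_zero hα h4)
  exact sub_eq_zero.1 h6

/-- Every index but the first is the head of an arrow of some `f_i`. -/
theorem exists_arrow (D : Datum m n) (c : Fin (m + n)) (hc : 0 < (c : ℕ)) :
    ∃ i : Fin (rk m n), ((c : ℕ) ≤ rk m n ∧ (i : ℕ) + 1 = c ∧ c = D.snd i) ∨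
      (rk m n < (c : ℕ) ∧ (i : ℕ) = c.rev ∧ D.fst i = c.rev ∧ ((D.snd i).rev : ℕ) + 1 = c) := by
  have hN := D.two_lt
  have hc2 := c.2
  by_cases h : (c : ℕ) ≤ rk m n
  · refine ⟨⟨c - 1, by omega⟩, Or.inl ⟨h, ?_, Fin.ext ?_⟩⟩
    · show (c : ℕ) - 1 + 1 = c; omega
    · rw [snd_val]; show (c : ℕ) = c - 1 + 1; omega
  · have hr : (c.rev : ℕ) < rk m n := by rw [Fin.val_rev]; unfold rk at *; omega
    refine ⟨⟨c.rev, hr⟩, Or.inr ⟨by omega, rfl, Fin.ext ?_, ?_⟩⟩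
    -- The skipped index of the fork would occur only if `c'` were the index of `v_s`, but `c` lies
    -- strictly beyond `s'`.
    · rcases D.fst_val ⟨c.rev, hr⟩ with ⟨hF, h1, -⟩ | ⟨-, h1⟩
      · have he := D.fork_even hF
        rw [Nat.even_iff] at he
        have h1' : (c.rev : ℕ) = rk m n - 1 := h1
        rw [Fin.val_rev] at h1'; unfold rk at *; omega
      · exact h1
    · rw [Fin.val_rev, snd_val]
      show m + n - ((c.rev : ℕ) + 1 + 1) + 1 = c
      rw [Fin.val_rev] at *; unfold rk at *; omega

/-- The values of a colowest functional on the zero weight space. -/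
theorem IsColowest.zero_weight (h : D.IsColowest φ) (a : Fin (m + n)) :
    φ (D.v a ⊗ₜ[Kq] D.v a.rev)
      = sgn (D.parity D.one + D.parity a) * D.coeff a
        * φ (D.v D.one ⊗ₜ[Kq] D.v D.one.rev) := by
  -- The formula propagates along one arrow from `a` to `b`; the signs compose since `(-1)^{|1|+|a|}
  -- (-1)^{|a|+|b|} = (-1)^{|1|+|b|}`.
  have trans : ∀ a b : Fin (m + n), φ (D.v a ⊗ₜ[Kq] D.v a.rev)
      = sgn (D.parity D.one + D.parity a) * D.coeff a * φ (D.v D.one ⊗ₜ[Kq] D.v D.one.rev) →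
      φ (D.v b ⊗ₜ[Kq] D.v b.rev) = sgn (D.parity a + D.parity b) * (qh ^ (D.expo b - D.expo a)
        * (D.theta a * D.theta b : ℤ)) * φ (D.v a ⊗ₜ[Kq] D.v a.rev) →
      φ (D.v b ⊗ₜ[Kq] D.v b.rev)
      = sgn (D.parity D.one + D.parity b) * D.coeff b * φ (D.v D.one ⊗ₜ[Kq] D.v D.one.rev) := by
    intro a b h1 h2
    have hs : (sgn (D.parity D.one + D.parity b) : Kq)
        = sgn (D.parity a + D.parity b) * sgn (D.parity D.one + D.parity a) := by
      rw [← Int.cast_mul, ← sgn_add]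
      have : ∀ x y z : ZMod 2, x + y = z + y + (x + z) := by decide
      rw [← this]
    rw [h2, h1, D.coeff_ratio a b _ rfl, hs]
    ring
  obtain ⟨k, hk⟩ := a
  induction k using Nat.strong_induction_on with
  | _ k ih =>
    rcases Nat.eq_zero_or_pos k with rfl | hk0
    · have h1 := D.isCoeff_coeff.one
      have h2 : sgn (D.parity D.one + D.parity D.one) = 1 := by
        generalize D.parity D.one = x; revert x; decide
      rw [show (⟨0, hk⟩ : Fin (m + n)) = D.one from rfl, h1, h2]
      simp
    -- In the first half the arrow into the index runs from `a` to `b`, and `edge` applies; in the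
    -- second half it runs from `b'` to `a'`, and `edge_rev` applies.
    obtain ⟨i, ⟨-, -, hi⟩ | ⟨-, -, hi, hi'⟩⟩ := D.exists_arrow ⟨k, hk⟩ hk0
    · have h1 := D.fst_lt_snd i
      rw [← hi] at h1
      refine trans _ _ (ih (D.fst i) h1 (D.fst i).2) ?_
      rw [hi]
      exact h.edge i
    · refine trans _ _ (ih ((D.snd i).rev : ℕ)
        (by simpa using Nat.lt_of_succ_le hi'.le) (D.snd i).rev.2) ?_
      have h1 : (⟨k, hk⟩ : Fin (m + n)) = (D.fst i).rev := by rw [hi, Fin.rev_rev]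
      rw [h1]
      have h2 := h.edge_rev i
      -- `edge_rev` is written with `θ_a θ_b`; passing to the mirrored indices produces the sign
      -- that `trans` asks for.
      have h3 := D.theta_mul_rev (D.snd i) (D.fst i)
      have h4 : (sgn (D.parity (D.snd i) + D.parity (D.fst i)) : Kq)
        * sgn (D.parity (D.snd i) + D.parity (D.fst i)) = 1 := sgn_sq' _
      simp only [Fin.rev_rev, D.parity_rev, Fin.eta] at *
      rw [h2, h3]
      push_cast
      linear_combination (-(qh ^ (D.expo (D.fst i).rev - D.expo (D.snd i).rev)
        * (D.theta (D.fst i) * D.theta (D.snd i))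
        * φ (D.v (D.snd i).rev ⊗ₜ[Kq] D.v (D.snd i)) : Kq)) * h4

/-- Away from the zero weight space a colowest functional is supported on the span of
`v_1 ⊗ v_1`, `v_1 ⊗ v_2`, `v_2 ⊗ v_1`. -/
theorem IsColowest.eq_zero_of_le (h : D.IsColowest φ) (a c : Fin (m + n)) (hc : 0 < (c : ℕ))
    (hac : c ≤ a) (hr : a ≠ c.rev) :
    φ (D.v a ⊗ₜ[Kq] D.v c) = 0 ∧ φ (D.v c ⊗ₜ[Kq] D.v a) = 0 := by
  rw [Fin.le_def] at hac
  -- The `f_i` with an arrow into `c` moves only the tail of that arrow and the mirror image `c'` of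
  -- its head. The tail precedes `c ≤ a`, and `a = c'` is excluded, so `f_i` kills `v_a`.
  obtain ⟨i, ⟨-, -, hi⟩ | ⟨-, -, hi, hi'⟩⟩ := D.exists_arrow c hc
  · have h1 := D.fst_lt_snd i
    refine h.eq_zero i a c (Or.inl hi) ?_ (by rw [← hi]; exact hr)
    rw [Ne, Fin.ext_iff, ← Ne]
    rw [← hi] at h1
    omega
  · refine h.eq_zero i a c (Or.inr (by rw [hi, Fin.rev_rev])) (by rw [hi]; exact hr) ?_
    rw [Ne, Fin.ext_iff]
    omega

/-- An arrow into an index beyond `2` starts at `1` only for the last root `ε_{s-1} + ε_s` of a fork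
with `s = 2`. In all other cases the `f_i` that hits `v_c` kills `v_1`. -/
theorem IsColowest.eq_zero_one (h : D.IsColowest φ) (c : Fin (m + n)) (hc : 2 ≤ (c : ℕ))
    (hr : c ≠ D.one.rev) (hF : ¬ (D.Fork ∧ m + n = 4)) :
    φ (D.v D.one ⊗ₜ[Kq] D.v c) = 0 ∧ φ (D.v c ⊗ₜ[Kq] D.v D.one) = 0 := by
  have hr' : D.one ≠ c.rev := fun e => hr (by rw [e, Fin.rev_rev])
  obtain ⟨i, ⟨h0, h1, hi⟩ | ⟨h0, -, hi, hi'⟩⟩ := D.exists_arrow c (by omega)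
  · refine h.eq_zero i _ c (Or.inl hi) ?_ (by rw [← hi]; exact hr')
    rw [Ne, Fin.ext_iff, one_val]
    rcases D.fst_val i with ⟨hf, h2, h3⟩ | ⟨-, h2⟩
    · have he := D.fork_even hf
      rw [Nat.even_iff] at he
      intro h4
      apply hF
      refine ⟨hf, ?_⟩
      unfold rk at *
      omega
    · omega
  · refine h.eq_zero i _ c (Or.inr (by rw [hi, Fin.rev_rev])) (by rw [hi]; exact hr') ?_
    rw [Ne, Fin.ext_iff, one_val]
    omega

/-- A relation between the values on `v_1 ⊗ v_b` and `v_b ⊗ v_1`, where `ε_1 - ε_b` is a simple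
root. -/
theorem IsColowest.one_snd (h : D.IsColowest φ) (i : Fin (rk m n)) (hi : D.fst i = D.one) :
    φ (D.v (D.snd i) ⊗ₜ[Kq] D.v D.one)
      = -(sgn (D.rootParity i * D.parity D.one) * qh ^ (2 * D.chevH i D.one D.one)
        * φ (D.v D.one ⊗ₜ[Kq] D.v (D.snd i))) := by
  obtain ⟨α, hα, h1, -, -⟩ := D.op_f_v i
  -- The relation is the vanishing of `φ` on `f_i (v_1 ⊗ v_1)`.
  have e := h.apply i D.one D.one
  rw [hi] at h1
  rw [h1, TensorProduct.tmul_smul, ← TensorProduct.smul_tmul', map_smul, map_smul, smul_eq_mul,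
    smul_eq_mul, zpow_neg] at e
  rw [two_mul, zpow_add₀ qh_ne]
  have h3 : (qh : Kq) ^ D.chevH i D.one D.one ≠ 0 := zpow_ne_zero _ qh_ne
  field_simp at e
  replace e := (mul_eq_zero.1 (e.trans (mul_zero _))).resolve_left hα
  linear_combination e

theorem q_zpow_ne_one (k : ℤ) (hk : k ≠ 0) : (q : Kq) ^ k ≠ 1 := by
  have hpos : ∀ k : ℕ, 0 < k → (q : Kq) ^ k ≠ 1 := by
    intro k hk
    rw [q, ← pow_mul]
    exact qh_pow_ne_one _ (by omega)
  intro h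
  rcases Int.natAbs_eq k with h1 | h1
  · rw [h1, zpow_natCast] at h
    exact hpos _ (Int.natAbs_pos.2 hk) h
  · rw [h1, zpow_neg, zpow_natCast, inv_eq_one] at h
    exact hpos _ (Int.natAbs_pos.2 hk) h

theorem q_zpow_ne_neg_one (k : ℤ) : (q : Kq) ^ k ≠ -1 := by
  intro h
  by_cases hk : k = 0
  · rw [hk, zpow_zero] at h
    have h2 : (2 : Kq) ≠ 0 := two_ne_zero
    exact h2 (by linear_combination h)
  · apply q_zpow_ne_one (k + k) (by omega)
    rw [zpow_add₀ q_ne, h]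
    ring

/-- The vanishing on `f_1 (v_1 ⊗ v_1)` and on `w_2` are two linear equations for the two values.
Eliminating one leaves the factor `1 + q^{2(-1)^{|1|}}`, which is not zero. -/
theorem IsColowest.two_eq_zero (h : D.IsColowest φ) (h₂ : φ D.w₂ = 0) :
    φ (D.v D.one ⊗ₜ[Kq] D.v D.two) = 0 ∧ φ (D.v D.two ⊗ₜ[Kq] D.v D.one) = 0 := by
  let i : Fin (rk m n) := ⟨0, D.rk_pos⟩
  have e := h.one_snd i (D.fst_zero i rfl)
  have hp : D.rootParity i = D.parity D.one + D.parity D.two := by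
    rw [rootParity, D.fst_zero i rfl, D.snd_zero i rfl]
  rw [D.snd_zero i rfl, D.chevH_one i rfl, hp, mul_comm (_ + _), ← q_zpow] at e
  rw [w₂_eq, map_sub, map_smul, smul_eq_mul, e] at h₂
  have h1 := sgn_sq' (D.parity D.one * (D.parity D.one + D.parity D.two))
  have h2 := q_zpow_ne_neg_one (sgn (D.parity D.one) + sgn (D.parity D.one))
  rw [zpow_add₀ q_ne] at h2
  have h3 : (1 + q ^ sgn (D.parity D.one) * q ^ sgn (D.parity D.one))
      * φ (D.v D.one ⊗ₜ[Kq] D.v D.two) = 0 := by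
    linear_combination h₂ - (q ^ sgn (D.parity D.one) * q ^ sgn (D.parity D.one)
      * φ (D.v D.one ⊗ₜ[Kq] D.v D.two)) * h1
  have h4 := (mul_eq_zero.1 h3).resolve_left fun h5 => h2 (by linear_combination h5)
  refine ⟨h4, ?_⟩
  rw [e, h4, mul_zero, neg_zero]

/-- In the exceptional case `ε_1 - ε_3` is a simple root. -/
theorem exists_second_fork (D : Datum m n) (hF : D.Fork) (hN : m + n = 4) :
    ∃ i, D.fst i = D.one ∧ D.snd i = D.two.rev := by
  have hr : rk m n = 2 := by unfold rk; omega
  refine ⟨⟨1, by omega⟩, ?_, ?_⟩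
  · rw [Fin.ext_iff, one_val]
    rcases D.fst_val ⟨1, by omega⟩ with ⟨_, _, h'⟩ | ⟨h', _⟩
    · omega
    · refine absurd ⟨hF, ?_⟩ h'
      show 1 = rk m n - 1
      omega
  · rw [Fin.ext_iff, Fin.val_rev, two_val, snd_val]
    show 1 + 1 = _
    omega

/-- A colowest functional vanishes if it kills `w₁`, `w₂`, the vector `v_1 ⊗ v_{1'}` and, in the
exceptional case, the vector `v_1 ⊗ v_3`. -/
theorem IsColowest.eq_zero_of_kills (h : D.IsColowest φ) (h₁ : φ D.w₁ = 0) (h₂ : φ D.w₂ = 0)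
    (h₃ : φ (D.v D.one ⊗ₜ[Kq] D.v D.one.rev) = 0)
    (h₄ : D.Fork → m + n = 4 → φ (D.v D.one ⊗ₜ[Kq] D.v D.two.rev) = 0) : φ = 0 := by
  have hone : ∀ c, φ (D.v D.one ⊗ₜ[Kq] D.v c) = 0 ∧ φ (D.v c ⊗ₜ[Kq] D.v D.one) = 0 := by
    intro c
    by_cases c0 : (c : ℕ) = 0
    · have : c = D.one := Fin.ext c0
      rw [this]
      exact ⟨h₁, h₁⟩
    by_cases c1 : (c : ℕ) = 1
    · have : c = D.two := Fin.ext c1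
      rw [this]
      exact h.two_eq_zero h₂
    by_cases cr : c = D.one.rev
    · have h5 := h.zero_weight D.one.rev
      rw [h₃, mul_zero, Fin.rev_rev] at h5
      rw [cr]
      exact ⟨h₃, h5⟩
    by_cases hF : D.Fork ∧ m + n = 4
    -- The only index left is `3 = 2'`. As `ε_1 - ε_3` is simple, the value on `v_3 ⊗ v_1` is a
    -- multiple of the one on `v_1 ⊗ v_3`.
    · obtain ⟨i, e3, e2⟩ := D.exists_second_fork hF.1 hF.2
      have e1 : c = D.two.rev := by
        rw [Fin.ext_iff, Fin.val_rev, one_val] at cr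
        rw [Fin.ext_iff, Fin.val_rev, two_val]
        omega
      have e4 := h.one_snd i e3
      rw [e2, h₄ hF.1 hF.2, mul_zero, neg_zero] at e4
      rw [e1]
      exact ⟨h₄ hF.1 hF.2, e4⟩
    · exact h.eq_zero_one c (by omega) cr hF
  refine D.functional_ext φ fun a b => ?_
  by_cases a0 : (a : ℕ) = 0
  · have : a = D.one := Fin.ext a0
    rw [this]
    exact (hone b).1
  by_cases b0 : (b : ℕ) = 0
  · have : b = D.one := Fin.ext b0
    rw [this]
    exact (hone a).2
  by_cases hab : a = b.rev
  · have h5 := h.zero_weight a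
    rw [h₃, mul_zero, hab, Fin.rev_rev] at h5
    rw [hab]
    exact h5
  · rcases le_total b a with hle | hle
    · exact (h.eq_zero_of_le a b (by omega) hle hab).1
    · exact (h.eq_zero_of_le b a (by omega) hle fun e => hab (by rw [e, Fin.rev_rev])).2

end IsColowest

/-! ### The quantum superdimension -/

theorem sdim₂_eq (D : Datum m n) : D.sdim₂ = 2 * ((m : ℤ) - n) := by
  have h1 : ∀ x : ZMod 2, sgn x = 1 - 2 * (if x = 1 then 1 else 0) := by decide
  have h2 : ∑ j, (if D.parity j = 1 then (1 : ℤ) else 0) = n := by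
    rw [← Finset.sum_filter, Finset.sum_const, D.card_odd]
    simp
  rw [sdim₂, ← Finset.mul_sum]
  simp only [h1]
  rw [Finset.sum_sub_distrib, ← Finset.mul_sum, h2]
  simp
  ring

/-- Twice the sum of the signs of the first `k` indices. -/
def heightN (D : Datum m n) (k : ℕ) : ℤ :=
  ∑ j : Fin (m + n), if (j : ℕ) < k then 2 * sgn (D.parity j) else 0

theorem heightN_val (D : Datum m n) (a : Fin (m + n)) : D.heightN a = D.height a := rfl

theorem heightN_succ (D : Datum m n) (a : Fin (m + n)) :
    D.heightN (a + 1) = D.height a + 2 * sgn (D.parity a) := by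
  have : 2 * sgn (D.parity a) = ∑ j, if j = a then 2 * sgn (D.parity j) else 0 := by simp
  rw [heightN, height, this, ← Finset.sum_add_distrib]
  refine Finset.sum_congr rfl fun j _ => ?_
  simp only [Fin.lt_def, Fin.ext_iff]
  split_ifs <;> omega

theorem heightN_zero (D : Datum m n) : D.heightN 0 = 0 := by simp [heightN]

theorem heightN_top (D : Datum m n) : D.heightN (m + n) = D.sdim₂ := by
  simp [heightN, sdim₂]

/-- This turns each term of the superdimension sum into a difference of consecutive powers
`q^{height}`. -/
theorem q_sub_mul_sgn (x : ZMod 2) :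
    (q - q⁻¹) * ((sgn x : Kq) * q ^ sgn x) = q ^ (2 * sgn x) - 1 := by
  have h := q_ne
  rcases par_cases x with rfl | rfl
  · rw [show sgn 0 = 1 from rfl, mul_one, zpow_ofNat]
    simp only [Int.cast_one]
    field_simp
  · rw [show sgn 1 = -1 from rfl, show (2 : ℤ) * -1 = -2 from rfl, zpow_neg, zpow_neg, zpow_ofNat]
    simp only [Int.cast_neg, Int.cast_one]
    field_simp
    ring

/-- After multiplication by `q - q⁻¹`, the sum telescopes on each stretch where `shift` is constant,
that is, on each half of the basis. -/
theorem sum_expo (D : Datum m n) :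
    (q - q⁻¹) * ∑ a, (sgn (D.parity a) : Kq) * q ^ D.expo a
      = ∑ k ∈ Finset.range (m + n), q ^ (if k < rk m n then (0 : ℤ) else
          if m + n - (k + 1) < rk m n then -2 else -1)
          * (q ^ D.heightN (k + 1) - q ^ D.heightN k) := by
  rw [← Fin.sum_univ_eq_sum_range (fun k => (q : Kq) ^ (if k < rk m n then (0 : ℤ) else
          if m + n - (k + 1) < rk m n then -2 else -1)
          * (q ^ D.heightN (k + 1) - q ^ D.heightN k)), Finset.mul_sum]
  refine Finset.sum_congr rfl fun a _ => ?_
  rw [heightN_succ, heightN_val, expo]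
  have h1 : D.shift a = if (a : ℕ) < rk m n then 0 else
      if m + n - (a + 1) < rk m n then -2 else -1 := by rw [shift, Fin.val_rev]
  rw [← h1, zpow_add₀ q_ne, zpow_add₀ q_ne, zpow_add₀ q_ne]
  linear_combination (q ^ D.height a * q ^ D.shift a) * q_sub_mul_sgn (D.parity a)

/-- With `h` the height after the first half, the two halves contribute `q^h - 1` and `q^{-2}(q^{2h}
- q^h)`. -/
theorem sum_expo_even (D : Datum m n) (h : m + n = rk m n + rk m n) :
    (q - q⁻¹) * ∑ a, (sgn (D.parity a) : Kq) * q ^ D.expo a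
      = (q ^ D.heightN (rk m n) - 1) * (1 + q ^ (D.heightN (rk m n) - 2))
      ∧ D.sdim₂ = 2 * D.heightN (rk m n) := by
  have hN := D.two_lt
  have htop := D.heightN_top
  have h2 : D.sdim₂ = 2 * D.heightN (rk m n) := by
    -- The first index of the second half. Its mirror image is the last index of the first half, so
    -- in `height_rev` both partial sums equal the height after the first half.
    let a : Fin (m + n) := ⟨rk m n, by omega⟩
    have h3 := D.height_rev a
    have h4 := D.heightN_succ a.rev
    have h5 : (a.rev : ℕ) + 1 = rk m n := by
      rw [Fin.val_rev]; show m + n - (rk m n + 1) + 1 = _; omega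
    rw [h5, D.parity_rev] at h4
    have h6 : D.height a = D.heightN (rk m n) := rfl
    omega
  refine ⟨?_, h2⟩
  rw [sum_expo]
  generalize rk m n = r at *
  rw [h] at htop ⊢
  have h₁ : ∀ k ∈ Finset.range r, (q : Kq) ^ (if k < r then (0 : ℤ) else
      if (r + r) - (k + 1) < r then -2 else -1) * (q ^ D.heightN (k + 1) - q ^ D.heightN (k))
      = q ^ D.heightN (k + 1) - q ^ D.heightN k := fun k hk => by
    rw [if_pos (Finset.mem_range.1 hk), zpow_zero, one_mul]
  have h₂ : ∀ k ∈ Finset.range r, (q : Kq) ^ (if r + k < r then (0 : ℤ) else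
      if (r + r) - (r + k + 1) < r then -2 else -1)
      * (q ^ D.heightN (r + k + 1) - q ^ D.heightN (r + k))
      = q ^ (-2 : ℤ) * (q ^ D.heightN (r + (k + 1)) - q ^ D.heightN (r + k)) := fun k hk => by
    have := Finset.mem_range.1 hk
    rw [if_neg (by omega), if_pos (by omega), add_assoc r]
  rw [Finset.sum_range_add, Finset.sum_congr rfl h₁, Finset.sum_congr rfl h₂,
    Finset.sum_range_sub (fun k => (q : Kq) ^ D.heightN k), ← Finset.mul_sum,
    Finset.sum_range_sub (fun k => (q : Kq) ^ D.heightN (r + k)), htop, heightN_zero, h2,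
    zpow_zero, add_zero, two_mul, zpow_add₀ q_ne, sub_eq_add_neg (D.heightN r), zpow_add₀ q_ne]
  ring

/-- The middle vector is even, so with `h` the height after the first half the contributions are
`q^h - 1`, `q^{-1}(q^{h+2} - q^h)` and `q^{-2}(q^{2h+2} - q^{h+2})`. -/
theorem sum_expo_odd (D : Datum m n) (h : m + n = rk m n + 1 + rk m n) :
    (q - q⁻¹) * ∑ a, (sgn (D.parity a) : Kq) * q ^ D.expo a
      = (q ^ D.heightN (rk m n) + q) * (q ^ D.heightN (rk m n) - q⁻¹)
      ∧ D.sdim₂ = 2 * D.heightN (rk m n) + 2 := by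
  have hN := D.two_lt
  have htop := D.heightN_top
  let a : Fin (m + n) := ⟨rk m n, by omega⟩
  have ha : a.rev = a := by
    rw [Fin.ext_iff, Fin.val_rev]; show m + n - (rk m n + 1) = rk m n; omega
  have h2 : D.sdim₂ = 2 * D.heightN (rk m n) + 2 := by
    have h3 := D.height_rev a
    rw [ha, D.parity_mid a ha, show sgn 0 = 1 from rfl] at h3
    have h6 : D.height a = D.heightN (rk m n) := rfl
    omega
  have h3 : D.heightN (rk m n + 1) = D.heightN (rk m n) + 2 := by
    have h4 := D.heightN_succ a
    rw [D.parity_mid a ha] at h4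
    exact h4
  refine ⟨?_, h2⟩
  rw [sum_expo]
  clear ha
  clear a
  generalize rk m n = r at *
  rw [h] at htop ⊢
  have h₁ : ∀ k ∈ Finset.range r, (q : Kq) ^ (if k < r then (0 : ℤ) else
      if (r + 1 + r) - (k + 1) < r then -2 else -1) * (q ^ D.heightN (k + 1) - q ^ D.heightN (k))
      = q ^ D.heightN (k + 1) - q ^ D.heightN k := fun k hk => by
    rw [if_pos (Finset.mem_range.1 hk), zpow_zero, one_mul]
  have h₂ : ∀ k ∈ Finset.range r, (q : Kq) ^ (if r + 1 + k < r then (0 : ℤ) else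
      if (r + 1 + r) - (r + 1 + k + 1) < r then -2 else -1)
      * (q ^ D.heightN (r + 1 + k + 1) - q ^ D.heightN (r + 1 + k))
      = q ^ (-2 : ℤ) * (q ^ D.heightN (r + 1 + (k + 1)) - q ^ D.heightN (r + 1 + k)) := fun k hk => by
    have := Finset.mem_range.1 hk
    rw [if_neg (by omega), if_pos (by omega), add_assoc (r + 1)]
  rw [Finset.sum_range_add, Finset.sum_range_succ, Finset.sum_congr rfl h₁, Finset.sum_congr rfl h₂,
    Finset.sum_range_sub (fun k => (q : Kq) ^ D.heightN k), ← Finset.mul_sum,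
    Finset.sum_range_sub (fun k => (q : Kq) ^ D.heightN (r + 1 + k)), htop, heightN_zero, h2,
    if_neg (lt_irrefl r), if_neg (by omega), add_zero, h3, two_mul]
  simp only [zpow_add₀ q_ne, zpow_neg, zpow_ofNat]
  have := q_ne
  generalize (q : Kq) ^ D.heightN r = Q
  field_simp
  ring

/-- Since `q` is transcendental, no power of it is `-1` and only the zeroth is `1`. One factor can
therefore never vanish; the other would need `h = 0` for even `N` or `h = -1` for odd `N`, that is,
`m = n`. -/
theorem sum_expo_ne_zero (D : Datum m n) (h : n ≠ m) :
    ∑ a, (sgn (D.parity a) : Kq) * q ^ D.expo a ≠ 0 := by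
  intro h0
  have hs := D.sdim₂_eq
  have hmn : (n : ℤ) ≠ m := by exact_mod_cast h
  rcases Nat.even_or_odd (m + n) with he | ho
  · rw [Nat.even_iff] at he
    obtain ⟨e, h2⟩ := D.sum_expo_even (by unfold rk; omega)
    rw [h0, mul_zero] at e
    rcases mul_eq_zero.1 e.symm with e | e
    · exact q_zpow_ne_one _ (by omega) (sub_eq_zero.1 e)
    · exact q_zpow_ne_neg_one _ (eq_neg_of_add_eq_zero_right e)
  · rw [Nat.odd_iff] at ho
    obtain ⟨e, h2⟩ := D.sum_expo_odd (by unfold rk; omega)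
    rw [h0, mul_zero] at e
    rcases mul_eq_zero.1 e.symm with e | e
    · apply q_zpow_ne_neg_one (D.heightN (rk m n) - 1)
      rw [zpow_sub₀ q_ne, zpow_one, div_eq_iff q_ne]
      linear_combination e
    · apply q_zpow_ne_one (D.heightN (rk m n) + 1) (by omega)
      rw [zpow_add₀ q_ne, zpow_one]
      have := mul_inv_cancel₀ q_ne
      linear_combination q * e + this

theorem coeff_sq (D : Datum m n) (a : Fin (m + n)) :
    D.coeff a * D.coeff a = q ^ D.expo a * (q ^ D.expo D.one)⁻¹ := by
  have h1 : (D.theta D.one * D.theta a) * (D.theta D.one * D.theta a) = 1 := by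
    rw [mul_mul_mul_comm, theta_sq, theta_sq, one_mul]
  have h2 : ((D.theta D.one * D.theta a : ℤ) : Kq) * (D.theta D.one * D.theta a : ℤ) = 1 := by
    exact_mod_cast h1
  rw [← zpow_neg, ← zpow_add₀ q_ne, q_zpow, two_mul, ← sub_eq_add_neg, zpow_add₀ qh_ne, coeff]
  linear_combination (qh ^ (D.expo a - D.expo D.one) * qh ^ (D.expo a - D.expo D.one)) * h2

/-- By `zero_weight`, `φ w_3` is `φ (v_1 ⊗ v_{1'})` times a signed sum of the `c_a²`. The `θ`'s
disappear in the squares, which leaves the superdimension sum up to a nonzero factor. -/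
theorem IsColowest.w₃ {D : Datum m n} {φ : D.V ⊗[Kq] D.V →ₗ[Kq] Kq} (h : D.IsColowest φ)
    (hmn : n ≠ m) (h₃ : φ (D.w₃ D.coeff) = 0) : φ (D.v D.one ⊗ₜ[Kq] D.v D.one.rev) = 0 := by
  have h1 : φ (D.w₃ D.coeff) = (sgn (D.parity D.one) : Kq) * (q ^ D.expo D.one)⁻¹
      * φ (D.v D.one ⊗ₜ[Kq] D.v D.one.rev)
      * ∑ a, (sgn (D.parity a) : Kq) * q ^ D.expo a := by
    rw [w₃_eq, map_sum, Finset.mul_sum]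
    refine Finset.sum_congr rfl fun a _ => ?_
    rw [map_smul, smul_eq_mul, h.zero_weight a, sgn_add]
    push_cast
    linear_combination (sgn (D.parity D.one) * sgn (D.parity a)
      * φ (D.v D.one ⊗ₜ[Kq] D.v D.one.rev) : Kq) * D.coeff_sq a
  rw [h₃] at h1
  have h2 := (mul_eq_zero.1 h1.symm).resolve_right (D.sum_expo_ne_zero hmn)
  exact (mul_eq_zero.1 h2).resolve_left
    (mul_ne_zero (sgn_cast_ne _) (inv_ne_zero (zpow_ne_zero _ q_ne)))

/-! ### Generation -/

/-- As `n` is even, it is `0`, `2` or `4`. The value `2` gives `m = n`, and `4` makes all vectors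
odd, including `v_s`. -/
theorem fork_four (D : Datum m n) (hF : D.Fork) (hN : m + n = 4) (hmn : n ≠ m) :
    m = 4 ∧ n = 0 := by
  have h1 := D.even_n
  have h2 : n ≠ 4 := by
    intro h
    have h3 : (Finset.univ.filter fun i => D.parity i = 1) = Finset.univ := by
      apply Finset.eq_univ_of_card
      rw [D.card_odd, Fintype.card_fin]
      omega
    have h4 : D.last ∈ Finset.univ.filter fun i => D.parity i = 1 := by rw [h3]; simp
    have h5 := (Finset.mem_filter.1 h4).2
    rw [hF.2] at h5
    exact absurd h5 (by decide)
  rw [Nat.even_iff] at h1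
  omega

theorem span_w₃_eq_top (D : Datum m n) (hmn : n ≠ m) (h4 : ¬ (m = 4 ∧ n = 0)) :
    Submodule.span D.Uq {D.w₁, D.w₂, D.w₃ D.coeff} = ⊤ := by
  refine D.submodule_eq_top _ fun φ hφ hM => ?_
  refine hφ.eq_zero_of_kills (hM _ (Submodule.subset_span (by simp)))
    (hM _ (Submodule.subset_span (by simp)))
    (hφ.w₃ hmn (hM _ (Submodule.subset_span (by simp)))) fun hF hN => ?_
  exact absurd (D.fork_four hF hN hmn) h4

/-- The raising operator `e_1` on `v_{1'}`. -/
theorem op_e_one_rev (D : Datum m n) (i : Fin (rk m n)) (hi : (i : ℕ) = 0) :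
    D.op (.e i) (D.v D.one.rev) = (D.coeffE i : Kq) • D.v D.two.rev := by
  have h := D.op_e_fst_rev i
  rw [D.fst_zero i hi, D.snd_zero i hi] at h
  exact h

theorem coeffE_ne (D : Datum m n) (i : Fin (rk m n)) : D.coeffE i ≠ 0 :=
  neg_ne_zero.2 (mul_ne_zero (mul_ne_zero (sgn_ne _) (D.theta_ne _)) (D.theta_ne _))

/-- The operator `e_1` kills `v_1` and sends `v_{1'}` to a nonzero multiple of `v_{2'}`, so the
submodule contains `v_1 ⊗ v_{2'}`, which is `v_1 ⊗ v_3` when `N = 4`. -/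
theorem vv_one_two_rev_eq_zero (D : Datum m n) (M : Submodule D.Uq D.TensorSquare)
    (φ : D.V ⊗[Kq] D.V →ₗ[Kq] Kq) (hM : ∀ w ∈ M, φ w = 0)
    (h : D.vv D.one D.one.rev ∈ M) : φ (D.v D.one ⊗ₜ[Kq] D.v D.two.rev) = 0 := by
  let i : Fin (rk m n) := ⟨0, D.rk_pos⟩
  have h1 := hM _ (M.smul_mem (D.gen (.e i)) h)
  rw [gen_smul, vv, op₂_e_vv, op_e_one, D.op_e_one_rev i rfl, map_add, map_smul, map_smul,
    TensorProduct.zero_tmul, map_zero, smul_zero, add_zero, TensorProduct.tmul_smul, map_smul] at h1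
  simpa [sgn_ne, coeffE_ne, zpow_ne_zero _ qh_ne] using h1

theorem vv_two_rev_one_eq_zero (D : Datum m n) (M : Submodule D.Uq D.TensorSquare)
    (φ : D.V ⊗[Kq] D.V →ₗ[Kq] Kq) (hM : ∀ w ∈ M, φ w = 0)
    (h : D.vv D.one.rev D.one ∈ M) : φ (D.v D.two.rev ⊗ₜ[Kq] D.v D.one) = 0 := by
  let i : Fin (rk m n) := ⟨0, D.rk_pos⟩
  have h1 := hM _ (M.smul_mem (D.gen (.e i)) h)
  rw [gen_smul, vv, op₂_e_vv, op_e_one, D.op_e_one_rev i rfl, map_add, map_smul, map_smul,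
    TensorProduct.tmul_zero, map_zero, smul_zero, zero_add, ← TensorProduct.smul_tmul',
    map_smul] at h1
  simpa [coeffE_ne, zpow_ne_zero _ qh_ne] using h1

theorem span_vv_one_one_rev_eq_top (D : Datum m n) :
    Submodule.span D.Uq {D.w₁, D.w₂, D.vv D.one D.one.rev} = ⊤ := by
  refine D.submodule_eq_top _ fun φ hφ hM => ?_
  have h := Submodule.subset_span (R := D.Uq)
    (show D.vv D.one D.one.rev ∈ ({D.w₁, D.w₂, D.vv D.one D.one.rev} : Set D.TensorSquare) by simp)
  exact hφ.eq_zero_of_kills (hM _ (Submodule.subset_span (by simp)))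
    (hM _ (Submodule.subset_span (by simp))) (hM _ h)
    fun _ _ => D.vv_one_two_rev_eq_zero _ φ hM h

theorem span_vv_one_rev_one_eq_top (D : Datum m n) :
    Submodule.span D.Uq {D.w₁, D.w₂, D.vv D.one.rev D.one} = ⊤ := by
  refine D.submodule_eq_top _ fun φ hφ hM => ?_
  have h := Submodule.subset_span (R := D.Uq)
    (show D.vv D.one.rev D.one ∈ ({D.w₁, D.w₂, D.vv D.one.rev D.one} : Set D.TensorSquare) by simp)
  refine hφ.eq_zero_of_kills (hM _ (Submodule.subset_span (by simp)))
    (hM _ (Submodule.subset_span (by simp))) ?_ fun hF hN => ?_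
  -- The values on `v_{1'} ⊗ v_1` and `v_1 ⊗ v_{1'}` differ by the factor `± c_{1'}`, which is
  -- invertible.
  · have h1 := hφ.zero_weight D.one.rev
    have h2 : φ (D.v D.one.rev ⊗ₜ[Kq] D.v D.one.rev.rev) = 0 := by
      rw [Fin.rev_rev]
      exact hM _ h
    rw [h2] at h1
    refine (mul_eq_zero.1 h1.symm).resolve_left (mul_ne_zero (sgn_cast_ne _) ?_)
    exact mul_ne_zero (Int.cast_ne_zero.2 (mul_ne_zero (D.theta_ne _) (D.theta_ne _)))
      (zpow_ne_zero _ qh_ne)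
  -- Here `e_1` yields the value on `v_3 ⊗ v_1`, and the relation from `f_2 (v_1 ⊗ v_1)` transfers
  -- its vanishing to `v_1 ⊗ v_3`.
  · obtain ⟨i, hi, hi'⟩ := D.exists_second_fork hF hN
    have h1 := hφ.one_snd i hi
    rw [hi', D.vv_two_rev_one_eq_zero _ φ hM h] at h1
    simpa [sgn_ne, zpow_ne_zero _ qh_ne] using h1

end Datum
end Osp

/-! ### The proposition. -/

theorem proposition3p2 (m n : ℕ) (D : Osp.Datum m n) :
    (∃! c, D.IsCoeff c) ∧ ∀ c, D.IsCoeff c →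
      (D.IsHighestWeight (2 • D.eps D.one) D.w₁ ∧
        D.IsHighestWeight (D.eps D.one + D.eps D.two) D.w₂ ∧
        D.IsHighestWeight 0 (D.w₃ c)) ∧
      (n ≠ m → ¬ (m = 4 ∧ n = 0) → Submodule.span D.Uq {D.w₁, D.w₂, D.w₃ c} = ⊤) ∧
      Submodule.span D.Uq {D.w₁, D.w₂, D.vv D.one D.one.rev} = ⊤ ∧
      Submodule.span D.Uq {D.w₁, D.w₂, D.vv D.one.rev D.one} = ⊤ := by
  refine ⟨⟨D.coeff, D.isCoeff_coeff, fun c hc => hc.eq_coeff⟩, fun c hc => ?_⟩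
  rw [hc.eq_coeff]
  exact ⟨⟨D.isHighestWeight_w₁, D.isHighestWeight_w₂, D.isHighestWeight_w₃⟩, D.span_w₃_eq_top,
    D.span_vv_one_one_rev_eq_top, D.span_vv_one_rev_one_eq_top⟩
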